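/- **Conventions.** Let $\mathbb F=\mathbb F_2$ and $V=\mathbb F[H][x]/(x^2=Hx)$, the Frobenius algebra over $\mathbb F[H]$ with basis $1,x$ and comultiplication $\Delta(1)=1\otimes x+x\otimes 1+H\,1\otimes 1$, $\Delta(x)=x\otimes x$. For a planar knot diagram $D$ let $CBN(D)$ be the Bar-Natan complex: the direct sum, over all choices $v$ of the $0$- or $1$-resolution at each crossing, of the tensor products $V^{\otimes(\text{circles of the resolution }v)}$, whose differential $d$ is the sum of the maps obtained by changing the resolution of one crossing from $0$ to $1$, each being the multiplication of $V$ (two circles merge) or $\Delta$ (one circle splits). A *transvergent diagram* of a strongly invertible knot is a planar diagram (on the sphere) which is preserved by the involution induced by the rotation by $\pi$ about an axis lying in the plane of the diagram: the plane is reflected in the axis and over- and under-strands are exchanged; the involution preserves the knot, reverses its orientation, and fixes two points of it, which lie on the axis. For a transvergent diagram $D$ the reflection maps the resolutions of $D$ to resolutions of $D$ and circles to circles, and so induces an involution $I_\tau$ of the complex $CBN(D)$. Put $$\widetilde{CBN}(D)=\mathrm{Cone}\bigl(CBN(D)\xrightarrow{\;1+I_\tau\;}CBN(D)\bigr),\qquad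 \tilde d=\begin{bmatrix} d&0\\ 1+I_\tau&d\end{bmatrix},$$ and for a strongly invertible knot $K$ given by a transvergent diagram let $\widetilde{CBN}(K)$ be the chain homotopy type of this complex over $\mathbb F[H]$. All chain maps and homotopies are $\mathbb F[H]$-linear and need not preserve gradings. Let $K$ and $J$ be strongly invertible knots. We say that $J$ is obtained from $K$ by a single *equivariant crossing change* if they have transvergent diagrams $D$ of $K$ and $D'$ of $J$ such that $D'$ is obtained from $D$ - **(Type A)** by changing a crossing off the axis and its mirror image, at the same time; - **(Type B)** by changing one crossing on the axis; or - **(Type C)** by letting two fixed points of the knot that are next to each other on the axis move along the axis and pass through each other: $D'$ is obtained by replacing two neighbouring arcs that cross the axis by a symmetric clasp with two crossings, exchanged by the reflection, or conversely such a clasp is replaced by two arcs that cross the axis without meeting each other (the clasp may have either sign). **Proposition.** Suppose that $J$ is obtained from $K$ by a single Type $X$ equivariant crossing change, $X\in\{A,B,C\}$, and let $t=2$ if $X=A$ and $t=1$ if $X=B$ or $X=C$. Then there are chain maps $f:\widetilde{CBN}(K)\to\widetilde{CBN}(J)$ and $g:\widetilde{CBN}(J)\to\widetilde{CBN}(K)$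 with $$g\circ f\simeq H^t\cdot\mathrm{id},\qquad f\circ g\simeq H^t\cdot\mathrm{id};$$ that is, such maps exist for any complexes that represent the two chain homotopy types. Moreover, on the complexes of $D$ and $D'$ the maps can be chosen as follows: there are chain maps $f_0:CBN(D)\to CBN(D')$ and $g_0:CBN(D')\to CBN(D)$ with $I_\tau f_0=f_0I_\tau$ and $I_\tau g_0=g_0I_\tau$, homotopies $h$ from $g_0f_0$ to $H^t\,\mathrm{id}_{CBN(D)}$ and $h'$ from $f_0g_0$ to $H^t\,\mathrm{id}_{CBN(D')}$, and $\mathbb F[H]$-linear maps $k,k'$ with $hI_\tau+I_\tau h=dk+kd$ and $h'I_\tau+I_\tau h'=dk'+k'd$; the maps $f=f_0\oplus f_0$ and $g=g_0\oplus g_0$ induced on the cones $\widetilde{CBN}(D)$, $\widetilde{CBN}(D')$ satisfy $gf\simeq H^t\,\mathrm{id}$ and $fg\simeq H^t\,\mathrm{id}$. -/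

import Mathlib

open CategoryTheory TensorProduct

/-! ### Diagrams -/

/-- The corners of a diagram: the corner `(i, k)` of crossing `i` lies between the half-edges `k` and
`k + 1`.  Two corners are adjacent when they lie on the same side of one and the same arc, at its two
ends.  The classes generated by adjacency are the faces of the diagram. -/
def cornerAdj {X E : Type} (arc : X → ZMod 4 → E) (p q : X × ZMod 4) : Prop :=
  q ≠ (p.1, p.2 + 1) ∧ arc q.1 q.2 = arc p.1 (p.2 + 1)

/-- A planar diagram (on the sphere) of an unoriented knot, as a planar diagram code.

The half-edges at a crossing are numbered counterclockwise by `ZMod 4`, in such a way that `0` and `2`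
belong to the under-strand and `1` and `3` to the over-strand; `arc i k` is the arc of the diagram to
which the half-edge `k` at the crossing `i` belongs. -/
structure KnotDiagram where
  /-- the crossings -/
  Crossing : Type
  /-- the arcs (edges of the underlying 4-valent graph) -/
  Arc : Type
  [fintypeCrossing : Fintype Crossing]
  [decidableEqCrossing : DecidableEq Crossing]
  [fintypeArc : Fintype Arc]
  arc : Crossing → ZMod 4 → Arc
  /-- An arc that meets a crossing has exactly two ends. (An arc without ends is a circle without
  crossings.) -/
  arc_ends : ∀ p : Crossing × ZMod 4, ∃! q : Crossing × ZMod 4, q ≠ p ∧ arc q.1 q.2 = arc p.1 p.2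
  nonempty : Nonempty Arc
  /-- There is one component: going straight through the crossings connects any two arcs. -/
  one_component : ∀ e e' : Arc,
    Relation.EqvGen (fun a b => ∃ i k, a = arc i k ∧ b = arc i (k + 2)) e e'
  /-- The diagram lies on the sphere: with `n ≥ 1` crossings there are `2n` arcs, so that the Euler
  characteristic is `2` exactly if there are `n + 2` faces. -/
  planar : Nonempty Crossing → Nat.card (Quot (cornerAdj arc)) = Nat.card Crossing + 2

attribute [instance] KnotDiagram.fintypeCrossing KnotDiagram.decidableEqCrossing
  KnotDiagram.fintypeArc

/-- A transvergent diagram of a strongly invertible knot: a knot diagram with the symmetry induced by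
the rotation `(x, y, z) ↦ (-x, y, -z)` about an axis in the plane of the diagram.  The plane is
reflected in the axis and over and under are exchanged, so that the half-edge `k` at `i` goes to the
half-edge `shift i - k` at `τ i`, with `shift i` odd.  The reflection fixes no half-edge; an
arc that is mapped to itself crosses the axis in a fixed point of the knot, and there is
such an arc exactly if the involution reverses the orientation of the knot. -/
structure TransvergentDiagram extends KnotDiagram where
  τ : Crossing → Crossing
  τArc : Arc → Arc
  shift : Crossing → ZMod 4
  τ_τ : ∀ i, τ (τ i) = i
  τArc_τArc : ∀ e, τArc (τArc e) = e
  shift_odd : ∀ i, shift i = 1 ∨ shift i = 3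
  shift_τ : ∀ i, shift (τ i) = shift i
  τArc_arc : ∀ i k, τArc (arc i k) = arc (τ i) (shift i - k)
  exists_fixed : ∃ e, τArc e = e

/-! ### The Frobenius algebra -/

/-- The ground ring `𝔽₂[H]`. -/
abbrev BNRing : Type := Polynomial (ZMod 2)

/-- The variable `H`. -/
noncomputable abbrev varH : BNRing := Polynomial.X

/-- The algebra `V = 𝔽₂[H][x] / (x² = H x)`, free over `𝔽₂[H]` on `1` and `x`: its elements are
`re + im · x` with `re` and `im` in `𝔽₂[H]`. -/
def BNAlg : Type := QuadraticAlgebra BNRing 0 varH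

namespace BNAlg

noncomputable instance : CommRing BNAlg :=
  inferInstanceAs (CommRing (QuadraticAlgebra BNRing 0 varH))

noncomputable instance : Algebra BNRing BNAlg :=
  inferInstanceAs (Algebra BNRing (QuadraticAlgebra BNRing 0 varH))

/-- The generator `x`. -/
noncomputable def x : BNAlg := QuadraticAlgebra.mk 0 1

/-- The coefficient of `1`. -/
noncomputable def coeffOne : BNAlg →ₗ[BNRing] BNRing where
  toFun v := QuadraticAlgebra.re v
  map_add' _ _ := rfl
  map_smul' _ _ := rfl

/-- The coefficient of `x`. -/
noncomputable def coeffX : BNAlg →ₗ[BNRing] BNRing where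
  toFun v := QuadraticAlgebra.im v
  map_add' _ _ := rfl
  map_smul' _ _ := rfl

/-- The comultiplication, `1 ↦ 1 ⊗ x + x ⊗ 1 + H · 1 ⊗ 1` and `x ↦ x ⊗ x`. -/
noncomputable def comul : BNAlg →ₗ[BNRing] BNAlg ⊗[BNRing] BNAlg :=
  coeffOne.smulRight
      ((1 : BNAlg) ⊗ₜ[BNRing] x + x ⊗ₜ[BNRing] (1 : BNAlg)
        + varH • ((1 : BNAlg) ⊗ₜ[BNRing] (1 : BNAlg)))
    + coeffX.smulRight (x ⊗ₜ[BNRing] x)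

end BNAlg

/-- The module `V^{⊗ S}` that the TQFT assigns to a collection `S` of circles. -/
abbrev circleModule (S : Type) : Type := ⨂[BNRing] _ : S, BNAlg

open Classical in
/-- The inclusion of the tensor factor of the circle `s`. -/
noncomputable def factor {S : Type} (s : S) : BNAlg →ₗ[BNRing] circleModule S :=
  (PiTensorProduct.singleAlgHom (R := BNRing) (A := fun _ : S => BNAlg) s).toLinearMap

/-- Move the tensor factors along a map `f` of circles: factors that arrive at the same circle are
multiplied. -/
noncomputable def relabel {S T : Type} [Fintype S] (f : S → T) :
    circleModule S →ₗ[BNRing] circleModule T :=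
  PiTensorProduct.lift
    ((MultilinearMap.mkPiAlgebra BNRing S (circleModule T)).compLinearMap fun s => factor (f s))

open Classical in
/-- Comultiply the tensor factor of the circle `c`, putting the two resulting factors at the circles
`a` and `b`; the factor of any other circle `s` goes to `f s`. -/
noncomputable def comulAt {S T : Type} [Fintype S] (c : S) (a b : T) (f : S → T) :
    circleModule S →ₗ[BNRing] circleModule T :=
  PiTensorProduct.lift
    ((MultilinearMap.mkPiAlgebra BNRing S (circleModule T)).compLinearMap fun s =>
      if s = c then
        LinearMap.mul' BNRing (circleModule T) ∘ₗ TensorProduct.map (factor a) (factor b) ∘ₗ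
          BNAlg.comul
      else factor (f s))

/-! ### The cube of resolutions -/

namespace KnotDiagram

variable (D : KnotDiagram)

/-- A choice of resolution at every crossing; `false` is the `0`-resolution. -/
abbrev State : Type := D.Crossing → Bool

/-- The arcs joined by the resolution `v`.  The `0`-resolution joins the half-edges `0`, `1` and the
half-edges `2`, `3`; the `1`-resolution joins `1`, `2` and `3`, `0`. -/
def Joined (v : D.State) (a b : D.Arc) : Prop :=
  ∃ (i : D.Crossing) (k : ZMod 4), (k = (if v i then 1 else 0) ∨ k = (if v i then 3 else 2)) ∧
    a = D.arc i k ∧ b = D.arc i (k + 1)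

/-- The circles of the resolved diagram. -/
abbrev Circle (v : D.State) : Type := Quot (D.Joined v)

/-- The circle that contains an arc. -/
def circle (v : D.State) (e : D.Arc) : D.Circle v := Quot.mk _ e

noncomputable instance (v : D.State) : Fintype (D.Circle v) :=
  Fintype.ofFinite _

open Classical in
/-- The map of the saddle at the crossing `i`, from the resolution `v` (with `v i = 0`) to the
resolution `w` (with `w i = 1`).  In either of them, the strands at the crossing lie on the circles
of the half-edges `0` and `2`.  All other circles of `v` are circles of `w`. -/
noncomputable def saddle (v w : D.State) (i : D.Crossing) :
    circleModule (D.Circle v) →ₗ[BNRing] circleModule (D.Circle w) :=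
  if D.circle w (D.arc i 0) = D.circle w (D.arc i 2) then
    relabel fun s => D.circle w (Quot.out s)
  else
    comulAt (D.circle v (D.arc i 0)) (D.circle w (D.arc i 0)) (D.circle w (D.arc i 2))
      fun s => D.circle w (Quot.out s)

/-- The module underlying the Bar-Natan complex. -/
abbrev Chain : Type := (v : D.State) → circleModule (D.Circle v)

/-- The differential of the Bar-Natan complex. -/
noncomputable def diff : D.Chain →ₗ[BNRing] D.Chain :=
  LinearMap.pi fun w => ∑ i with w i = true,
    D.saddle (Function.update w i false) w i ∘ₗ LinearMap.proj (Function.update w i false)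

end KnotDiagram


/-! ### Evaluation of tensors -/

namespace BNAlg

/-- The evaluation `x ↦ 0` or `x ↦ H`. -/
noncomputable def eval (b : Bool) : BNAlg →ₐ[BNRing] BNRing where
  toFun v := coeffOne v + (if b then varH else 0) * coeffX v
  map_one' := by
    change (1 : BNRing) + _ * 0 = 1
    ring
  map_mul' v w := by
    change (v.re * w.re + 0 * v.im * w.im) + _ * (v.re * w.im + v.im * w.re + varH * v.im * w.im) =
      (v.re + _ * v.im) * (w.re + _ * w.im)
    cases b
    · simp
    · simp
      ring
  map_zero' := by
    change (0 : BNRing) + _ * 0 = 0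
    ring
  map_add' v w := by
    change (v.re + w.re) + _ * (v.im + w.im) = (v.re + _ * v.im) + (w.re + _ * w.im)
    ring
  commutes' r := by
    change r + _ * 0 = r
    ring

lemma eval_x (b : Bool) : eval b x = if b then varH else 0 := by
  change (0 : BNRing) + _ * 1 = _
  ring

lemma eq_coeff (v : BNAlg) : v = coeffOne v • 1 + coeffX v • x := by
  apply QuadraticAlgebra.ext
  · change v.re = v.re * 1 + v.im * 0
    ring
  · change v.im = v.re * 0 + v.im * 1
    ring

lemma two_eq_zero : (2 : BNRing) = 0 := by
  have : ((2 : ℕ) : BNRing) = 0 := CharP.cast_eq_zero BNRing 2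
  simpa using this

/-- `H` times the idempotents that belong to the two evaluations. -/
noncomputable def idem (b : Bool) : BNAlg := if b then x else x + varH • 1

lemma sum_eval_idem (v : BNAlg) : ∑ b : Bool, eval b v • idem b = varH • v := by
  have h2 : ∀ r : BNRing, r + r = 0 := fun r => by
    rw [← two_mul, two_eq_zero, zero_mul]
  rw [Fintype.sum_bool]
  apply QuadraticAlgebra.ext
  · change (v.re + varH * v.im) * 0 + (v.re + 0 * v.im) * (0 + varH * 1) = varH * v.re
    ring
  · change (v.re + varH * v.im) * 1 + (v.re + 0 * v.im) * (1 + varH * 0) = varH * v.im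
    linear_combination h2 v.re

instance : Module.Free BNRing BNAlg :=
  inferInstanceAs (Module.Free BNRing (QuadraticAlgebra BNRing 0 varH))

end BNAlg

/-- The evaluation of a tensor, with `x ↦ 0` or `x ↦ H` at every circle. -/
noncomputable def evalAt {S : Type} [Fintype S] (ε : S → Bool) : circleModule S →ₐ[BNRing] BNRing :=
  PiTensorProduct.liftAlgHom
    ((MultilinearMap.mkPiAlgebra BNRing S BNRing).compLinearMap fun s =>
      (BNAlg.eval (ε s)).toLinearMap)
    (by simp) (by intro a b; simp [Finset.prod_mul_distrib])

section evaluation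

variable {S T : Type} [Fintype S] [Fintype T]

lemma evalAt_tprod (ε : S → Bool) (v : S → BNAlg) :
    evalAt ε (PiTensorProduct.tprod BNRing v) = ∏ s, BNAlg.eval (ε s) (v s) := by
  simp [evalAt, PiTensorProduct.liftAlgHom]

lemma evalAt_factor (ε : S → Bool) (s : S) (v : BNAlg) :
    evalAt ε (factor s v) = BNAlg.eval (ε s) v := by
  classical
  change evalAt ε (PiTensorProduct.tprod BNRing (Pi.mulSingle s v)) = _
  rw [evalAt_tprod, Finset.prod_eq_single s]
  · simp
  · intro t _ ht
    simp [Pi.mulSingle_eq_of_ne ht]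
  · simp

lemma evalAt_relabel (ε : T → Bool) (f : S → T) (y : circleModule S) :
    evalAt ε (relabel f y) = evalAt (ε ∘ f) y := by
  have h : (evalAt ε).toLinearMap ∘ₗ relabel f = (evalAt (ε ∘ f)).toLinearMap := by
    refine PiTensorProduct.ext (MultilinearMap.ext fun v => ?_)
    simp [relabel, evalAt_tprod, evalAt_factor]
  exact LinearMap.congr_fun h y

lemma evalAt_mul_comul (ε : T → Bool) (a b : T) (v : BNAlg) :
    evalAt ε (LinearMap.mul' BNRing (circleModule T)
      (TensorProduct.map (factor a) (factor b) (BNAlg.comul v))) =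
    if ε a = ε b then varH * BNAlg.eval (ε a) v else 0 := by
  have h2 : ∀ r : BNRing, r + r = 0 := fun r => by
    rw [← two_mul, BNAlg.two_eq_zero, zero_mul]
  have key : ∀ v, evalAt ε (LinearMap.mul' BNRing (circleModule T)
      (TensorProduct.map (factor a) (factor b) (BNAlg.comul v))) =
      BNAlg.coeffOne v * (BNAlg.eval (ε b) BNAlg.x + BNAlg.eval (ε a) BNAlg.x + varH) +
      BNAlg.coeffX v * (BNAlg.eval (ε a) BNAlg.x * BNAlg.eval (ε b) BNAlg.x) := by
    intro v
    simp [BNAlg.comul, evalAt_factor]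
    ring
  rw [key]
  change _ = if ε a = ε b then varH * (BNAlg.coeffOne v + _ * BNAlg.coeffX v) else 0
  simp only [BNAlg.eval_x]
  cases ε a <;> cases ε b <;> simp [h2]
  all_goals ring

open Classical in
lemma evalAt_comulAt (ε : T → Bool) (c : S) (a b : T) (f : S → T) (hf : f c = a ∨ f c = b)
    (y : circleModule S) :
    evalAt ε (comulAt c a b f y) =
      if ε a = ε b then varH * evalAt (ε ∘ f) y else 0 := by
  have h : (evalAt ε).toLinearMap ∘ₗ comulAt c a b f =
      (if ε a = ε b then varH else 0) • (evalAt (ε ∘ f)).toLinearMap := by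
    refine PiTensorProduct.ext (MultilinearMap.ext fun v => ?_)
    simp only [LinearMap.compMultilinearMap_apply, LinearMap.comp_apply, comulAt,
      PiTensorProduct.lift.tprod, MultilinearMap.compLinearMap_apply, MultilinearMap.mkPiAlgebra_apply,
      AlgHom.toLinearMap_apply, map_prod, LinearMap.smul_apply, evalAt_tprod, smul_eq_mul]
    rw [← Finset.mul_prod_erase _ _ (Finset.mem_univ c),
      ← Finset.mul_prod_erase Finset.univ (fun s => BNAlg.eval ((ε ∘ f) s) (v s))
        (Finset.mem_univ c), ← mul_assoc]
    refine congrArg₂ (HMul.hMul : BNRing → BNRing → BNRing) ?_ ?_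
    · rw [if_pos rfl]
      refine (evalAt_mul_comul ε a b (v c)).trans ?_
      by_cases hab : ε a = ε b
      · have : (ε ∘ f) c = ε a := by
          rcases hf with h | h <;> simp [h, hab]
        rw [if_pos hab, if_pos hab, this]
      · simp [hab]
    · refine Finset.prod_congr rfl fun s hs => ?_
      rw [if_neg (Finset.ne_of_mem_erase hs), evalAt_factor]
      rfl
  have := LinearMap.congr_fun h y
  simp only [LinearMap.comp_apply, AlgHom.toLinearMap_apply, LinearMap.smul_apply] at this
  rw [this]
  split_ifs <;> simp

lemma evalAt_injective {y z : circleModule S} (h : ∀ ε : S → Bool, evalAt ε y = evalAt ε z) :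
    y = z := by
  classical
  have key : ∀ y : circleModule S,
      ∑ ε : S → Bool, evalAt ε y • PiTensorProduct.tprod BNRing (fun s => BNAlg.idem (ε s)) =
        varH ^ Fintype.card S • y := by
    intro y
    have hl : ∑ ε : S → Bool, (evalAt ε).toLinearMap.smulRight
        (PiTensorProduct.tprod BNRing (fun s => BNAlg.idem (ε s))) =
        varH ^ Fintype.card S • LinearMap.id := by
      ext v
      simp only [LinearMap.compMultilinearMap_apply, LinearMap.sum_apply, LinearMap.smulRight_apply,
        AlgHom.toLinearMap_apply, evalAt_tprod, LinearMap.smul_apply, LinearMap.id_apply]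
      have h1 := MultilinearMap.map_sum (PiTensorProduct.tprod BNRing (s := fun _ : S => BNAlg))
        (fun (s : S) (b : Bool) => BNAlg.eval b (v s) • BNAlg.idem b)
      have h2 : (fun s => ∑ b : Bool, BNAlg.eval b (v s) • BNAlg.idem b) = fun s => varH • v s :=
        funext fun s => BNAlg.sum_eval_idem (v s)
      rw [h2, MultilinearMap.map_smul_univ] at h1
      simp only [MultilinearMap.map_smul_univ] at h1
      rw [← h1, Finset.prod_const, Finset.card_univ]
    simpa using LinearMap.congr_fun hl y
  have hyz : varH ^ Fintype.card S • y = varH ^ Fintype.card S • z := by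
    rw [← key, ← key]
    exact Finset.sum_congr rfl fun ε _ => by rw [h ε]
  have hfree : Module.Free BNRing (circleModule S) :=
    Module.Free.of_basis (Basis.piTensorProduct fun _ : S => Module.Free.chooseBasis BNRing BNAlg)
  exact smul_right_injective _ (pow_ne_zero _ Polynomial.X_ne_zero) hyz

end evaluation


/-! ### Permutations and quotients -/

lemma sameCycle_mul_swap {α : Type} [Finite α] [DecidableEq α] (π : Equiv.Perm α) {a b : α}
    (hab : a ≠ b) : (π * Equiv.swap a b).SameCycle a b ↔ ¬ π.SameCycle a b := by
  classical
  have hex : ∃ n, 0 < n ∧ ((π ^ n) a = a ∨ (π ^ n) a = b) :=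
    ⟨orderOf π, orderOf_pos π, Or.inl (by rw [pow_orderOf_eq_one]; rfl)⟩
  obtain ⟨hn0, hn⟩ := Nat.find_spec hex
  have hmin : ∀ m, 0 < m → m < Nat.find hex → (π ^ m) a ≠ a ∧ (π ^ m) a ≠ b := by
    intro m hm0 hm
    have := Nat.find_min hex hm
    tauto
  set n := Nat.find hex
  set σ := π * Equiv.swap a b with hσ
  have hpow : ∀ m, 0 < m → m ≤ n → (σ ^ m) b = (π ^ m) a := by
    intro m hm0 hm
    induction m with
    | zero => omega
    | succ m ih =>
      rcases Nat.eq_zero_or_pos m with rfl | hpos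
      · simp [hσ]
      · obtain ⟨h1, h2⟩ := hmin m hpos (by omega)
        rw [pow_succ', Equiv.Perm.mul_apply, ih hpos (by omega), hσ, Equiv.Perm.mul_apply,
          Equiv.swap_apply_of_ne_of_ne h1 h2, pow_succ', Equiv.Perm.mul_apply]
  have hmod : ∀ (ρ : Equiv.Perm α) (c : α), (ρ ^ n) c = c → ∀ k, (ρ ^ k) c = (ρ ^ (k % n)) c := by
    intro ρ c hc k
    have h1 : ∀ q, ((ρ ^ n) ^ q) c = c := by
      intro q
      induction q with
      | zero => rfl
      | succ q ih => rw [pow_succ, Equiv.Perm.mul_apply, hc, ih]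
    conv_lhs => rw [← Nat.mod_add_div k n, pow_add, pow_mul, Equiv.Perm.mul_apply, h1]
  rcases hn with hn | hn
  · have h1 : σ.SameCycle b a := ⟨n, by rw [zpow_natCast, hpow n hn0 le_rfl, hn]⟩
    refine iff_of_true h1.symm fun h => ?_
    obtain ⟨k, hk⟩ := h.exists_nat_pow_eq
    rw [hmod π a hn k] at hk
    rcases Nat.eq_zero_or_pos (k % n) with h0 | h0
    · rw [h0] at hk
      exact hab hk
    · exact (hmin _ h0 (Nat.mod_lt _ hn0)).2 hk
  · have h1 : π.SameCycle a b := ⟨n, by rw [zpow_natCast, hn]⟩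
    refine iff_of_false (fun h => ?_) (not_not.2 h1)
    have hb : (σ ^ n) b = b := by rw [hpow n hn0 le_rfl, hn]
    obtain ⟨k, hk⟩ := h.symm.exists_nat_pow_eq
    rw [hmod σ b hb k] at hk
    rcases Nat.eq_zero_or_pos (k % n) with h0 | h0
    · rw [h0] at hk
      exact hab hk.symm
    · have hlt := Nat.mod_lt k hn0
      rw [hpow _ h0 hlt.le] at hk
      exact (hmin _ h0 hlt).1 hk

/-- Add the relation `a ~ b`. -/
def addRel {α : Type} (r : α → α → Prop) (a b : α) : α → α → Prop :=
  fun s t => r s t ∨ (s = a ∧ t = b)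

lemma card_quot_congr {α : Type} [Finite α] {r s : α → α → Prop}
    (h1 : ∀ x y, r x y → Quot.mk s x = Quot.mk s y)
    (h2 : ∀ x y, s x y → Quot.mk r x = Quot.mk r y) : Nat.card (Quot r) = Nat.card (Quot s) := by
  refine Nat.card_congr
    ⟨Quot.lift (fun x => Quot.mk s x) h1, Quot.lift (fun x => Quot.mk r x) h2, ?_, ?_⟩
  · rintro ⟨x⟩
    rfl
  · rintro ⟨x⟩
    rfl

lemma card_quot_addRel_of_eq {α : Type} [Finite α] {r : α → α → Prop} {a b : α}
    (h : Quot.mk r a = Quot.mk r b) : Nat.card (Quot r) = Nat.card (Quot (addRel r a b)) := by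
  refine card_quot_congr (fun x y hxy => Quot.sound (Or.inl hxy)) fun x y hxy => ?_
  rcases hxy with hxy | ⟨rfl, rfl⟩
  · exact Quot.sound hxy
  · exact h

lemma card_quot_addRel_of_ne {α : Type} [Finite α] {r : α → α → Prop} {a b : α}
    (h : Quot.mk r a ≠ Quot.mk r b) :
    Nat.card (Quot r) = Nat.card (Quot (addRel r a b)) + 1 := by
  classical
  have hfin : Finite (Quot (addRel r a b)) := inferInstance
  have hproj : ∀ x y, r x y → Quot.mk (addRel r a b) x = Quot.mk (addRel r a b) y :=
    fun x y hxy => Quot.sound (Or.inl hxy)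
  let proj : Quot r → Quot (addRel r a b) := Quot.lift (fun x => Quot.mk _ x) hproj
  let back : Quot (addRel r a b) → Quot r :=
    Quot.lift (fun x => if Quot.mk r x = Quot.mk r b then Quot.mk r a else Quot.mk r x) (by
      rintro x y (hxy | ⟨rfl, rfl⟩)
      · have := Quot.sound hxy
        simp only [this]
      · simp)
  have hback : ∀ x, x ≠ Quot.mk r b → back (proj x) = x := by
    rintro ⟨x⟩ hx
    exact if_neg hx
  let F : Quot r → Option (Quot (addRel r a b)) :=
    fun x => if x = Quot.mk r b then none else some (proj x)
  have hF : Function.Bijective F := by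
    constructor
    · intro x y hxy
      by_cases hx : x = Quot.mk r b <;> by_cases hy : y = Quot.mk r b
      · rw [hx, hy]
      · simp [F, hx, hy] at hxy
      · simp [F, hx, hy] at hxy
      · simp only [F, if_neg hx, if_neg hy, Option.some.injEq] at hxy
        rw [← hback x hx, ← hback y hy, hxy]
    · rintro (_ | ⟨⟨e⟩⟩)
      · exact ⟨Quot.mk r b, if_pos rfl⟩
      · by_cases he : Quot.mk r e = Quot.mk r b
        · refine ⟨Quot.mk r a, ?_⟩
          have : proj (Quot.mk r a) = proj (Quot.mk r e) := by
            rw [he]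
            exact Quot.sound (Or.inr ⟨rfl, rfl⟩)
          simp only [F, if_neg h, this]
          rfl
        · exact ⟨Quot.mk r e, if_neg he⟩
  rw [Nat.card_congr (Equiv.ofBijective F hF), Finite.card_option]


/-! ### Planarity: the half-edges of a planar diagram can be directed in and out alternately -/

namespace KnotDiagram

variable (D : KnotDiagram)

/-- The other end of the arc of a half-edge. -/
noncomputable def opp (p : D.Crossing × ZMod 4) : D.Crossing × ZMod 4 := (D.arc_ends p).choose

lemma opp_ne (p : D.Crossing × ZMod 4) : D.opp p ≠ p := (D.arc_ends p).choose_spec.1.1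

lemma arc_opp (p : D.Crossing × ZMod 4) : D.arc (D.opp p).1 (D.opp p).2 = D.arc p.1 p.2 :=
  (D.arc_ends p).choose_spec.1.2

lemma eq_opp {p q : D.Crossing × ZMod 4} (h : q ≠ p) (h' : D.arc q.1 q.2 = D.arc p.1 p.2) :
    q = D.opp p := (D.arc_ends p).choose_spec.2 q ⟨h, h'⟩

lemma opp_opp (p : D.Crossing × ZMod 4) : D.opp (D.opp p) = p :=
  (D.eq_opp (D.opp_ne p).symm (D.arc_opp p).symm).symm

lemma eq_or_eq_opp {p q : D.Crossing × ZMod 4} (h : D.arc q.1 q.2 = D.arc p.1 p.2) :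
    q = p ∨ q = D.opp p := by
  by_cases hq : q = p
  · exact Or.inl hq
  · exact Or.inr (D.eq_opp hq h)

lemma exists_arc_eq [hX : Nonempty D.Crossing] (e : D.Arc) :
    ∃ p : D.Crossing × ZMod 4, D.arc p.1 p.2 = e := by
  obtain ⟨i⟩ := hX
  have key : ∀ a b, Relation.EqvGen (fun a b => ∃ i k, a = D.arc i k ∧ b = D.arc i (k + 2)) a b →
      ((∃ p : D.Crossing × ZMod 4, D.arc p.1 p.2 = a) ↔
        ∃ p : D.Crossing × ZMod 4, D.arc p.1 p.2 = b) := by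
    intro a b h
    induction h with
    | rel a b h =>
      obtain ⟨i, k, rfl, rfl⟩ := h
      exact iff_of_true ⟨(i, k), rfl⟩ ⟨(i, k + 2), rfl⟩
    | refl a => rfl
    | symm a b _ ih => exact ih.symm
    | trans a b c _ _ h1 h2 => exact h1.trans h2
  exact (key _ _ (D.one_component (D.arc i 0) e)).1 ⟨(i, 0), rfl⟩

lemma eq_of_opp_of_straight [Nonempty D.Crossing] {K : Type} (ρ : D.Crossing × ZMod 4 → K)
    (h1 : ∀ p, ρ (D.opp p) = ρ p) (h2 : ∀ i k, ρ (i, k) = ρ (i, k + 2))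
    (p q : D.Crossing × ZMod 4) : ρ p = ρ q := by
  have hsame : ∀ p q : D.Crossing × ZMod 4, D.arc q.1 q.2 = D.arc p.1 p.2 → ρ p = ρ q := by
    intro p q h
    rcases D.eq_or_eq_opp h with rfl | rfl
    · rfl
    · exact (h1 p).symm
  have key : ∀ a b, Relation.EqvGen (fun a b => ∃ i k, a = D.arc i k ∧ b = D.arc i (k + 2)) a b →
      ∀ p q : D.Crossing × ZMod 4, D.arc p.1 p.2 = a → D.arc q.1 q.2 = b → ρ p = ρ q := by
    intro a b h
    induction h with
    | rel a b h =>
      obtain ⟨i, k, rfl, rfl⟩ := h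
      intro p q hp hq
      rw [← hsame (i, k) p hp, ← hsame (i, k + 2) q hq]
      exact h2 i k
    | refl a => exact fun p q hp hq => hsame p q (hq.trans hp.symm)
    | symm a b _ ih => exact fun p q hp hq => (ih q p hq hp).symm
    | trans a b c _ _ ih1 ih2 =>
      intro p q hp hq
      obtain ⟨r, hr⟩ := D.exists_arc_eq b
      exact (ih1 p r hp hr).trans (ih2 r q hr hq)
  exact key _ _ (D.one_component _ _) p q rfl rfl

lemma sum_arc_eq {K : Type} [AddCommMonoid K] [DecidableEq D.Arc] (ρ : D.Crossing × ZMod 4 → K)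
    (p : D.Crossing × ZMod 4) :
    ∑ q with D.arc q.1 q.2 = D.arc p.1 p.2, ρ q = ρ p + ρ (D.opp p) := by
  classical
  have : (Finset.univ.filter fun q : D.Crossing × ZMod 4 => D.arc q.1 q.2 = D.arc p.1 p.2) =
      {p, D.opp p} := by
    ext q
    simp only [Finset.mem_filter, Finset.mem_univ, true_and, Finset.mem_insert,
      Finset.mem_singleton]
    constructor
    · exact D.eq_or_eq_opp
    · rintro (rfl | rfl)
      · rfl
      · exact D.arc_opp p
  rw [this, Finset.sum_pair (D.opp_ne p).symm]

/-- The next corner of a face. -/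
noncomputable def nextCorner : Equiv.Perm (D.Crossing × ZMod 4) where
  toFun p := D.opp (p.1, p.2 + 1)
  invFun p := ((D.opp p).1, (D.opp p).2 - 1)
  left_inv p := by simp [opp_opp]
  right_inv p := by simp [opp_opp]

lemma exists_orientation : ∃ o : D.Crossing × ZMod 4 → ZMod 2,
    (∀ i k, o (i, k + 1) = o (i, k) + 1) ∧ ∀ p, o (D.opp p) = o p + 1 := by
  classical
  rcases isEmpty_or_nonempty D.Crossing with hX | hX
  · exact ⟨fun _ => 0, fun i => hX.elim i, fun p => hX.elim p.1⟩
  let Face := Quot (cornerAdj D.arc)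
  have : Finite Face := inferInstanceAs (Finite (Quot _))
  let _ : Fintype Face := Fintype.ofFinite _
  let fc : D.Crossing × ZMod 4 → Face := Quot.mk _
  have hfc : ∀ p, fc (D.nextCorner p) = fc p := fun p =>
    (Quot.sound ⟨D.opp_ne _, D.arc_opp _⟩).symm
  let c := ZMod.castHom (show 2 ∣ 4 by norm_num) (ZMod 2)
  have h2 : ∀ r : ZMod 2, r + r = 0 := by decide
  -- the coboundary map and the incidence matrix of arcs and faces
  let δ : (D.Crossing → ZMod 2) →ₗ[ZMod 2] (D.Arc → ZMod 2) :=
    { toFun := fun a e => ∑ p : D.Crossing × ZMod 4 with D.arc p.1 p.2 = e, a p.1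
      map_add' := fun a b => by
        ext e
        simp [Finset.sum_add_distrib]
      map_smul' := fun r a => by
        ext e
        simp [Finset.mul_sum] }
  let M : Matrix D.Arc Face (ZMod 2) := fun e f =>
    ∑ p : D.Crossing × ZMod 4 with D.arc p.1 p.2 = e, if fc p = f then 1 else 0
  have hδ : ∀ a p, δ a (D.arc p.1 p.2) = a p.1 + a (D.opp p).1 := fun a p =>
    D.sum_arc_eq (fun q => a q.1) p
  have hM : ∀ φ p, M.mulVec φ (D.arc p.1 p.2) = φ (fc p) + φ (fc (D.opp p)) := by
    intro φ p
    rw [← D.sum_arc_eq (fun q => φ (fc q)) p]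
    simp only [Matrix.mulVec, dotProduct, M, Finset.sum_mul]
    rw [Finset.sum_comm]
    simp
  have hMT : ∀ g f, M.transpose.mulVec g f =
      ∑ p : D.Crossing × ZMod 4, if fc p = f then g (D.arc p.1 p.2) else 0 := by
    intro g f
    change ∑ e, (∑ p : D.Crossing × ZMod 4 with D.arc p.1 p.2 = e,
      if fc p = f then (1 : ZMod 2) else 0) * g e = _
    simp only [Finset.sum_mul, Finset.sum_filter]
    rw [Finset.sum_comm]
    refine Finset.sum_congr rfl fun p _ => ?_
    simp
  -- going around the faces
  have hround : ∀ (ρ : D.Crossing × ZMod 4 → ZMod 2) f,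
      (∑ p, if fc p = f then ρ p else 0) = ∑ p, if fc p = f then ρ (D.nextCorner p) else 0 := by
    intro ρ f
    rw [← Equiv.sum_comp D.nextCorner]
    simp only [hfc]
  let b : D.Arc → ZMod 2 := fun e => 1 + ∑ p : D.Crossing × ZMod 4 with D.arc p.1 p.2 = e, c p.2
  have hb : ∀ p, b (D.arc p.1 p.2) = 1 + (c p.2 + c (D.opp p).2) := fun p =>
    congrArg (1 + ·) (D.sum_arc_eq (fun q => c q.2) p)
  have hnext : ∀ p, D.opp (D.nextCorner p) = (p.1, p.2 + 1) := fun p => D.opp_opp _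
  have hbker : b ∈ LinearMap.ker M.transpose.mulVecLin := by
    ext f
    rw [Matrix.mulVecLin_apply, hMT]
    have e1 : ∀ p, (if fc p = f then b (D.arc p.1 p.2) else 0) =
        (if fc p = f then 1 + c p.2 else 0) + if fc p = f then c (D.opp p).2 else 0 := by
      intro p
      rw [hb]
      split_ifs <;> ring
    rw [Finset.sum_congr rfl fun p _ => e1 p, Finset.sum_add_distrib,
      hround fun p => c (D.opp p).2, ← Finset.sum_add_distrib]
    refine Finset.sum_eq_zero fun p _ => ?_
    rw [hnext]
    split_ifs
    · rw [map_add, map_one, add_comm 1 (c p.2)]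
      exact h2 _
    · simp
  have hδker : LinearMap.range δ ≤ LinearMap.ker M.transpose.mulVecLin := by
    rintro _ ⟨a, rfl⟩
    ext f
    rw [Matrix.mulVecLin_apply, hMT]
    have e1 : ∀ p, (if fc p = f then δ a (D.arc p.1 p.2) else 0) =
        (if fc p = f then a p.1 else 0) + if fc p = f then a (D.opp p).1 else 0 := by
      intro p
      rw [hδ]
      split_ifs <;> ring
    rw [Finset.sum_congr rfl fun p _ => e1 p, Finset.sum_add_distrib,
      hround fun p => a (D.opp p).1, ← Finset.sum_add_distrib]
    refine Finset.sum_eq_zero fun p _ => ?_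
    rw [hnext]
    split_ifs
    · exact h2 _
    · simp
  -- dimensions
  have hcardE : 2 * Fintype.card D.Arc = 4 * Fintype.card D.Crossing := by
    have e1 : Fintype.card (D.Crossing × ZMod 4) = ∑ e : D.Arc, 2 := by
      rw [← Finset.card_univ, Finset.card_eq_sum_card_fiberwise
        (f := fun p : D.Crossing × ZMod 4 => D.arc p.1 p.2) (t := Finset.univ) (by simp)]
      refine Finset.sum_congr rfl fun e _ => ?_
      obtain ⟨p, rfl⟩ := D.exists_arc_eq e
      rw [Finset.card_eq_sum_ones, D.sum_arc_eq (fun _ => 1) p]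
    rw [Fintype.card_prod, ZMod.card, Finset.sum_const, Finset.card_univ, smul_eq_mul] at e1
    omega
  have hcardF : Fintype.card Face = Fintype.card D.Crossing + 2 := by
    have := D.planar hX
    rwa [Nat.card_eq_fintype_card, Nat.card_eq_fintype_card] at this
  have hcardX : 0 < Fintype.card D.Crossing := Fintype.card_pos
  have hkerδ : Module.finrank (ZMod 2) (LinearMap.ker δ) ≤ 1 := by
    refine finrank_le_one (⟨fun _ => 1, ?_⟩ : LinearMap.ker δ) ?_
    · rw [LinearMap.mem_ker]
      ext e
      obtain ⟨p, rfl⟩ := D.exists_arc_eq e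
      rw [hδ]
      exact h2 1
    · rintro ⟨a, ha⟩
      rw [LinearMap.mem_ker] at ha
      refine ⟨a hX.some, Subtype.ext (funext fun i => ?_)⟩
      have := D.eq_of_opp_of_straight (fun p => a p.1) (fun p => by
        have := congrFun ha (D.arc p.1 p.2)
        rw [hδ] at this
        calc a (D.opp p).1 = (a p.1 + a (D.opp p).1) + a p.1 := by
              rw [add_right_comm, h2, zero_add]
          _ = a p.1 := by rw [this]; simp) (fun _ _ => rfl) (hX.some, 0) (i, 0)
      simpa using this
  have hkerM : Module.finrank (ZMod 2) (LinearMap.ker M.mulVecLin) ≤ 1 := by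
    refine finrank_le_one (⟨fun _ => 1, ?_⟩ : LinearMap.ker M.mulVecLin) ?_
    · rw [LinearMap.mem_ker]
      ext e
      obtain ⟨p, rfl⟩ := D.exists_arc_eq e
      rw [Matrix.mulVecLin_apply, hM]
      exact h2 1
    · rintro ⟨φ, hφ⟩
      rw [LinearMap.mem_ker] at hφ
      refine ⟨φ (fc (hX.some, 0)), Subtype.ext (funext fun f => ?_)⟩
      obtain ⟨q, rfl⟩ := Quot.exists_rep f
      have hopp : ∀ p, φ (fc (D.opp p)) = φ (fc p) := by
        intro p
        have := congrFun hφ (D.arc p.1 p.2)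
        rw [Matrix.mulVecLin_apply, hM] at this
        calc φ (fc (D.opp p)) = (φ (fc p) + φ (fc (D.opp p))) + φ (fc p) := by
              rw [add_right_comm, h2, zero_add]
          _ = φ (fc p) := by rw [this]; simp
      have hstep : ∀ i k, φ (fc (i, k)) = φ (fc (i, k + 1)) := by
        intro i k
        rw [← hopp (i, k + 1), ← hfc (i, k)]
        rfl
      have := D.eq_of_opp_of_straight (fun p => φ (fc p)) hopp (fun i k => by
        rw [hstep, hstep i (k + 1), add_assoc]
        rfl) (hX.some, 0) q
      simpa using this
  have hle : LinearMap.ker M.transpose.mulVecLin = LinearMap.range δ := by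
    refine (Submodule.eq_of_le_of_finrank_le hδker ?_).symm
    have r1 := LinearMap.finrank_range_add_finrank_ker δ
    have r2 := LinearMap.finrank_range_add_finrank_ker M.mulVecLin
    have r3 := LinearMap.finrank_range_add_finrank_ker M.transpose.mulVecLin
    have r4 : Module.finrank (ZMod 2) (LinearMap.range M.transpose.mulVecLin) =
        Module.finrank (ZMod 2) (LinearMap.range M.mulVecLin) := M.rank_transpose
    rw [Module.finrank_fintype_fun_eq_card] at r1 r2 r3
    omega
  obtain ⟨a, ha⟩ : b ∈ LinearMap.range δ := hle ▸ hbker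
  refine ⟨fun p => a p.1 + c p.2, fun i k => ?_, fun p => ?_⟩
  · change a i + c (k + 1) = a i + c k + 1
    rw [map_add, map_one, add_assoc]
  · have := congrFun ha (D.arc p.1 p.2)
    rw [hδ, hb] at this
    linear_combination this - h2 (a p.1) + h2 (c (D.opp p).2)

end KnotDiagram


/-! ### A saddle merges two circles or splits one circle -/

namespace KnotDiagram

variable (D : KnotDiagram)

/-- The half-edge to which a resolution joins the half-edge `k`. -/
def partner (b : Bool) (k : ZMod 4) : ZMod 4 := if b then 3 - k else 1 - k

lemma partner_eq (b : Bool) (k : ZMod 4) : partner b k = k + 1 ∨ k = partner b k + 1 := by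
  revert b k
  decide

lemma partner_partner (b : Bool) (k : ZMod 4) : partner b (partner b k) = k := by
  revert b k
  decide

lemma partner_of_joined (b : Bool) (k : ZMod 4)
    (h : k = (if b then 1 else 0) ∨ k = (if b then 3 else 2)) : partner b k = k + 1 := by
  revert b k
  decide

variable {D}

lemma circle_eq_of_joined {v : D.State} {a b : D.Arc} (h : D.Joined v a b) :
    D.circle v a = D.circle v b := Quot.sound h

lemma circle_out {v : D.State} (s : D.Circle v) : D.circle v (Quot.out s) = s := Quot.out_eq s

lemma circle_partner (v : D.State) (i : D.Crossing) (k : ZMod 4) :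
    D.circle v (D.arc i (partner (v i) k)) = D.circle v (D.arc i k) := by
  have key : ∀ (b : Bool) (k : ZMod 4),
      ((k = (if b then 1 else 0) ∨ k = (if b then 3 else 2)) ∧ partner b k = k + 1) ∨
      ((partner b k = (if b then 1 else 0) ∨ partner b k = (if b then 3 else 2)) ∧
        k = partner b k + 1) := by decide
  rcases key (v i) k with ⟨h1, h2⟩ | ⟨h1, h2⟩
  · exact (circle_eq_of_joined ⟨i, k, h1, rfl, by rw [h2]⟩).symm
  · exact circle_eq_of_joined ⟨i, partner (v i) k, h1, rfl, by rw [← h2]⟩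

lemma circle_zero_one {v : D.State} {i : D.Crossing} (h : v i = false) :
    D.circle v (D.arc i 1) = D.circle v (D.arc i 0) := by
  have := circle_partner v i 0
  rwa [h] at this

lemma circle_two_three {v : D.State} {i : D.Crossing} (h : v i = false) :
    D.circle v (D.arc i 3) = D.circle v (D.arc i 2) := by
  have := circle_partner v i 2
  rwa [h] at this

lemma circle_one_two {v : D.State} {i : D.Crossing} (h : v i = true) :
    D.circle v (D.arc i 1) = D.circle v (D.arc i 2) := by
  have := circle_partner v i 2
  rwa [h] at this

lemma circle_three_zero {v : D.State} {i : D.Crossing} (h : v i = true) :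
    D.circle v (D.arc i 3) = D.circle v (D.arc i 0) := by
  have := circle_partner v i 0
  rwa [h] at this

lemma circle_merge_or_split {v w : D.State} {i : D.Crossing} (hv : v i = false) (hw : w i = true)
    (hvw : ∀ j, j ≠ i → v j = w j) :
    D.circle w (D.arc i 0) = D.circle w (D.arc i 2) ↔
      ¬ D.circle v (D.arc i 0) = D.circle v (D.arc i 2) := by
  classical
  have : Nonempty D.Crossing := ⟨i⟩
  obtain ⟨o, ho1, ho2⟩ := D.exists_orientation
  have hz : ∀ r : ZMod 2, r = 0 ∨ r = 1 := by decide
  have hpart : ∀ b j k, o (j, partner b k) = o (j, k) + 1 := by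
    intro b j k
    rcases partner_eq b k with h | h
    · rw [h, ho1]
    · conv_rhs => rw [h, ho1, add_assoc]
      rw [show (1 + 1 : ZMod 2) = 0 by decide, add_zero]
  -- an arc has one end at which it arrives and one at which it departs
  have hdir : ∀ p q : D.Crossing × ZMod 4, o p = o q → D.arc p.1 p.2 = D.arc q.1 q.2 → p = q := by
    intro p q h h'
    rcases D.eq_or_eq_opp h' with rfl | rfl
    · rfl
    · rw [ho2] at h
      simp at h
  have hin : ∀ e : D.Arc, ∃ p : D.Crossing × ZMod 4, o p = 1 ∧ D.arc p.1 p.2 = e := by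
    intro e
    obtain ⟨p, rfl⟩ := D.exists_arc_eq e
    rcases hz (o p) with h | h
    · exact ⟨D.opp p, by rw [ho2, h, zero_add], D.arc_opp p⟩
    · exact ⟨p, h, rfl⟩
  choose hd hd1 hd2 using hin
  have hd_eq : ∀ p, o p = 1 → hd (D.arc p.1 p.2) = p := fun p hp =>
    hdir _ _ ((hd1 _).trans hp.symm) (hd2 _)
  -- the arc that follows an arc on its circle
  let nx : D.State → D.Arc → D.Arc := fun u e => D.arc (hd e).1 (partner (u (hd e).1) (hd e).2)
  have hnx : ∀ u, Function.Injective (nx u) := by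
    intro u e e' h
    have := hdir ((hd e).1, partner (u (hd e).1) (hd e).2)
      ((hd e').1, partner (u (hd e').1) (hd e').2) (by rw [hpart, hpart, hd1, hd1]) h
    rw [Prod.mk.injEq] at this
    obtain ⟨h1, h2⟩ := this
    rw [h1] at h2
    have h3 := congrArg (partner (u (hd e').1)) h2
    rw [partner_partner, partner_partner] at h3
    rw [← hd2 e, ← hd2 e', h1, h3]
  let π : D.State → Equiv.Perm D.Arc := fun u =>
    Equiv.ofBijective (nx u) (Finite.injective_iff_bijective.1 (hnx u))
  have hπ : ∀ u p, o p = 1 → π u (D.arc p.1 p.2) = D.arc p.1 (partner (u p.1) p.2) := by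
    intro u p hp
    change nx u _ = _
    simp only [nx, hd_eq p hp]
  have hcyc : ∀ u a b, D.circle u a = D.circle u b ↔ (π u).SameCycle a b := by
    intro u a b
    constructor
    · intro h
      have hE := Quot.eqvGen_exact h
      clear h
      induction hE with
      | rel a b h =>
        obtain ⟨j, k, hk, rfl, rfl⟩ := h
        have hk' := partner_of_joined _ _ hk
        rcases hz (o (j, k)) with h | h
        · have h1 : o (j, k + 1) = 1 := by rw [ho1, h, zero_add]
          refine Equiv.Perm.SameCycle.symm ⟨1, ?_⟩
          rw [zpow_one, hπ u (j, k + 1) h1]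
          change D.arc j (partner (u j) (k + 1)) = D.arc j k
          rw [← hk', partner_partner]
        · refine ⟨1, ?_⟩
          rw [zpow_one, hπ u (j, k) h]
          change D.arc j (partner (u j) k) = _
          rw [hk']
      | refl a => exact Equiv.Perm.SameCycle.refl _ _
      | symm a b _ ih => exact ih.symm
      | trans a b c _ _ h1 h2 => exact h1.trans h2
    · intro h
      obtain ⟨n, rfl⟩ := h.exists_nat_pow_eq
      clear h
      induction n with
      | zero => rfl
      | succ n ih =>
        rw [ih, pow_succ', Equiv.Perm.mul_apply]
        set e := ((π u) ^ n) a
        conv_lhs => rw [← hd2 e]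
        exact (circle_partner u (hd e).1 (hd e).2).symm
  -- the two arcs that arrive at the crossing
  obtain ⟨k, hk, hkv, hkw⟩ : ∃ k, o (i, k) = 1 ∧
      (D.circle v (D.arc i 0) = D.circle v (D.arc i 2) ↔
        D.circle v (D.arc i k) = D.circle v (D.arc i (k + 2))) ∧
      (D.circle w (D.arc i 0) = D.circle w (D.arc i 2) ↔
        D.circle w (D.arc i k) = D.circle w (D.arc i (k + 2))) := by
    rcases hz (o (i, 0)) with h | h
    · refine ⟨1, by rw [← zero_add 1, ho1, h, zero_add], ?_, ?_⟩
      · rw [show (1 + 2 : ZMod 4) = 3 by decide, circle_zero_one hv, circle_two_three hv]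
      · rw [show (1 + 2 : ZMod 4) = 3 by decide, circle_one_two hw, circle_three_zero hw]
        exact eq_comm
    · exact ⟨0, h, by rw [zero_add], by rw [zero_add]⟩
  have hk2 : o (i, k + 2) = 1 := by
    rw [show k + 2 = k + 1 + 1 by rw [add_assoc]; rfl, ho1, ho1, hk]
    decide
  have hne : D.arc i k ≠ D.arc i (k + 2) := by
    intro h
    have := hdir (i, k) (i, k + 2) (by rw [hk, hk2]) h
    rw [Prod.mk.injEq] at this
    exact absurd this.2 ((by decide : ∀ k : ZMod 4, k ≠ k + 2) k)
  have hswap : π w = π v * Equiv.swap (D.arc i k) (D.arc i (k + 2)) := by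
    ext e
    rw [Equiv.Perm.mul_apply]
    have h3 : ∀ k : ZMod 4, partner true k = partner false (k + 2) := by decide
    have h4 : ∀ k : ZMod 4, partner true (k + 2) = partner false k := by decide
    by_cases h1 : e = D.arc i k
    · rw [h1, Equiv.swap_apply_left, hπ w (i, k) hk, hπ v (i, k + 2) hk2, hv, hw]
      exact congrArg _ (h3 k)
    by_cases h2 : e = D.arc i (k + 2)
    · rw [h2, Equiv.swap_apply_right, hπ w (i, k + 2) hk2, hπ v (i, k) hk, hv, hw]
      exact congrArg _ (h4 k)
    rw [Equiv.swap_apply_of_ne_of_ne h1 h2]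
    have hj : (hd e).1 ≠ i := by
      intro hj
      have hkk : ∀ k l : ZMod 4, l = k ∨ l = k + 1 ∨ l = k + 2 ∨ l = k + 2 + 1 := by decide
      have ho := hd1 e
      have he := hd2 e
      rw [← Prod.mk.eta (p := hd e), hj] at ho
      rw [hj] at he
      rcases hkk k (hd e).2 with h | h | h | h <;> rw [h] at ho he
      · exact h1 he.symm
      · rw [ho1, hk] at ho
        exact absurd ho (by decide)
      · exact h2 he.symm
      · rw [ho1, hk2] at ho
        exact absurd ho (by decide)
    rw [← hd2 e, hπ w _ (hd1 e), hπ v _ (hd1 e), hvw _ hj]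
  rw [hkv, hkw, hcyc, hcyc, hswap]
  exact sameCycle_mul_swap (π v) hne

open Classical in
/-- The number of splittings at a saddle that leads to the resolution `w`. -/
noncomputable def numSplit (w : D.State) (i : D.Crossing) : ℕ :=
  if D.circle w (D.arc i 0) = D.circle w (D.arc i 2) then 0 else 1

lemma card_circle {v w : D.State} {i : D.Crossing} (hv : v i = false) (hw : w i = true)
    (hvw : ∀ j, j ≠ i → v j = w j) :
    Nat.card (D.Circle w) + 1 = Nat.card (D.Circle v) + 2 * numSplit w i := by
  have key : Nat.card (Quot (addRel (D.Joined v) (D.arc i 0) (D.arc i 2))) =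
      Nat.card (Quot (addRel (D.Joined w) (D.arc i 0) (D.arc i 2))) := by
    have hgen : ∀ (u u' : D.State), (∀ j, j ≠ i → u j = u' j) →
        (∀ (r : D.Arc → D.Arc → Prop), (∀ a b, addRel (D.Joined u') (D.arc i 0) (D.arc i 2) a b → r a b)
          → ∀ k l, Quot.mk r (D.arc i k) = Quot.mk r (D.arc i l)) →
        ∀ x y, addRel (D.Joined u) (D.arc i 0) (D.arc i 2) x y →
          Quot.mk (addRel (D.Joined u') (D.arc i 0) (D.arc i 2)) x = Quot.mk _ y := by
      intro u u' huu hall x y hxy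
      rcases hxy with ⟨j, k, hk, rfl, rfl⟩ | ⟨rfl, rfl⟩
      · by_cases hj : j = i
        · subst hj
          exact hall _ (fun _ _ h => h) _ _
        · rw [huu j hj] at hk
          exact Quot.sound (Or.inl ⟨j, k, hk, rfl, rfl⟩)
      · exact hall _ (fun _ _ h => h) _ _
    have hk4 : ∀ k : ZMod 4, k = 0 ∨ k = 1 ∨ k = 2 ∨ k = 3 := by decide
    refine card_quot_congr (hgen v w hvw fun r hr => ?_) (hgen w v (fun j hj => (hvw j hj).symm)
      fun r hr => ?_)
    · have h02 : Quot.mk r (D.arc i 0) = Quot.mk r (D.arc i 2) :=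
        Quot.sound (hr _ _ (Or.inr ⟨rfl, rfl⟩))
      have h12 : Quot.mk r (D.arc i 1) = Quot.mk r (D.arc i 2) :=
        Quot.sound (hr _ _ (Or.inl ⟨i, 1, by simp [hw], rfl, rfl⟩))
      have h30 : Quot.mk r (D.arc i 3) = Quot.mk r (D.arc i 0) :=
        Quot.sound (hr _ _ (Or.inl ⟨i, 3, by simp [hw], rfl, rfl⟩))
      have hk : ∀ k, Quot.mk r (D.arc i k) = Quot.mk r (D.arc i 2) := by
        intro k
        rcases hk4 k with rfl | rfl | rfl | rfl
        exacts [h02, h12, rfl, h30.trans h02]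
      exact fun k l => (hk k).trans (hk l).symm
    · have h02 : Quot.mk r (D.arc i 0) = Quot.mk r (D.arc i 2) :=
        Quot.sound (hr _ _ (Or.inr ⟨rfl, rfl⟩))
      have h01 : Quot.mk r (D.arc i 0) = Quot.mk r (D.arc i 1) :=
        Quot.sound (hr _ _ (Or.inl ⟨i, 0, by simp [hv], rfl, rfl⟩))
      have h23 : Quot.mk r (D.arc i 2) = Quot.mk r (D.arc i 3) :=
        Quot.sound (hr _ _ (Or.inl ⟨i, 2, by simp [hv], rfl, rfl⟩))
      have hk : ∀ k, Quot.mk r (D.arc i k) = Quot.mk r (D.arc i 2) := by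
        intro k
        rcases hk4 k with rfl | rfl | rfl | rfl
        exacts [h02, h01.symm.trans h02, rfl, h23.symm]
      exact fun k l => (hk k).trans (hk l).symm
  have hms := circle_merge_or_split hv hw hvw
  change Nat.card (Quot (D.Joined w)) + 1 = Nat.card (Quot (D.Joined v)) + _
  by_cases h : D.circle w (D.arc i 0) = D.circle w (D.arc i 2)
  · have h' := hms.1 h
    rw [numSplit, if_pos h, card_quot_addRel_of_eq h, card_quot_addRel_of_ne h', key]
  · have h' := not_not.1 (mt hms.2 h)
    rw [numSplit, if_neg h, card_quot_addRel_of_ne h, card_quot_addRel_of_eq h', key]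

end KnotDiagram


/-! ### The differential squares to zero -/

namespace KnotDiagram

variable {D : KnotDiagram}

/-- The evaluation of a tensor over the circles of `v` at a colouring of the arcs. -/
noncomputable def evalState (v : D.State) (κ : D.Arc → Bool) :
    circleModule (D.Circle v) →ₐ[BNRing] BNRing :=
  evalAt fun s => κ (Quot.out s)

lemma eq_out {v : D.State} {κ : D.Arc → Bool} (h : ∀ a b, D.Joined v a b → κ a = κ b) (a : D.Arc) :
    κ (Quot.out (D.circle v a)) = κ a := by
  have := congrArg (Quot.lift κ h) (circle_out (D.circle v a))
  exact this

lemma joined_of_joined {v w : D.State} {i : D.Crossing} (hv : v i = false) (hw : w i = true)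
    (hvw : ∀ j, j ≠ i → v j = w j) {κ : D.Arc → Bool} (hκ : ∀ a b, D.Joined w a b → κ a = κ b)
    (h : κ (D.arc i 0) = κ (D.arc i 2)) (a b : D.Arc) (hab : D.Joined v a b) : κ a = κ b := by
  obtain ⟨j, k, hk, rfl, rfl⟩ := hab
  by_cases hj : j = i
  · subst hj
    have h12 : κ (D.arc j 1) = κ (D.arc j 2) := hκ _ _ ⟨j, 1, by simp [hw], rfl, rfl⟩
    have h30 : κ (D.arc j 3) = κ (D.arc j 0) := hκ _ _ ⟨j, 3, by simp [hw], rfl, rfl⟩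
    simp only [hv, Bool.false_eq_true, if_false] at hk
    rcases hk with rfl | rfl
    · exact h.trans h12.symm
    · exact h.symm.trans h30.symm
  · rw [hvw j hj] at hk
    exact hκ _ _ ⟨j, k, hk, rfl, rfl⟩

lemma evalState_saddle {v w : D.State} {i : D.Crossing} (hv : v i = false) (hw : w i = true)
    (hvw : ∀ j, j ≠ i → v j = w j) {κ : D.Arc → Bool} (hκ : ∀ a b, D.Joined w a b → κ a = κ b)
    (y : circleModule (D.Circle v)) :
    evalState w κ (D.saddle v w i y) =
      if κ (D.arc i 0) = κ (D.arc i 2) then varH ^ numSplit w i * evalState v κ y else 0 := by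
  classical
  have hcomp : (fun s : D.Circle w => κ (Quot.out s)) ∘ (fun s : D.Circle v =>
      D.circle w (Quot.out s)) = fun s => κ (Quot.out s) := by
    funext s
    exact eq_out hκ _
  by_cases h : D.circle w (D.arc i 0) = D.circle w (D.arc i 2)
  · have h' : κ (D.arc i 0) = κ (D.arc i 2) := by
      rw [← eq_out hκ (D.arc i 0), h, eq_out hκ]
    rw [saddle, if_pos h, if_pos h', numSplit, if_pos h, pow_zero, one_mul, evalState,
      evalAt_relabel, hcomp]
    rfl
  · have hP : ∀ a b, D.Joined v a b →
        (D.circle w a = D.circle w (D.arc i 0) ∨ D.circle w a = D.circle w (D.arc i 2)) =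
        (D.circle w b = D.circle w (D.arc i 0) ∨ D.circle w b = D.circle w (D.arc i 2)) := by
      rintro a b ⟨j, k, hk, rfl, rfl⟩
      by_cases hj : j = i
      · subst hj
        have hall : ∀ k, D.circle w (D.arc j k) = D.circle w (D.arc j 0) ∨
            D.circle w (D.arc j k) = D.circle w (D.arc j 2) := by
          intro k
          have hk4 : ∀ k : ZMod 4, k = 0 ∨ k = 1 ∨ k = 2 ∨ k = 3 := by decide
          rcases hk4 k with rfl | rfl | rfl | rfl
          · exact Or.inl rfl
          · exact Or.inr (circle_one_two hw)
          · exact Or.inr rfl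
          · exact Or.inl (circle_three_zero hw)
        exact propext (iff_of_true (hall _) (hall _))
      · rw [hvw j hj] at hk
        rw [circle_eq_of_joined ⟨j, k, hk, rfl, rfl⟩]
    have hout : D.circle w (Quot.out (D.circle v (D.arc i 0))) = D.circle w (D.arc i 0) ∨
        D.circle w (Quot.out (D.circle v (D.arc i 0))) = D.circle w (D.arc i 2) := by
      have := congrArg (Quot.lift _ hP) (circle_out (D.circle v (D.arc i 0)))
      exact this.mpr (Or.inl rfl)
    rw [saddle, if_neg h, evalState, evalAt_comulAt _ (D.circle v (D.arc i 0)) _ _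
      (fun s => D.circle w (Quot.out s)) hout, eq_out hκ, eq_out hκ, hcomp,
      numSplit, if_neg h, pow_one]
    rfl

lemma eq_of_evalState {w : D.State} {y z : circleModule (D.Circle w)}
    (h : ∀ κ : D.Arc → Bool, (∀ a b, D.Joined w a b → κ a = κ b) →
      evalState w κ y = evalState w κ z) : y = z := by
  refine evalAt_injective fun ε => ?_
  have := h (fun a => ε (D.circle w a)) fun a b hab => by rw [circle_eq_of_joined hab]
  simpa only [evalState, circle_out] using this

lemma update_false {w : D.State} (i : D.Crossing) (j : D.Crossing) (hj : j ≠ i) :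
    Function.update w i false j = w j := Function.update_of_ne hj _ _

lemma diff_apply (y : D.Chain) (w : D.State) : D.diff y w =
    ∑ i with w i = true, D.saddle (Function.update w i false) w i (y (Function.update w i false)) := by
  simp [diff]

lemma evalState_diff {w : D.State} {κ : D.Arc → Bool} (hκ : ∀ a b, D.Joined w a b → κ a = κ b)
    (y : D.Chain) : evalState w κ (D.diff y w) =
      ∑ i with w i = true, if κ (D.arc i 0) = κ (D.arc i 2) then
        varH ^ numSplit w i *
          evalState (Function.update w i false) κ (y (Function.update w i false)) else 0 := by
  rw [diff_apply, map_sum]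
  refine Finset.sum_congr rfl fun i hi => ?_
  exact evalState_saddle (Function.update_self _ _ _) (Finset.mem_filter.1 hi).2
    (fun j hj => update_false i j hj) hκ _

lemma diff_comp_diff : D.diff ∘ₗ D.diff = 0 := by
  classical
  refine LinearMap.ext fun y => funext fun w => eq_of_evalState fun κ hκ => ?_
  rw [LinearMap.comp_apply, evalState_diff hκ, LinearMap.zero_apply, Pi.zero_apply, map_zero]
  have h2 : ∀ r : BNRing, r + r = 0 := fun r => by
    rw [← two_mul, BNAlg.two_eq_zero, zero_mul]
  let upd : D.Crossing → D.State := fun i => Function.update w i false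
  let G : D.Crossing × D.Crossing → BNRing := fun p =>
    if κ (D.arc p.1 0) = κ (D.arc p.1 2) then varH ^ numSplit w p.1 *
      (if κ (D.arc p.2 0) = κ (D.arc p.2 2) then varH ^ numSplit (upd p.1) p.2 *
        evalState (Function.update (upd p.1) p.2 false) κ (y (Function.update (upd p.1) p.2 false))
      else 0) else 0
  have hsum : (∑ i with w i = true, if κ (D.arc i 0) = κ (D.arc i 2) then
        varH ^ numSplit w i * evalState (upd i) κ (D.diff y (upd i)) else 0) =
      ∑ p : D.Crossing × D.Crossing with (w p.1 = true ∧ upd p.1 p.2 = true), G p := by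
    rw [Finset.sum_filter, Finset.sum_filter, Fintype.sum_prod_type]
    refine Finset.sum_congr rfl fun i _ => ?_
    by_cases hi : w i = true
    · simp only [hi, if_true, true_and, G]
      by_cases hc : κ (D.arc i 0) = κ (D.arc i 2)
      · simp only [hc, if_true]
        rw [evalState_diff (joined_of_joined (Function.update_self _ _ _) hi
          (fun j hj => update_false i j hj) hκ hc), Finset.sum_filter, Finset.mul_sum]
        refine Finset.sum_congr rfl fun j _ => ?_
        rw [mul_ite, mul_zero]
      · simp [hc]
    · simp [hi]
  refine hsum.trans ?_
  refine Finset.sum_involution (fun p _ => (p.2, p.1)) ?_ ?_ ?_ ?_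
  · rintro ⟨i, j⟩ hp
    obtain ⟨hi, hj⟩ := (Finset.mem_filter.1 hp).2
    have hij : j ≠ i := by
      rintro rfl
      simp [upd] at hj
    have hj' : w j = true := by rwa [show upd i j = w j from update_false i j hij] at hj
    have hi' : upd j i = true := by rwa [show upd j i = w i from update_false j i hij.symm]
    have hcomm : Function.update (upd i) j false = Function.update (upd j) i false :=
      Function.update_comm hij.symm _ _ _
    have c1 := card_circle (v := upd i) (w := w) (i := i) (Function.update_self _ _ _) hi
      fun j hj => update_false i j hj
    have c2 := card_circle (v := Function.update (upd i) j false) (w := upd i) (i := j)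
      (Function.update_self _ _ _) hj fun k hk => update_false j k hk
    have c3 := card_circle (v := upd j) (w := w) (i := j) (Function.update_self _ _ _) hj'
      fun k hk => update_false j k hk
    have c4 := card_circle (v := Function.update (upd j) i false) (w := upd j) (i := i)
      (Function.update_self _ _ _) hi' fun k hk => update_false i k hk
    rw [hcomm] at c2
    have hnum : numSplit w i + numSplit (upd i) j = numSplit w j + numSplit (upd j) i := by omega
    have hG : G (i, j) = G (j, i) := by
      simp only [G]
      rw [hcomm]
      split_ifs
      · rw [← mul_assoc, ← mul_assoc, ← pow_add, ← pow_add, hnum]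
      · simp
      · simp
      · rfl
    rw [hG]
    exact h2 _
  · rintro ⟨i, j⟩ hp _ h
    obtain ⟨hi, hj⟩ := (Finset.mem_filter.1 hp).2
    rw [Prod.mk.injEq] at h
    obtain rfl : j = i := h.1
    simp [upd] at hj
  · rintro ⟨i, j⟩ hp
    obtain ⟨hi, hj⟩ := (Finset.mem_filter.1 hp).2
    have hij : j ≠ i := by
      rintro rfl
      simp [upd] at hj
    have hj' : w j = true := by rwa [show upd i j = w j from update_false i j hij] at hj
    have hi' : upd j i = true := by rwa [show upd j i = w i from update_false j i hij.symm]
    exact Finset.mem_filter.2 ⟨Finset.mem_univ _, hj', hi'⟩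
  · rintro ⟨i, j⟩ _
    rfl

end KnotDiagram

/-! ### The involution -/

namespace TransvergentDiagram

variable (D : TransvergentDiagram)

lemma joined_τArc (v : D.State) (a b : D.Arc) (h : D.Joined (v ∘ D.τ) a b) :
    D.Joined v (D.τArc a) (D.τArc b) ∨ D.Joined v (D.τArc b) (D.τArc a) := by
  obtain ⟨i, k, hk, rfl, rfl⟩ := h
  refine Or.inr ⟨D.τ i, D.shift i - (k + 1), ?_, ?_, ?_⟩
  · have key : ∀ (b : Bool) (s k : ZMod 4), (s = 1 ∨ s = 3) →
        (k = (if b then 1 else 0) ∨ k = (if b then 3 else 2)) →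
        (s - (k + 1) = (if b then 1 else 0) ∨ s - (k + 1) = (if b then 3 else 2)) := by decide
    exact key _ _ _ (D.shift_odd i) hk
  · exact D.τArc_arc i (k + 1)
  · rw [D.τArc_arc, show D.shift i - (k + 1) + 1 = D.shift i - k by ring]

/-- The image of a circle under the reflection. -/
def τCircle (v : D.State) : D.Circle (v ∘ D.τ) → D.Circle v :=
  Quot.lift (fun a => D.circle v (D.τArc a)) fun a b h => by
    rcases D.joined_τArc v a b h with h | h
    · exact KnotDiagram.circle_eq_of_joined h
    · exact (KnotDiagram.circle_eq_of_joined h).symm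

/-- The involution `I_τ` on chains: every circle of a resolution is taken to its image under the
reflection, which is a circle of the reflected resolution. -/
noncomputable def invol : D.Chain →ₗ[BNRing] D.Chain :=
  LinearMap.pi fun w => relabel (D.τCircle w) ∘ₗ LinearMap.proj (w ∘ D.τ)

variable {D}

lemma colour_τArc {w : D.State} {κ : D.Arc → Bool} (hκ : ∀ a b, D.Joined w a b → κ a = κ b)
    (a b : D.Arc) (h : D.Joined (w ∘ D.τ) a b) : (κ ∘ D.τArc) a = (κ ∘ D.τArc) b := by
  rcases D.joined_τArc w a b h with h | h
  · exact hκ _ _ h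
  · exact (hκ _ _ h).symm

lemma evalState_invol {w : D.State} {κ : D.Arc → Bool} (hκ : ∀ a b, D.Joined w a b → κ a = κ b)
    (y : D.Chain) : KnotDiagram.evalState w κ (D.invol y w) =
      KnotDiagram.evalState (w ∘ D.τ) (κ ∘ D.τArc) (y (w ∘ D.τ)) := by
  change KnotDiagram.evalState w κ (relabel (D.τCircle w) (y (w ∘ D.τ))) = _
  rw [KnotDiagram.evalState, evalAt_relabel, KnotDiagram.evalState]
  have : (fun s : D.Circle w => κ (Quot.out s)) ∘ D.τCircle w =
      fun s => (κ ∘ D.τArc) (Quot.out s) := by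
    funext s
    obtain ⟨a, rfl⟩ := Quot.exists_rep s
    refine (KnotDiagram.eq_out hκ (D.τArc a)).trans ?_
    exact (KnotDiagram.eq_out (colour_τArc hκ) a).symm
  rw [this]

lemma comp_τ_τ (w : D.State) : (w ∘ D.τ) ∘ D.τ = w := by
  funext i
  simp [D.τ_τ]

lemma invol_comp_invol : D.invol ∘ₗ D.invol = LinearMap.id := by
  refine LinearMap.ext fun y => funext fun w => KnotDiagram.eq_of_evalState fun κ hκ => ?_
  rw [LinearMap.comp_apply, evalState_invol hκ, evalState_invol (colour_τArc hκ)]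
  have h1 : (κ ∘ D.τArc) ∘ D.τArc = κ := by
    funext a
    simp [D.τArc_τArc]
  rw [h1, comp_τ_τ]
  rfl

lemma circle_τArc (w : D.State) (a b : D.Arc) : D.circle (w ∘ D.τ) a = D.circle (w ∘ D.τ) b ↔
    D.circle w (D.τArc a) = D.circle w (D.τArc b) := by
  constructor
  · exact fun h => congrArg (D.τCircle w) h
  · intro h
    have h' : D.circle ((w ∘ D.τ) ∘ D.τ) (D.τArc a) = D.circle ((w ∘ D.τ) ∘ D.τ) (D.τArc b) := by
      rwa [comp_τ_τ]
    have := congrArg (D.τCircle (w ∘ D.τ)) h'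
    change D.circle (w ∘ D.τ) (D.τArc (D.τArc a)) = D.circle (w ∘ D.τ) (D.τArc (D.τArc b)) at this
    rwa [D.τArc_τArc, D.τArc_τArc] at this

lemma invol_comp_diff : D.invol ∘ₗ D.diff = D.diff ∘ₗ D.invol := by
  classical
  refine LinearMap.ext fun y => funext fun w => KnotDiagram.eq_of_evalState fun κ hκ => ?_
  rw [LinearMap.comp_apply, LinearMap.comp_apply, evalState_invol hκ,
    KnotDiagram.evalState_diff (colour_τArc hκ), KnotDiagram.evalState_diff hκ]
  let τe : Equiv.Perm D.Crossing := ⟨D.τ, D.τ, D.τ_τ, D.τ_τ⟩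
  rw [Finset.sum_filter, Finset.sum_filter, ← Equiv.sum_comp τe]
  refine Finset.sum_congr rfl fun i _ => ?_
  change (if w (D.τ (D.τ i)) = true then _ else _) = _
  rw [D.τ_τ]
  by_cases hi : w i = true
  swap
  · rw [if_neg hi, if_neg hi]
  rw [if_pos hi, if_pos hi]
  change (if κ (D.τArc (D.arc (D.τ i) 0)) = κ (D.τArc (D.arc (D.τ i) 2)) then
    varH ^ KnotDiagram.numSplit (w ∘ D.τ) (D.τ i) *
      KnotDiagram.evalState (Function.update (w ∘ D.τ) (D.τ i) false) (κ ∘ D.τArc)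
        (y (Function.update (w ∘ D.τ) (D.τ i) false)) else 0) = _
  have hupd : Function.update (w ∘ D.τ) (D.τ i) false = Function.update w i false ∘ D.τ := by
    funext j
    by_cases hj : j = D.τ i
    · subst hj
      simp [D.τ_τ]
    · have : D.τ j ≠ i := fun h => hj (by rw [← h, D.τ_τ])
      simp [Function.update_of_ne hj, Function.update_of_ne this]
  have hcirc : (D.circle w (D.τArc (D.arc (D.τ i) 0)) = D.circle w (D.arc i 0) ∧
        D.circle w (D.τArc (D.arc (D.τ i) 2)) = D.circle w (D.arc i 2)) ∨
      (D.circle w (D.τArc (D.arc (D.τ i) 0)) = D.circle w (D.arc i 2) ∧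
        D.circle w (D.τArc (D.arc (D.τ i) 2)) = D.circle w (D.arc i 0)) := by
    rw [D.τArc_arc, D.τArc_arc, D.τ_τ]
    rcases D.shift_odd (D.τ i) with h | h <;> rw [h]
    · exact Or.inr ⟨KnotDiagram.circle_one_two hi, KnotDiagram.circle_three_zero hi⟩
    · exact Or.inl ⟨KnotDiagram.circle_three_zero hi, KnotDiagram.circle_one_two hi⟩
  have hκeq : κ (D.τArc (D.arc (D.τ i) 0)) = κ (D.τArc (D.arc (D.τ i) 2)) ↔
      κ (D.arc i 0) = κ (D.arc i 2) := by
    have hc : ∀ a b, D.circle w a = D.circle w b → κ a = κ b := fun a b h => by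
      rw [← KnotDiagram.eq_out hκ a, h, KnotDiagram.eq_out hκ]
    rcases hcirc with ⟨h1, h2⟩ | ⟨h1, h2⟩
    · rw [hc _ _ h1, hc _ _ h2]
    · rw [hc _ _ h1, hc _ _ h2]
      exact eq_comm
  have hnum : KnotDiagram.numSplit (w ∘ D.τ) (D.τ i) = KnotDiagram.numSplit w i := by
    have : D.circle (w ∘ D.τ) (D.arc (D.τ i) 0) = D.circle (w ∘ D.τ) (D.arc (D.τ i) 2) ↔
        D.circle w (D.arc i 0) = D.circle w (D.arc i 2) := by
      rw [circle_τArc]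
      rcases hcirc with ⟨h1, h2⟩ | ⟨h1, h2⟩
      · rw [h1, h2]
      · rw [h1, h2]
        exact eq_comm
    simp only [KnotDiagram.numSplit, this]
  by_cases hc : κ (D.arc i 0) = κ (D.arc i 2)
  · have hJ := KnotDiagram.joined_of_joined (Function.update_self _ _ _) hi
      (fun j hj => KnotDiagram.update_false i j hj) hκ hc
    rw [if_pos (hκeq.2 hc), if_pos hc, hnum, evalState_invol hJ, hupd]
  · rw [if_neg (mt hκeq.1 hc), if_neg hc]

end TransvergentDiagram


/-! ### Complexes

The maps between Bar-Natan complexes that are considered here need not preserve the homological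
grading. Complexes are therefore ungraded: a module with an endomorphism of square zero. -/

/-- The shape of ungraded complexes: one object with a differential to itself. -/
def ungraded : ComplexShape Unit where
  Rel _ _ := True
  next_eq _ _ := rfl
  prev_eq _ _ := rfl

/-- Ungraded chain complexes of `𝔽₂[H]`-modules. -/
abbrev BNComplex : Type 1 := HomologicalComplex (ModuleCat.{0} BNRing) ungraded

/-- The complex given by a module and a differential. -/
noncomputable def BNComplex.of (M : Type) [AddCommGroup M] [Module BNRing M] (d : M →ₗ[BNRing] M)
    (hd : d ∘ₗ d = 0) : BNComplex where
  X _ := ModuleCat.of BNRing M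
  d _ _ := ModuleCat.ofHom d
  shape _ _ h := absurd trivial h
  d_comp_d' _ _ _ _ _ := by
    rw [← ModuleCat.ofHom_comp, hd]
    rfl

/-- A complex with an involution. -/
structure EquivariantComplex where
  complex : BNComplex
  τ : complex ⟶ complex
  τ_comp_τ : τ ≫ τ = 𝟙 complex

namespace EquivariantComplex

lemma add_self_eq_zero {M : Type} [AddCommGroup M] [Module BNRing M] (m : M) : m + m = 0 := by
  rw [← two_smul BNRing m, BNAlg.two_eq_zero, zero_smul]

/-- The differential of a complex with an involution, as a linear map. -/
noncomputable abbrev d (C : EquivariantComplex) :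
    C.complex.X () →ₗ[BNRing] C.complex.X () := (C.complex.d () ()).hom

/-- The involution, as a linear map. -/
noncomputable abbrev τLin (C : EquivariantComplex) :
    C.complex.X () →ₗ[BNRing] C.complex.X () := (C.τ.f ()).hom

lemma d_d (C : EquivariantComplex) (a : C.complex.X ()) : C.d (C.d a) = 0 :=
  LinearMap.congr_fun (congrArg ModuleCat.Hom.hom (C.complex.d_comp_d () () ())) a

lemma τ_d (C : EquivariantComplex) (a : C.complex.X ()) : C.τLin (C.d a) = C.d (C.τLin a) :=
  (LinearMap.congr_fun (congrArg ModuleCat.Hom.hom (C.τ.comm () ())) a).symm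

/-- The mapping cone of `1 + τ : C → C`, which is `C ⊕ C` with the differential
`(a, b) ↦ (d a, (1 + τ) a + d b)`. -/
noncomputable def cone (C : EquivariantComplex) : BNComplex :=
  BNComplex.of (C.complex.X () × C.complex.X ())
    (LinearMap.prod (C.d ∘ₗ LinearMap.fst _ _ _)
      ((LinearMap.id + C.τLin) ∘ₗ LinearMap.fst _ _ _ + C.d ∘ₗ LinearMap.snd _ _ _))
    (by
      refine LinearMap.ext fun x => Prod.ext (C.d_d x.1) ?_
      change C.d x.1 + C.τLin (C.d x.1) + C.d (x.1 + C.τLin x.1 + C.d x.2) = 0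
      rw [map_add, map_add, C.d_d, C.τ_d, add_zero]
      exact add_self_eq_zero _)

/-- A strictly equivariant chain map. -/
structure Hom (A B : EquivariantComplex) where
  map : A.complex ⟶ B.complex
  comm : A.τ ≫ map = map ≫ B.τ

/-- The chain map of cones induced by a strictly equivariant chain map `f`, that is
`(a, b) ↦ (f a, f b)`. -/
noncomputable def Hom.cone {A B : EquivariantComplex} (f : Hom A B) : A.cone ⟶ B.cone where
  f _ := ModuleCat.ofHom (LinearMap.prodMap (f.map.f ()).hom (f.map.f ()).hom)
  comm' _ _ _ := by
    have hd : ∀ a, B.d ((f.map.f ()).hom a) = (f.map.f ()).hom (A.d a) := fun a =>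
      LinearMap.congr_fun (congrArg ModuleCat.Hom.hom (f.map.comm () ())) a
    have hτ : ∀ a, (f.map.f ()).hom (A.τLin a) = B.τLin ((f.map.f ()).hom a) := fun a =>
      LinearMap.congr_fun (congrArg ModuleCat.Hom.hom
        (congrArg (fun φ : A.complex ⟶ B.complex => φ.f ()) f.comm)) a
    refine ModuleCat.hom_ext (LinearMap.ext fun x => Prod.ext (hd x.1) ?_)
    change (f.map.f ()).hom x.1 + B.τLin ((f.map.f ()).hom x.1) + B.d ((f.map.f ()).hom x.2) =
      (f.map.f ()).hom (x.1 + A.τLin x.1 + A.d x.2)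
    rw [map_add, map_add, hτ, hd]

/-- Two strictly equivariant chain maps `f` and `g` are coherently homotopic: there is a homotopy `h`
from `f` to `g` and a map `k` with `h τ + τ h = d k + k d`. -/
def CoherentlyHomotopic {A B : EquivariantComplex} (f g : A.complex ⟶ B.complex) : Prop :=
  ∃ (h : Homotopy f g) (k : A.complex.X () ⟶ B.complex.X ()),
    A.τ.f () ≫ h.hom () () + h.hom () () ≫ B.τ.f () =
      A.complex.d () () ≫ k + k ≫ B.complex.d () ()

end EquivariantComplex

namespace TransvergentDiagram

/-- The Bar-Natan complex of a transvergent diagram, with the involution `I_τ`. -/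
noncomputable def CBN (D : TransvergentDiagram) : EquivariantComplex where
  complex := BNComplex.of D.Chain D.diff KnotDiagram.diff_comp_diff
  τ :=
    { f := fun _ => ModuleCat.ofHom D.invol
      comm' := fun _ _ _ => ModuleCat.hom_ext D.invol_comp_diff.symm }
  τ_comp_τ := by
    ext1 u
    exact ModuleCat.hom_ext D.invol_comp_invol

/-- The involutive Bar-Natan complex of a transvergent diagram. -/
noncomputable def eqCBN (D : TransvergentDiagram) : BNComplex := D.CBN.cone

/-! ### Equivariant crossing changes -/

/-- `D` and `D'` are the same up to the choice of the over-strands, the crossing `i` of `D` being the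
crossing `eX i` of `D'`, and the half-edge `k` at `i` the half-edge `k + o i` at `eX i`.  The crossing
`i` is changed exactly if `o i` is odd. -/
def SameShadow (D D' : TransvergentDiagram) (eX : D.Crossing ≃ D'.Crossing) (eA : D.Arc ≃ D'.Arc)
    (o : D.Crossing → ZMod 4) : Prop :=
  (∀ i k, D'.arc (eX i) (k + o i) = eA (D.arc i k)) ∧
  (∀ i, D'.τ (eX i) = eX (D.τ i)) ∧
  (∀ e, D'.τArc (eA e) = eA (D.τArc e)) ∧
  ∀ i, D'.shift (eX i) = D.shift i + o i + o (D.τ i)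

/-- Type A: a crossing off the axis and its mirror image are changed. -/
def TypeA (D D' : TransvergentDiagram) : Prop :=
  ∃ eX eA o, SameShadow D D' eX eA o ∧
    ∃ c, D.τ c ≠ c ∧ ∀ i, (o i = 1 ∨ o i = 3) ↔ (i = c ∨ i = D.τ c)

/-- Type B: a crossing on the axis is changed. -/
def TypeB (D D' : TransvergentDiagram) : Prop :=
  ∃ eX eA o, SameShadow D D' eX eA o ∧
    ∃ c, D.τ c = c ∧ ∀ i, (o i = 1 ∨ o i = 3) ↔ i = c

/-- Two arcs of `D` that cross the axis next to each other are pushed through each other along the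
axis.  In `D'` they form a clasp with two crossings, `l` on the left and `r = τ l` on the right of the
axis. With the axis vertical, the half-edges `p`, `p + 1`, `p + 2`, `p + 3` at `l` and `q`, `q + 1`,
`q + 2`, `q + 3` at `r` point to the bottom left, bottom right, top right and top left.  The two
crossings are joined by a lower and an upper arc, which cross the axis.  Smoothing the clasp into an
upper and a lower strand yields `D`, up to the names of crossings and arcs. -/
def AddsClasp (D D' : TransvergentDiagram) : Prop :=
  ∃ (l r : D'.Crossing) (p q : ZMod 4) (j : D.Crossing → D'.Crossing) (π : D'.Arc → D.Arc)
    (o : D.Crossing → ZMod 4),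
    l ≠ r ∧ D'.τ l = r ∧ D'.shift l = p + q + 1 ∧
    D'.arc l (p + 1) = D'.arc r q ∧ D'.arc l (p + 2) = D'.arc r (q + 3) ∧
    Function.Injective j ∧ Set.range j = {l, r}ᶜ ∧ Function.Surjective π ∧
    (∀ e e', π e = π e' ↔ Relation.EqvGen (fun a b =>
      (a = D'.arc l p ∧ b = D'.arc l (p + 1)) ∨ (a = D'.arc l (p + 2) ∧ b = D'.arc l (p + 3)) ∨
      (a = D'.arc r q ∧ b = D'.arc r (q + 1)) ∨
      (a = D'.arc r (q + 2) ∧ b = D'.arc r (q + 3))) e e') ∧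
    (∀ i, o i = 0 ∨ o i = 2) ∧
    (∀ i k, π (D'.arc (j i) (k + o i)) = D.arc i k) ∧
    (∀ i, D'.τ (j i) = j (D.τ i)) ∧
    (∀ e, π (D'.τArc e) = D.τArc (π e)) ∧
    ∀ i, D'.shift (j i) = D.shift i + o i + o (D.τ i)

/-- Type C: two fixed points that are next to each other on the axis move along the axis and pass
through each other. -/
def TypeC (D D' : TransvergentDiagram) : Prop := AddsClasp D D' ∨ AddsClasp D' D

end TransvergentDiagram

/-- The types of equivariant crossing changes. -/
inductive CrossingChangeType
  | A
  | B
  | C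

/-- The exponent of `H` that belongs to a type of equivariant crossing changes. -/
def CrossingChangeType.exponent : CrossingChangeType → ℕ
  | A => 2
  | B => 1
  | C => 1

/-- `D'` is obtained from `D` by a single equivariant crossing change of the given type. -/
def TransvergentDiagram.CrossingChange : CrossingChangeType → TransvergentDiagram →
    TransvergentDiagram → Prop
  | .A => TransvergentDiagram.TypeA
  | .B => TransvergentDiagram.TypeB
  | .C => TransvergentDiagram.TypeC

/-!
Chains are described by normalized coordinates.  Over a field that contains a square root `T` of `H`, a
chain is determined by its evaluations `x ↦ 0` or `x ↦ H` on the circles of the resolutions, that is, by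
functions of a resolution and a two-colouring of the arcs that is constant on circles.  If they are
divided by `T` to the number of circles, every saddle, merging or splitting and in either direction,
becomes multiplication by `T` between the resolutions at which the colouring makes sense
(`KnotDiagram.coord_saddleAt`), and the reflection becomes the reflection of resolutions and colourings.
All identities between maps of chains are checked in these coordinates.

Going through a saddle at a crossing `c` and back is `H` plus the sum of the dots on the two strands at
`c`; hence the reverse saddle at `c` is a homotopy from this sum of dots to `H`
(`KnotDiagram.diff_saddleAt_false`).

* Changing a set of crossings exchanges their resolutions.  The map that is the identity from the
  `0`-resolution to the new `1`-resolution, and the sum of the two dots from the `1`-resolution to the new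
  `0`-resolution, is a chain map, since the sum of the dots vanishes on everything that comes from or goes
  into a saddle at this crossing.  The composition of this map with its counterpart is the product of the
  sums of dots, so that each crossing contributes a factor `H` up to homotopy.  For a crossing on the
  axis the reverse saddle commutes with the reflection.  For two crossings `c` and `τ c` the homotopy and
  its reflection combine the two reverse saddles in different orders, and they differ by the boundary of
  the composition of both with the reflection (`exists_homotopy_dotAt_dotAt`).

* For a clasp, all maps are composed of the four saddles at the two crossings, the reflection, and the
  birth and the death of the small circle at one of the crossings.  These satisfy the relations
  `ClaspRelations`, mainly neck cutting and the exchange of the two crossings by the reflection.  The maps,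
  the homotopy and the homotopy between the homotopy and its reflection are explicit polynomials in these
  generators, and the required identities follow from the relations (`ClaspRelations.exists_maps`).  The
  relations are invariant under reversal of all products, which takes care of the two signs of the clasp,
  and everything commutes with the saddles at the other crossings.

A coherent homotopy between strictly equivariant maps induces a homotopy between the maps of cones
(`EquivariantComplex.coneHomotopy`), and homotopies can be transported along homotopy equivalences.
-/

/-! ### Homotopies of ungraded complexes and of cones -/

namespace BNComplex

/-- Over `𝔽₂`, a chain map `f` is homotopic to `g` as soon as `f + g = d h + h d`. -/
noncomputable def homotopyOfAdd {A B : BNComplex} (f g : A ⟶ B) (h : A.X () ⟶ B.X ())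
    (hfg : ∀ a, (f.f ()).hom a + (g.f ()).hom a =
      (B.d () ()).hom (h.hom a) + h.hom ((A.d () ()).hom a)) : Homotopy f g where
  hom _ _ := h
  zero _ _ hr := absurd trivial hr
  comm i := by
    rw [dNext_eq (C := A) (D := B) _ (show ungraded.Rel i () from trivial),
      prevD_eq (C := A) (D := B) _ (show ungraded.Rel () i from trivial)]
    refine ModuleCat.hom_ext (LinearMap.ext fun a => ?_)
    change (f.f ()).hom a = h.hom ((A.d () ()).hom a) + (B.d () ()).hom (h.hom a) + (g.f ()).hom a
    rw [add_comm (h.hom _), ← hfg, add_assoc, EquivariantComplex.add_self_eq_zero, add_zero]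

end BNComplex

namespace EquivariantComplex

/-- A coherent homotopy `(h, k)` between strictly equivariant maps `φ` and `ψ` induces a homotopy of
the maps `φ ⊕ φ` and `ψ ⊕ ψ` of cones, namely `(a, b) ↦ (h a, k a + h b)`. -/
noncomputable def coneHomotopy {A B : EquivariantComplex} (φ ψ : A.complex ⟶ B.complex)
    (h k : A.complex.X () ⟶ B.complex.X ())
    (hh : ∀ a, (φ.f ()).hom a + (ψ.f ()).hom a = B.d (h.hom a) + h.hom (A.d a))
    (hk : ∀ a, h.hom (A.τLin a) + B.τLin (h.hom a) = B.d (k.hom a) + k.hom (A.d a))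
    (Φ Ψ : A.cone ⟶ B.cone)
    (hΦ : ∀ x : A.complex.X () × A.complex.X (),
      (Φ.f ()).hom x = ((φ.f ()).hom x.1, (φ.f ()).hom x.2))
    (hΨ : ∀ x : A.complex.X () × A.complex.X (),
      (Ψ.f ()).hom x = ((ψ.f ()).hom x.1, (ψ.f ()).hom x.2)) : Homotopy Φ Ψ := by
  refine BNComplex.homotopyOfAdd Φ Ψ (ModuleCat.ofHom (LinearMap.prod
      (h.hom ∘ₗ LinearMap.fst _ _ _) (k.hom ∘ₗ LinearMap.fst _ _ _ + h.hom ∘ₗ LinearMap.snd _ _ _)))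
    fun x => ?_
  refine (congrArg₂ (fun a b : B.complex.X () × B.complex.X () => a + b) (hΦ x) (hΨ x)).trans ?_
  refine Prod.ext (hh x.1) ?_
  change (φ.f ()).hom x.2 + (ψ.f ()).hom x.2 =
    (h.hom x.1 + B.τLin (h.hom x.1) + B.d (k.hom x.1 + h.hom x.2)) +
      (k.hom (A.d x.1) + h.hom (x.1 + A.τLin x.1 + A.d x.2))
  rw [hh, map_add, map_add, map_add]
  have h0 := add_self_eq_zero (h.hom x.1)
  have h1 := hk x.1
  have h2 := add_self_eq_zero (B.d (k.hom x.1) + k.hom (A.d x.1))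
  calc B.d (h.hom x.2) + h.hom (A.d x.2)
      = (h.hom x.1 + h.hom x.1) + (B.d (k.hom x.1) + k.hom (A.d x.1) +
          (B.d (k.hom x.1) + k.hom (A.d x.1))) + (B.d (h.hom x.2) + h.hom (A.d x.2)) := by
        rw [h0, h2, zero_add, zero_add]
    _ = (h.hom x.1 + h.hom x.1) + (h.hom (A.τLin x.1) + B.τLin (h.hom x.1) +
          (B.d (k.hom x.1) + k.hom (A.d x.1))) + (B.d (h.hom x.2) + h.hom (A.d x.2)) := by
        rw [h1]
    _ = _ := by abel

end EquivariantComplex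

namespace TransvergentDiagram

/-- Equivariant chain maps `F : CBN(D) → CBN(D')` and `G` back, with a coherent homotopy `(h, k)` from
`G F` to `H ^ t`, in terms of elements. -/
structure CoherentSection (t : ℕ) (D D' : TransvergentDiagram) (F : D.Chain →ₗ[BNRing] D'.Chain)
    (G : D'.Chain →ₗ[BNRing] D.Chain) : Prop where
  map_diff : ∀ y, F (D.diff y) = D'.diff (F y)
  map_invol : ∀ y, F (D.invol y) = D'.invol (F y)
  homotopy : ∃ h k : D.Chain →ₗ[BNRing] D.Chain,
    (∀ y, G (F y) + varH ^ t • y = D.diff (h y) + h (D.diff y)) ∧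
    ∀ y, h (D.invol y) + D.invol (h y) = D.diff (k y) + k (D.diff y)

/-- The morphism of complexes with involution given by `F`. -/
noncomputable def CoherentSection.hom {t : ℕ} {D D' : TransvergentDiagram}
    {F : D.Chain →ₗ[BNRing] D'.Chain} {G : D'.Chain →ₗ[BNRing] D.Chain}
    (hFG : CoherentSection t D D' F G) : EquivariantComplex.Hom D.CBN D'.CBN where
  map :=
    { f := fun _ => ModuleCat.ofHom F
      comm' := fun _ _ _ => ModuleCat.hom_ext (LinearMap.ext fun y => (hFG.map_diff y).symm) }
  comm := by
    ext1 u
    exact ModuleCat.hom_ext (LinearMap.ext fun y => hFG.map_invol y)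

lemma CoherentSection.exists_homotopies {t : ℕ} {D D' : TransvergentDiagram}
    {F : D.Chain →ₗ[BNRing] D'.Chain} {G : D'.Chain →ₗ[BNRing] D.Chain}
    (hFG : CoherentSection t D D' F G) (hGF : CoherentSection t D' D G F) :
    EquivariantComplex.CoherentlyHomotopic (A := D.CBN) (B := D.CBN)
        (hFG.hom.map ≫ hGF.hom.map) (varH ^ t • 𝟙 D.CBN.complex) ∧
      Nonempty (Homotopy (hFG.hom.cone ≫ hGF.hom.cone) (varH ^ t • 𝟙 D.eqCBN)) := by
  obtain ⟨h, k, hh, hk⟩ := hFG.homotopy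
  refine ⟨⟨BNComplex.homotopyOfAdd _ _ (ModuleCat.ofHom h) hh, ModuleCat.ofHom k, ?_⟩, ⟨?_⟩⟩
  · refine ModuleCat.hom_ext (LinearMap.ext fun y => ?_)
    exact (hk y).trans (add_comm _ _)
  · exact EquivariantComplex.coneHomotopy (A := D.CBN) (B := D.CBN)
      (hFG.hom.map ≫ hGF.hom.map) (varH ^ t • 𝟙 D.CBN.complex)
      (ModuleCat.ofHom h) (ModuleCat.ofHom k) hh hk _ _ (fun _ => rfl) fun _ => rfl

end TransvergentDiagram

/-- Maps that are inverse to each other up to homotopy and the factor `r` can be transported along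
homotopy equivalences. -/
lemma nonempty_homotopy_of_homotopyEquiv {A B C C' : BNComplex} (r : BNRing) {f : A ⟶ B} {g : B ⟶ A}
    (h : Nonempty (Homotopy (f ≫ g) (r • 𝟙 A))) (e : HomotopyEquiv C A) (e' : HomotopyEquiv C' B) :
    Nonempty (Homotopy ((e.hom ≫ f ≫ e'.inv) ≫ e'.hom ≫ g ≫ e.inv) (r • 𝟙 C)) := by
  obtain ⟨h⟩ := h
  have h1 : Homotopy ((e.hom ≫ f) ≫ (e'.inv ≫ e'.hom) ≫ g ≫ e.inv)
      ((e.hom ≫ f) ≫ g ≫ e.inv) :=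
    (e'.homotopyInvHomId.compRightId (g ≫ e.inv)).compLeft (e.hom ≫ f)
  have h2 : Homotopy (e.hom ≫ (f ≫ g) ≫ e.inv) (e.hom ≫ (r • 𝟙 A) ≫ e.inv) :=
    (h.compRight e.inv).compLeft e.hom
  have h3 : Homotopy (r • (e.hom ≫ e.inv)) (r • 𝟙 C) := e.homotopyHomInvId.smul r
  refine ⟨(Homotopy.ofEq (by simp only [Category.assoc])).trans (h1.trans
    ((Homotopy.ofEq (by simp only [Category.assoc])).trans (h2.trans
      ((Homotopy.ofEq ?_).trans h3))))⟩
  rw [Linear.smul_comp, Category.id_comp, Linear.comp_smul]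

/-- The reduction of the statement on complexes to identities of linear maps. -/
lemma exists_maps_of_coherentSection {t : ℕ} {D D' : TransvergentDiagram}
    {F : D.Chain →ₗ[BNRing] D'.Chain} {G : D'.Chain →ₗ[BNRing] D.Chain}
    (hFG : TransvergentDiagram.CoherentSection t D D' F G)
    (hGF : TransvergentDiagram.CoherentSection t D' D G F) :
    (∃ (f : EquivariantComplex.Hom D.CBN D'.CBN) (g : EquivariantComplex.Hom D'.CBN D.CBN),
      EquivariantComplex.CoherentlyHomotopic (A := D.CBN) (B := D.CBN)
        (f.map ≫ g.map) (varH ^ t • 𝟙 D.CBN.complex) ∧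
      EquivariantComplex.CoherentlyHomotopic (A := D'.CBN) (B := D'.CBN)
        (g.map ≫ f.map) (varH ^ t • 𝟙 D'.CBN.complex) ∧
      Nonempty (Homotopy (f.cone ≫ g.cone) (varH ^ t • 𝟙 D.eqCBN)) ∧
      Nonempty (Homotopy (g.cone ≫ f.cone) (varH ^ t • 𝟙 D'.eqCBN))) ∧
    ∀ C C' : BNComplex, Nonempty (HomotopyEquiv C D.eqCBN) → Nonempty (HomotopyEquiv C' D'.eqCBN) →
      ∃ (f : C ⟶ C') (g : C' ⟶ C),
        Nonempty (Homotopy (f ≫ g) (varH ^ t • 𝟙 C)) ∧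
        Nonempty (Homotopy (g ≫ f) (varH ^ t • 𝟙 C')) := by
  obtain ⟨h1, h2⟩ := hFG.exists_homotopies hGF
  obtain ⟨h3, h4⟩ := hGF.exists_homotopies hFG
  refine ⟨⟨hFG.hom, hGF.hom, h1, h3, h2, h4⟩, fun C C' ⟨e⟩ ⟨e'⟩ => ⟨_, _,
    nonempty_homotopy_of_homotopyEquiv _ h2 e e', nonempty_homotopy_of_homotopyEquiv _ h4 e' e⟩⟩

/-! ### Normalized coordinates of chains -/

/-- A field that contains `𝔽₂[H]` and a square root of `H`. -/
abbrev BNField : Type := RatFunc (ZMod 2)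

namespace BNField

/-- The square root of `H`. -/
noncomputable def T : BNField := RatFunc.X

/-- The embedding of `𝔽₂[H]`, with `H ↦ T²`. -/
noncomputable def incl : BNRing →+* BNField :=
  (algebraMap (Polynomial (ZMod 2)) BNField).comp (Polynomial.expand (ZMod 2) 2 : _ →+* _)

lemma incl_varH : incl varH = T ^ 2 := by
  simp [incl, T, varH]

lemma T_ne_zero : T ≠ 0 := RatFunc.X_ne_zero

lemma incl_injective : Function.Injective incl :=
  (RatFunc.algebraMap_injective (ZMod 2)).comp (Polynomial.expand_injective two_pos)

lemma two_eq_zero : (2 : BNField) = 0 := by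
  have := congrArg incl BNAlg.two_eq_zero
  rwa [map_zero, map_ofNat] at this

instance : CharP BNField 2 := CharTwo.of_one_ne_zero_of_two_eq_zero one_ne_zero two_eq_zero

end BNField

namespace KnotDiagram

open BNField

variable {D D₁ D₂ : KnotDiagram}

/-- The colouring `κ` of the arcs is compatible with the resolution `b` at the crossing `i`. -/
def Fits (i : D.Crossing) (b : Bool) (κ : D.Arc → Bool) : Prop :=
  ∀ k, κ (D.arc i (partner b k)) = κ (D.arc i k)

/-- The colouring `κ` of the arcs is constant on the circles of the resolution `w`. -/
def Valid (w : D.State) (κ : D.Arc → Bool) : Prop := ∀ i, Fits i (w i) κ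

lemma valid_iff {w : D.State} {κ : D.Arc → Bool} :
    Valid w κ ↔ ∀ a b, D.Joined w a b → κ a = κ b := by
  constructor
  · rintro h _ _ ⟨i, k, hk, rfl, rfl⟩
    rw [← h i k, partner_of_joined _ _ hk]
  · intro h i k
    have hc : ∀ a b, D.circle w a = D.circle w b → κ a = κ b := fun a b hab => by
      rw [← eq_out h a, hab, eq_out h]
    exact hc _ _ (circle_partner w i k)

lemma Valid.eq_of_circle_eq {w : D.State} {κ : D.Arc → Bool} (h : Valid w κ) {a b : D.Arc}
    (hab : D.circle w a = D.circle w b) : κ a = κ b := by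
  rw [← eq_out (valid_iff.1 h) a, hab, eq_out (valid_iff.1 h)]

lemma valid_update {w : D.State} {κ : D.Arc → Bool} {i : D.Crossing} {b : Bool} :
    Valid (Function.update w i b) κ ↔ Fits i b κ ∧ ∀ j, j ≠ i → Fits j (w j) κ := by
  constructor
  · intro h
    refine ⟨by simpa using h i, fun j hj => ?_⟩
    have := h j
    rwa [Function.update_of_ne hj] at this
  · rintro ⟨h1, h2⟩ j
    by_cases hj : j = i
    · subst hj
      simpa using h1
    · rw [Function.update_of_ne hj]
      exact h2 j hj

lemma fits_false {i : D.Crossing} {κ : D.Arc → Bool} : Fits i false κ ↔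
    κ (D.arc i 0) = κ (D.arc i 1) ∧ κ (D.arc i 2) = κ (D.arc i 3) := by
  constructor
  · exact fun h => ⟨h 1, h 3⟩
  · rintro ⟨h1, h2⟩ k
    have hk : ∀ k : ZMod 4, k = 0 ∨ k = 1 ∨ k = 2 ∨ k = 3 := by decide
    rcases hk k with rfl | rfl | rfl | rfl
    exacts [h1.symm, h1, h2.symm, h2]

lemma fits_true {i : D.Crossing} {κ : D.Arc → Bool} : Fits i true κ ↔
    κ (D.arc i 0) = κ (D.arc i 3) ∧ κ (D.arc i 1) = κ (D.arc i 2) := by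
  constructor
  · exact fun h => ⟨h 3, h 2⟩
  · rintro ⟨h1, h2⟩ k
    have hk : ∀ k : ZMod 4, k = 0 ∨ k = 1 ∨ k = 2 ∨ k = 3 := by decide
    rcases hk k with rfl | rfl | rfl | rfl
    exacts [h1.symm, h2.symm, h2, h1]

lemma fits_not_iff {i : D.Crossing} {b : Bool} {κ : D.Arc → Bool} (h : Fits i b κ) :
    Fits i (!b) κ ↔ κ (D.arc i 0) = κ (D.arc i 2) := by
  cases b
  · rw [fits_false] at h
    rw [Bool.not_false, fits_true, ← h.1, h.2]
    exact ⟨fun h => h.1.trans rfl, fun h => ⟨h, h⟩⟩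
  · rw [fits_true] at h
    rw [Bool.not_true, fits_false, h.2, ← h.1]
    exact ⟨fun h => h.1, fun h => ⟨h, h.symm⟩⟩

lemma card_valid (w : D.State) :
    Nat.card {κ : D.Arc → Bool // Valid w κ} = 2 ^ Nat.card (D.Circle w) := by
  have e : {κ : D.Arc → Bool // Valid w κ} ≃ (D.Circle w → Bool) :=
    { toFun := fun κ => Quot.lift κ.1 (valid_iff.1 κ.2)
      invFun := fun ε => ⟨fun a => ε (D.circle w a), valid_iff.2 fun a b hab => by
        rw [circle_eq_of_joined hab]⟩
      left_inv := fun κ => rfl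
      right_inv := fun ε => by
        funext s
        obtain ⟨a, rfl⟩ := Quot.exists_rep s
        rfl }
  rw [Nat.card_congr e, Nat.card_fun, Nat.card_eq_fintype_card (α := Bool), Fintype.card_bool]

/-- A bijection of valid colourings shows that two resolutions have equally many circles. -/
lemma card_circle_eq {w₁ : D₁.State} {w₂ : D₂.State} (φ : D₁.Arc → D₂.Arc) (ψ : D₂.Arc → D₁.Arc)
    (hφ : ∀ κ, Valid w₂ κ → Valid w₁ (κ ∘ φ) ∧ (κ ∘ φ) ∘ ψ = κ)
    (hψ : ∀ κ, Valid w₁ κ → Valid w₂ (κ ∘ ψ) ∧ (κ ∘ ψ) ∘ φ = κ) :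
    Nat.card (D₁.Circle w₁) = Nat.card (D₂.Circle w₂) := by
  refine Nat.pow_right_injective le_rfl ?_
  change 2 ^ _ = 2 ^ _
  rw [← card_valid, ← card_valid]
  exact Nat.card_congr
    { toFun := fun κ => ⟨κ.1 ∘ ψ, (hψ κ.1 κ.2).1⟩
      invFun := fun κ => ⟨κ.1 ∘ φ, (hφ κ.1 κ.2).1⟩
      left_inv := fun κ => Subtype.ext (hψ κ.1 κ.2).2
      right_inv := fun κ => Subtype.ext (hφ κ.1 κ.2).2 }

open Classical in
/-- The coordinate of a chain at a resolution `w` and a colouring `κ` of its circles: the evaluation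
of the component at `w`, divided by `T` to the number of circles of `w`.  In these coordinates every
saddle, merging or splitting, is multiplication by `T`.  The coordinate is `0` if `κ` is not constant on
circles. -/
noncomputable def coord (y : D.Chain) (w : D.State) (κ : D.Arc → Bool) : BNField :=
  if Valid w κ then T ^ (-(Nat.card (D.Circle w) : ℤ)) * incl (evalState w κ (y w)) else 0

lemma coord_of_not_valid {y : D.Chain} {w : D.State} {κ : D.Arc → Bool} (h : ¬ Valid w κ) :
    coord y w κ = 0 := if_neg h

lemma coord_of_valid {y : D.Chain} {w : D.State} {κ : D.Arc → Bool} (h : Valid w κ) :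
    coord y w κ = T ^ (-(Nat.card (D.Circle w) : ℤ)) * incl (evalState w κ (y w)) := if_pos h

@[simp]
lemma coord_zero (w : D.State) (κ : D.Arc → Bool) : coord (0 : D.Chain) w κ = 0 := by
  simp [coord]

@[simp]
lemma coord_add (y z : D.Chain) (w : D.State) (κ : D.Arc → Bool) :
    coord (y + z) w κ = coord y w κ + coord z w κ := by
  unfold coord
  split_ifs
  · rw [Pi.add_apply, map_add, map_add, mul_add]
  · rw [add_zero]

@[simp]
lemma coord_smul (r : BNRing) (y : D.Chain) (w : D.State) (κ : D.Arc → Bool) :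
    coord (r • y) w κ = incl r * coord y w κ := by
  unfold coord
  split_ifs
  · rw [Pi.smul_apply, map_smul, smul_eq_mul, map_mul, mul_left_comm]
  · rw [mul_zero]

@[simp]
lemma coord_sum {α : Type} (s : Finset α) (y : α → D.Chain) (w : D.State) (κ : D.Arc → Bool) :
    coord (∑ i ∈ s, y i) w κ = ∑ i ∈ s, coord (y i) w κ := by
  classical
  induction s using Finset.induction_on with
  | empty => simp
  | insert a s ha ih => rw [Finset.sum_insert ha, Finset.sum_insert ha, coord_add, ih]

lemma coord_ext {y z : D.Chain} (h : ∀ w κ, Valid w κ → coord y w κ = coord z w κ) : y = z := by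
  refine funext fun w => eq_of_evalState fun κ hκ => incl_injective ?_
  have hv := valid_iff.2 hκ
  have := h w κ hv
  rw [coord_of_valid hv, coord_of_valid hv] at this
  exact mul_left_cancel₀ (zpow_ne_zero _ T_ne_zero) this

/-- The saddle at the crossing `i` that leads to the resolution `b` of this crossing, as a map of
chains.  For `b = true` it is a part of the differential. -/
noncomputable def saddleAt (i : D.Crossing) (b : Bool) : D.Chain →ₗ[BNRing] D.Chain :=
  LinearMap.pi fun w => if w i = b then
    D.saddle (Function.update w i (!b)) w i ∘ₗ LinearMap.proj (Function.update w i (!b)) else 0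

lemma saddleAt_apply (i : D.Crossing) (b : Bool) (y : D.Chain) (w : D.State) :
    saddleAt i b y w = if w i = b then
      D.saddle (Function.update w i (!b)) w i (y (Function.update w i (!b))) else 0 := by
  unfold saddleAt
  rw [LinearMap.pi_apply]
  split_ifs <;> rfl

lemma diff_eq_sum_saddleAt (y : D.Chain) : D.diff y = ∑ i, saddleAt i true y := by
  funext w
  rw [diff_apply, Finset.sum_apply, Finset.sum_filter]
  exact Finset.sum_congr rfl fun i _ => (saddleAt_apply i true y w).symm

/-- The value of a saddle in either direction. -/
lemma evalState_saddle_of_ne {v w : D.State} {i : D.Crossing} (hvw : ∀ j, j ≠ i → v j = w j)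
    {κ : D.Arc → Bool} (hκ : Valid w κ)
    (y : circleModule (D.Circle v)) :
    evalState w κ (D.saddle v w i y) =
      if κ (D.arc i 0) = κ (D.arc i 2) then varH ^ numSplit w i * evalState v κ y else 0 := by
  classical
  have hcomp : (fun s : D.Circle w => κ (Quot.out s)) ∘ (fun s : D.Circle v =>
      D.circle w (Quot.out s)) = fun s => κ (Quot.out s) := by
    funext s
    exact eq_out (valid_iff.1 hκ) _
  by_cases h : D.circle w (D.arc i 0) = D.circle w (D.arc i 2)
  · rw [saddle, if_pos h, if_pos (hκ.eq_of_circle_eq h), numSplit, if_pos h, pow_zero, one_mul,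
      evalState, evalAt_relabel, hcomp]
    rfl
  · have hall : ∀ k, D.circle w (D.arc i k) = D.circle w (D.arc i 0) ∨
        D.circle w (D.arc i k) = D.circle w (D.arc i 2) := by
      have hk : ∀ (b : Bool) (k : ZMod 4), k = 0 ∨ k = 2 ∨ k = partner b 0 ∨ k = partner b 2 := by
        decide
      intro k
      rcases hk (w i) k with rfl | rfl | rfl | rfl
      exacts [Or.inl rfl, Or.inr rfl, Or.inl (circle_partner w i 0), Or.inr (circle_partner w i 2)]
    have hP : ∀ a b, D.Joined v a b →
        (D.circle w a = D.circle w (D.arc i 0) ∨ D.circle w a = D.circle w (D.arc i 2)) =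
        (D.circle w b = D.circle w (D.arc i 0) ∨ D.circle w b = D.circle w (D.arc i 2)) := by
      rintro a b ⟨j, k, hk, rfl, rfl⟩
      by_cases hj : j = i
      · subst hj
        exact propext (iff_of_true (hall _) (hall _))
      · rw [hvw j hj] at hk
        rw [circle_eq_of_joined ⟨j, k, hk, rfl, rfl⟩]
    have hout : D.circle w (Quot.out (D.circle v (D.arc i 0))) = D.circle w (D.arc i 0) ∨
        D.circle w (Quot.out (D.circle v (D.arc i 0))) = D.circle w (D.arc i 2) := by
      have := congrArg (Quot.lift _ hP) (circle_out (D.circle v (D.arc i 0)))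
      exact this.mpr (Or.inl rfl)
    rw [saddle, if_neg h, evalState, evalAt_comulAt _ (D.circle v (D.arc i 0)) _ _
      (fun s => D.circle w (Quot.out s)) hout, eq_out (valid_iff.1 hκ), eq_out (valid_iff.1 hκ),
      hcomp, numSplit, if_neg h, pow_one]
    rfl

lemma card_circle_of_ne {v w : D.State} {i : D.Crossing} (hi : v i = !w i)
    (hvw : ∀ j, j ≠ i → v j = w j) :
    Nat.card (D.Circle w) + 1 = Nat.card (D.Circle v) + 2 * numSplit w i := by
  cases hw : w i
  · rw [hw] at hi
    have h1 := card_circle (v := w) (w := v) hw hi fun j hj => (hvw j hj).symm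
    have h2 := circle_merge_or_split (v := w) (w := v) hw hi fun j hj => (hvw j hj).symm
    have h3 : numSplit v i + numSplit w i = 1 := by
      unfold numSplit
      by_cases h : D.circle w (D.arc i 0) = D.circle w (D.arc i 2)
      · rw [if_pos h, if_neg (mt h2.1 (not_not.2 h))]
      · rw [if_neg h, if_pos (h2.2 h)]
    omega
  · rw [hw] at hi
    exact card_circle hi hw hvw

open Classical in
lemma coord_saddleAt (i : D.Crossing) (b : Bool) (y : D.Chain) (w : D.State) (κ : D.Arc → Bool) :
    coord (saddleAt i b y) w κ =
      if w i = b ∧ Fits i b κ then T * coord y (Function.update w i (!b)) κ else 0 := by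
  set v := Function.update w i (!b) with hv
  by_cases hval : Valid w κ
  swap
  · rw [coord_of_not_valid hval]
    split_ifs with h
    · rw [coord_of_not_valid, mul_zero]
      intro hv'
      refine hval fun j => ?_
      by_cases hj : j = i
      · subst hj
        rw [h.1]
        exact h.2
      · exact (valid_update.1 hv').2 j hj
    · rfl
  rw [coord_of_valid hval, saddleAt_apply]
  by_cases hb : w i = b
  swap
  · rw [if_neg hb, if_neg (fun h => hb h.1), map_zero, map_zero, mul_zero]
  have hfit : Fits i b κ := hb ▸ hval i
  rw [if_pos hb, if_pos ⟨hb, hfit⟩]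
  have hvi : v i = !w i := by rw [hv, Function.update_self, hb]
  have hvw : ∀ j, j ≠ i → v j = w j := fun j hj => Function.update_of_ne hj _ _
  rw [← hv, evalState_saddle_of_ne hvw hval]
  by_cases hc : κ (D.arc i 0) = κ (D.arc i 2)
  · have hval' : Valid v κ := valid_update.2 ⟨(fits_not_iff hfit).2 hc, fun j _ => hval j⟩
    have hcard := card_circle_of_ne hvi hvw
    rw [if_pos hc, coord_of_valid hval', map_mul, map_pow, incl_varH, ← pow_mul, ← mul_assoc,
      ← mul_assoc]
    congr 1
    rw [← zpow_natCast, ← zpow_add₀ T_ne_zero, ← zpow_one_add₀ T_ne_zero]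
    congr 1
    push_cast
    omega
  · have hval' : ¬ Valid v κ := fun h => hc ((fits_not_iff hfit).1 (valid_update.1 h).1)
    rw [if_neg hc, coord_of_not_valid hval', map_zero, mul_zero, mul_zero]

/-- Carry chains of `D₁` to chains of `D₂` along a map `S` of resolutions and a map `φ` of arcs that
maps circles to circles. -/
noncomputable def transport (S : D₂.State → D₁.State) (φ : D₁.Arc → D₂.Arc) :
    D₁.Chain →ₗ[BNRing] D₂.Chain :=
  LinearMap.pi fun w => relabel (fun s : D₁.Circle (S w) => D₂.circle w (φ (Quot.out s))) ∘ₗ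
    LinearMap.proj (S w)

lemma evalState_transport (S : D₂.State → D₁.State) (φ : D₁.Arc → D₂.Arc) (y : D₁.Chain)
    {w : D₂.State} {κ : D₂.Arc → Bool} (hκ : Valid w κ) :
    evalState w κ (transport S φ y w) = evalState (S w) (κ ∘ φ) (y (S w)) := by
  change evalState w κ (relabel (fun s : D₁.Circle (S w) => D₂.circle w (φ (Quot.out s)))
    (y (S w))) = _
  rw [evalState, evalAt_relabel, evalState]
  have : (fun s : D₂.Circle w => κ (Quot.out s)) ∘
      (fun s : D₁.Circle (S w) => D₂.circle w (φ (Quot.out s))) = fun s => (κ ∘ φ) (Quot.out s) := by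
    funext s
    exact eq_out (valid_iff.1 hκ) _
  rw [this]

lemma coord_transport (S : D₂.State → D₁.State) (φ : D₁.Arc → D₂.Arc) (y : D₁.Chain)
    {w : D₂.State} {κ : D₂.Arc → Bool} (hκ : Valid w κ) (hκ' : Valid (S w) (κ ∘ φ)) (n : ℕ)
    (hn : Nat.card (D₂.Circle w) = Nat.card (D₁.Circle (S w)) + n) :
    coord (transport S φ y) w κ = (T ^ n)⁻¹ * coord y (S w) (κ ∘ φ) := by
  rw [coord_of_valid hκ, coord_of_valid hκ', evalState_transport S φ y hκ, hn, ← mul_assoc,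
    Nat.cast_add, neg_add, zpow_add₀ T_ne_zero, zpow_neg T n, zpow_natCast, mul_comm (T ^ n)⁻¹]

end KnotDiagram

namespace KnotDiagram

open BNField

variable {D D₁ D₂ : KnotDiagram}

/-! ### Dots and saddles -/

/-- Multiplication by an element at every resolution. -/
noncomputable def mulBy (m : (w : D.State) → circleModule (D.Circle w)) :
    D.Chain →ₗ[BNRing] D.Chain :=
  LinearMap.pi fun w => LinearMap.mulLeft BNRing (m w) ∘ₗ LinearMap.proj w

lemma coord_mulBy (m : (w : D.State) → circleModule (D.Circle w)) (y : D.Chain) (w : D.State)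
    (κ : D.Arc → Bool) :
    coord (mulBy m y) w κ = incl (evalState w κ (m w)) * coord y w κ := by
  by_cases h : Valid w κ
  · rw [coord_of_valid h, coord_of_valid h, mul_left_comm, ← map_mul, ← map_mul]
    rfl
  · rw [coord_of_not_valid h, coord_of_not_valid h, mul_zero]

/-- The sum of a dot on either strand at the crossing `c`. -/
noncomputable def dots (c : D.Crossing) (w : D.State) : circleModule (D.Circle w) :=
  factor (D.circle w (D.arc c 0)) BNAlg.x + factor (D.circle w (D.arc c 2)) BNAlg.x

open Classical in
/-- The value of `dots c` at a colouring: `0` if all half-edges at `c` have the same colour, and `H`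
otherwise. -/
noncomputable def dotVal (c : D.Crossing) (κ : D.Arc → Bool) : BNField :=
  if ∀ b, Fits c b κ then 0 else T ^ 2

lemma incl_evalState_dots (c : D.Crossing) {w : D.State} {κ : D.Arc → Bool} (h : Valid w κ) :
    incl (evalState w κ (dots c w)) = dotVal c κ := by
  have h2 : (T : BNField) ^ 2 + T ^ 2 = 0 := CharTwo.add_self_eq_zero _
  have key : (∀ b, Fits c b κ) ↔ κ (D.arc c 0) = κ (D.arc c 2) := by
    rw [← fits_not_iff (h c)]
    refine ⟨fun hb => hb _, fun hb b => ?_⟩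
    by_cases hbw : b = w c
    · exact hbw ▸ h c
    · exact (Bool.eq_not.2 hbw) ▸ hb
  rw [dotVal, dots, map_add, evalState, evalAt_factor, evalAt_factor, eq_out (valid_iff.1 h),
    eq_out (valid_iff.1 h), BNAlg.eval_x, BNAlg.eval_x]
  simp only [key]
  cases κ (D.arc c 0) <;> cases κ (D.arc c 2) <;> simp [incl_varH, h2]

/-- Multiplication by `dots c`. -/
noncomputable def dotAt (c : D.Crossing) : D.Chain →ₗ[BNRing] D.Chain := mulBy (dots c)

lemma coord_dotAt (c : D.Crossing) (y : D.Chain) (w : D.State) (κ : D.Arc → Bool) :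
    coord (dotAt c y) w κ = dotVal c κ * coord y w κ := by
  by_cases h : Valid w κ
  · rw [dotAt, coord_mulBy, incl_evalState_dots c h]
  · rw [coord_of_not_valid h, coord_of_not_valid h, mul_zero]

lemma saddleAt_comm {i j : D.Crossing} (hij : i ≠ j) (b b' : Bool) (y : D.Chain) :
    saddleAt i b (saddleAt j b' y) = saddleAt j b' (saddleAt i b y) := by
  refine coord_ext fun w κ _ => ?_
  have h1 : Function.update w i (!b) j = w j := Function.update_of_ne hij.symm _ _
  have h2 : Function.update w j (!b') i = w i := Function.update_of_ne hij _ _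
  simp only [coord_saddleAt, h1, h2, Function.update_comm hij]
  split_ifs <;> simp_all

lemma dotAt_saddleAt (c i : D.Crossing) (b : Bool) (y : D.Chain) :
    dotAt c (saddleAt i b y) = saddleAt i b (dotAt c y) := by
  refine coord_ext fun w κ _ => ?_
  rw [coord_dotAt, coord_saddleAt, coord_saddleAt, coord_dotAt]
  split_ifs
  · exact mul_left_comm _ _ _
  · exact mul_zero _

lemma dotAt_diff (c : D.Crossing) (y : D.Chain) : dotAt c (D.diff y) = D.diff (dotAt c y) := by
  simp only [diff_eq_sum_saddleAt, map_sum, dotAt_saddleAt]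

/-- Going through a saddle and back is `H` times the identity plus the dots of the two strands (neck
cutting). -/
lemma saddleAt_saddleAt_not (c : D.Crossing) (b : Bool) (y : D.Chain) (w : D.State)
    (κ : D.Arc → Bool) : coord (saddleAt c b (saddleAt c (!b) y)) w κ =
      if w c = b then coord (dotAt c y + varH • y) w κ else 0 := by
  have h2 : (T : BNField) ^ 2 + T ^ 2 = 0 := CharTwo.add_self_eq_zero _
  by_cases hb : w c = b
  swap
  · rw [coord_saddleAt, if_neg fun h => hb h.1, if_neg hb]
  subst hb
  by_cases hv : Valid w κ
  swap
  · rw [coord_of_not_valid hv, coord_of_not_valid hv, ite_self]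
  rw [if_pos rfl, coord_saddleAt, if_pos ⟨rfl, hv c⟩, coord_saddleAt, Function.update_self,
    coord_add, coord_dotAt, coord_smul, incl_varH, Bool.not_not, Function.update_idem,
    Function.update_eq_self, dotVal]
  by_cases hf : ∀ b, Fits c b κ
  · rw [if_pos ⟨rfl, hf _⟩, if_pos hf]
    ring
  · have : ¬ Fits c (!w c) κ := fun h => hf fun b => by
      by_cases hbw : b = w c
      · exact hbw ▸ hv c
      · exact (Bool.eq_not.2 hbw) ▸ h
    rw [if_neg (fun h => this h.2), if_neg hf, ← add_mul, h2]
    ring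

/-- The reverse saddle at `c` is a homotopy from the sum of two dots to `H`. -/
lemma diff_saddleAt_false (c : D.Crossing) (y : D.Chain) :
    D.diff (saddleAt c false y) + saddleAt c false (D.diff y) = dotAt c y + varH • y := by
  classical
  rw [diff_eq_sum_saddleAt, diff_eq_sum_saddleAt, map_sum, ← Finset.sum_add_distrib,
    Finset.sum_eq_single c]
  · refine coord_ext fun w κ _ => ?_
    have h1 := saddleAt_saddleAt_not c true y w κ
    have h2 := saddleAt_saddleAt_not c false y w κ
    rw [Bool.not_true] at h1
    rw [Bool.not_false] at h2
    rw [coord_add, h1, h2]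
    cases w c <;> simp
  · intro i _ hi
    rw [saddleAt_comm hi]
    exact EquivariantComplex.add_self_eq_zero _
  · exact fun h => absurd (Finset.mem_univ c) h

/-! ### The crossing change map -/

/-- `D₂` is obtained from `D₁` by changing the crossings in `S`: the resolutions of the crossings in
`S` are swapped. -/
def FlipsAt (D₁ D₂ : KnotDiagram) (eX : D₁.Crossing ≃ D₂.Crossing) (eA : D₁.Arc ≃ D₂.Arc)
    (S : Finset D₁.Crossing) : Prop :=
  ∀ (c : D₁.Crossing) (b : Bool) (κ : D₂.Arc → Bool),
    Fits c b (κ ∘ eA) ↔ Fits (eX c) (if c ∈ S then !b else b) κ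

section change

variable {eX : D₁.Crossing ≃ D₂.Crossing} {eA : D₁.Arc ≃ D₂.Arc} {S : Finset D₁.Crossing}

lemma FlipsAt.symm (h : FlipsAt D₁ D₂ eX eA S) :
    FlipsAt D₂ D₁ eX.symm eA.symm (S.map eX.toEmbedding) := by
  intro c b κ
  have h1 := h (eX.symm c) (if c ∈ S.map eX.toEmbedding then !b else b) (κ ∘ eA.symm)
  have h2 : (κ ∘ eA.symm) ∘ eA = κ := by
    funext a
    simp
  have h3 : c ∈ S.map eX.toEmbedding ↔ eX.symm c ∈ S := by simp
  rw [h2, Equiv.apply_symm_apply] at h1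
  rw [h1]
  simp only [h3]
  split_ifs <;> simp

/-- The resolution of `D₁` that is the same as the resolution `w` of `D₂`. -/
def pullState (eX : D₁.Crossing ≃ D₂.Crossing) (S : Finset D₁.Crossing) (w : D₂.State) : D₁.State :=
  fun c => if c ∈ S then !w (eX c) else w (eX c)

lemma pullState_update (w : D₂.State) (c : D₁.Crossing) (b : Bool) :
    pullState eX S (Function.update w (eX c) b) =
      Function.update (pullState eX S w) c (if c ∈ S then !b else b) := by
  funext j
  by_cases hj : j = c
  · subst hj
    simp [pullState]
  · simp [pullState, Function.update_of_ne hj, Function.update_of_ne (eX.injective.ne hj)]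

lemma FlipsAt.valid_iff (h : FlipsAt D₁ D₂ eX eA S) {w : D₂.State} {κ : D₂.Arc → Bool} :
    Valid (pullState eX S w) (κ ∘ eA) ↔ Valid w κ := by
  have key : ∀ c, Fits c (pullState eX S w c) (κ ∘ eA) ↔ Fits (eX c) (w (eX c)) κ := by
    intro c
    rw [h c, pullState]
    split_ifs <;> simp
  constructor
  · intro hv c
    have := (key (eX.symm c)).1 (hv _)
    rwa [Equiv.apply_symm_apply] at this
  · exact fun hv c => (key c).2 (hv _)

lemma FlipsAt.coord_transport (h : FlipsAt D₁ D₂ eX eA S) (y : D₁.Chain) (w : D₂.State)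
    (κ : D₂.Arc → Bool) :
    coord (transport (pullState eX S) eA y) w κ = coord y (pullState eX S w) (κ ∘ eA) := by
  by_cases hv : Valid w κ
  · rw [KnotDiagram.coord_transport _ _ _ hv (h.valid_iff.2 hv) 0, pow_zero, inv_one, one_mul]
    rw [add_zero]
    have hA : ∀ κ : D₁.Arc → Bool, (κ ∘ eA.symm) ∘ eA = κ := fun κ => by
      funext a
      simp
    refine (card_circle_eq (eA : D₁.Arc → D₂.Arc) eA.symm (fun κ hκ => ⟨h.valid_iff.2 hκ, ?_⟩)
      fun κ hκ => ⟨h.valid_iff.1 ?_, hA κ⟩).symm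
    · funext a
      simp
    · rwa [hA]
  · rw [coord_of_not_valid hv, coord_of_not_valid (mt h.valid_iff.1 hv)]

lemma FlipsAt.dotVal_eq (h : FlipsAt D₁ D₂ eX eA S) (c : D₁.Crossing) (κ : D₂.Arc → Bool) :
    dotVal c (κ ∘ eA) = dotVal (eX c) κ := by
  have : (∀ b, Fits c b (κ ∘ eA)) ↔ ∀ b, Fits (eX c) b κ := by
    simp only [h c]
    split_ifs
    · exact ⟨fun hb b => by simpa using hb (!b), fun hb b => hb _⟩
    · rfl
  unfold dotVal
  by_cases hb : ∀ b, Fits c b (κ ∘ eA)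
  · rw [if_pos hb, if_pos (this.1 hb)]
  · rw [if_neg hb, if_neg (mt this.2 hb)]

/-- The weight of the crossing change map: dots on both strands at every crossing of `S` that has
its `1`-resolution. -/
noncomputable def changeWeight (S : Finset D₁.Crossing) (w : D₁.State) :
    circleModule (D₁.Circle w) :=
  ∏ c ∈ S, if w c then dots c w else 1

/-- The weight of the crossing change map in coordinates. -/
noncomputable def weightVal (S : Finset D₁.Crossing) (w : D₁.State) (κ : D₁.Arc → Bool) : BNField :=
  ∏ c ∈ S, if w c then dotVal c κ else 1

/-- The crossing change map: the identity between resolutions that are `0`-resolutions of `D₁` and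
`1`-resolutions of `D₂` at a crossing of `S`, and the sum of the dots on the two strands between
resolutions that are `1`-resolutions of `D₁` and `0`-resolutions of `D₂` there. -/
noncomputable def changeMap (eX : D₁.Crossing ≃ D₂.Crossing) (eA : D₁.Arc ≃ D₂.Arc)
    (S : Finset D₁.Crossing) : D₁.Chain →ₗ[BNRing] D₂.Chain :=
  transport (pullState eX S) eA ∘ₗ mulBy (changeWeight S)

lemma FlipsAt.coord_changeMap (h : FlipsAt D₁ D₂ eX eA S) (y : D₁.Chain) (w : D₂.State)
    (κ : D₂.Arc → Bool) : coord (changeMap eX eA S y) w κ =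
      weightVal S (pullState eX S w) (κ ∘ eA) * coord y (pullState eX S w) (κ ∘ eA) := by
  rw [changeMap, LinearMap.comp_apply, h.coord_transport, coord_mulBy]
  by_cases hv : Valid (pullState eX S w) (κ ∘ eA)
  · congr 1
    rw [changeWeight, weightVal, map_prod, map_prod]
    refine Finset.prod_congr rfl fun c _ => ?_
    split_ifs
    · exact incl_evalState_dots c hv
    · rw [map_one, map_one]
  · rw [coord_of_not_valid hv, mul_zero, mul_zero]

lemma weightVal_update {w : D₁.State} {c : D₁.Crossing} {b : Bool} (hc : c ∉ S)
    (κ : D₁.Arc → Bool) : weightVal S (Function.update w c b) κ = weightVal S w κ := by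
  refine Finset.prod_congr rfl fun j hj => ?_
  rw [Function.update_of_ne (ne_of_mem_of_not_mem hj hc)]

/-- The weight annihilates what can pass through a saddle at a crossing of `S`. -/
lemma weightVal_eq_zero {w : D₁.State} {c : D₁.Crossing} (hc : c ∈ S) (hw : w c = true)
    {κ : D₁.Arc → Bool} (hκ : ∀ b, Fits c b κ) : weightVal S w κ = 0 := by
  refine Finset.prod_eq_zero hc ?_
  rw [if_pos hw, dotVal, if_pos hκ]

lemma FlipsAt.changeMap_diff (h : FlipsAt D₁ D₂ eX eA S) (y : D₁.Chain) :
    changeMap eX eA S (D₁.diff y) = D₂.diff (changeMap eX eA S y) := by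
  classical
  refine coord_ext fun w κ _ => ?_
  rw [h.coord_changeMap, diff_eq_sum_saddleAt, diff_eq_sum_saddleAt, coord_sum, coord_sum,
    Finset.mul_sum, ← Equiv.sum_comp eX]
  refine Finset.sum_congr rfl fun c _ => ?_
  rw [coord_saddleAt, coord_saddleAt, h.coord_changeMap, pullState_update]
  have hfit : ∀ b b', (b' = if c ∈ S then !b else b) →
      (Fits c b (κ ∘ eA) ↔ Fits (eX c) b' κ) := fun b b' hb => hb ▸ h c b κ
  have hbool : ∀ {p q : Prop}, p → q → ∀ P : Bool → Prop, (P true ↔ p) → (P false ↔ q) →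
      ∀ b, P b := by
    rintro p q hp hq P h1 h2 (_ | _)
    exacts [h2.2 hq, h1.2 hp]
  by_cases hc : c ∈ S
  · have hL : weightVal S (pullState eX S w) (κ ∘ eA) *
        (if pullState eX S w c = true ∧ Fits c true (κ ∘ eA) then
          T * coord y (Function.update (pullState eX S w) c (!true)) (κ ∘ eA) else 0) = 0 := by
      split_ifs with h1
      · by_cases hv : Valid (Function.update (pullState eX S w) c (!true)) (κ ∘ eA)
        · rw [weightVal_eq_zero hc h1.1 (hbool h1.2 (valid_update.1 hv).1 _ Iff.rfl Iff.rfl),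
            zero_mul]
        · rw [coord_of_not_valid hv, mul_zero, mul_zero]
      · exact mul_zero _
    rw [hL]
    split_ifs with h1
    · rw [Bool.not_true, Bool.not_false]
      by_cases hv : Valid (Function.update (pullState eX S w) c true) (κ ∘ eA)
      · rw [weightVal_eq_zero hc (Function.update_self _ _ _)
          (hbool (valid_update.1 hv).1 h1.2 _ Iff.rfl (hfit false true (by simp [hc]))),
          zero_mul, mul_zero]
      · rw [coord_of_not_valid hv, mul_zero, mul_zero]
    · rfl
  · have h1 : pullState eX S w c = w (eX c) := if_neg hc
    rw [h1, hfit true true (by simp [hc]), if_neg hc, weightVal_update hc]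
    split_ifs
    · exact mul_left_comm _ _ _
    · exact mul_zero _

lemma FlipsAt.coord_changeMap_changeMap (h : FlipsAt D₁ D₂ eX eA S) (y : D₁.Chain) (w : D₁.State)
    (κ : D₁.Arc → Bool) :
    coord (changeMap eX.symm eA.symm (S.map eX.toEmbedding) (changeMap eX eA S y)) w κ =
      (∏ c ∈ S, dotVal c κ) * coord y w κ := by
  have hw : pullState eX S (pullState eX.symm (S.map eX.toEmbedding) w) = w := by
    funext c
    by_cases hc : c ∈ S <;> simp [pullState, hc]
  have hκ : (κ ∘ eA.symm) ∘ eA = κ := by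
    funext a
    simp
  rw [h.symm.coord_changeMap, h.coord_changeMap, hw, hκ, ← mul_assoc]
  congr 1
  rw [weightVal, weightVal, Finset.prod_map, ← Finset.prod_mul_distrib]
  refine Finset.prod_congr rfl fun c hc => ?_
  have h1 := h.dotVal_eq c (κ ∘ eA.symm)
  rw [hκ] at h1
  have h2 : pullState eX.symm (S.map eX.toEmbedding) w (eX c) = !w c := by
    simp [pullState, hc]
  change (if pullState eX.symm (S.map eX.toEmbedding) w (eX c) = true then
    dotVal (eX c) (κ ∘ eA.symm) else 1) * _ = _
  rw [h2, ← h1]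
  cases w c <;> simp

end change

end KnotDiagram

namespace TransvergentDiagram

open KnotDiagram BNField

variable {D D' : TransvergentDiagram}

/-! ### The involution in coordinates -/

lemma fits_τArc (i : D.Crossing) (b : Bool) (κ : D.Arc → Bool) :
    Fits i b (κ ∘ D.τArc) ↔ Fits (D.τ i) b κ := by
  have key : ∀ (b : Bool) (s k : ZMod 4), (s = 1 ∨ s = 3) →
      s - partner b k = partner b (s - k) := by decide
  constructor
  · intro h k
    have := h (D.shift i - k)
    rwa [Function.comp_apply, Function.comp_apply, D.τArc_arc, D.τArc_arc,
      key _ _ _ (D.shift_odd i), sub_sub_cancel] at this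
  · intro h k
    rw [Function.comp_apply, Function.comp_apply, D.τArc_arc, D.τArc_arc, key _ _ _ (D.shift_odd i)]
    exact h _

lemma comp_τArc_τArc (κ : D.Arc → Bool) : (κ ∘ D.τArc) ∘ D.τArc = κ := by
  funext a
  simp [D.τArc_τArc]

lemma valid_τArc {w : D.State} {κ : D.Arc → Bool} :
    Valid (w ∘ D.τ) (κ ∘ D.τArc) ↔ Valid w κ := by
  constructor
  · intro h i
    have := (fits_τArc _ _ _).1 (h (D.τ i))
    rwa [Function.comp_apply, D.τ_τ] at this
  · exact fun h i => (fits_τArc _ _ _).2 (h _)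

lemma coord_invol (y : D.Chain) (w : D.State) (κ : D.Arc → Bool) :
    coord (D.invol y) w κ = coord y (w ∘ D.τ) (κ ∘ D.τArc) := by
  by_cases hv : Valid w κ
  · have hcard : Nat.card (D.Circle (w ∘ D.τ)) = Nat.card (D.Circle w) := by
      refine card_circle_eq (D₁ := D.toKnotDiagram) (D₂ := D.toKnotDiagram) D.τArc D.τArc
        (fun κ hκ => ⟨valid_τArc.2 hκ, comp_τArc_τArc κ⟩)
        fun κ hκ => ⟨valid_τArc.1 ?_, comp_τArc_τArc κ⟩
      rwa [comp_τArc_τArc]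
    rw [coord_of_valid hv, coord_of_valid (valid_τArc.2 hv), evalState_invol (valid_iff.1 hv),
      hcard]
  · rw [coord_of_not_valid hv, coord_of_not_valid (mt valid_τArc.1 hv)]

lemma update_comp_τ (w : D.State) (i : D.Crossing) (b : Bool) :
    Function.update (w ∘ D.τ) i b = Function.update w (D.τ i) b ∘ D.τ := by
  funext j
  by_cases hj : j = i
  · subst hj
    simp
  · have : D.τ j ≠ D.τ i := fun h => hj (by rw [← D.τ_τ j, h, D.τ_τ])
    simp [Function.update_of_ne hj, Function.update_of_ne this]

lemma invol_saddleAt (i : D.Crossing) (b : Bool) (y : D.Chain) :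
    D.invol (saddleAt i b y) = saddleAt (D.τ i) b (D.invol y) := by
  classical
  refine coord_ext fun w κ _ => ?_
  simp only [coord_invol, coord_saddleAt, fits_τArc, update_comp_τ, Function.comp_apply]

lemma dotVal_τArc (c : D.Crossing) (κ : D.Arc → Bool) :
    dotVal c (κ ∘ D.τArc) = dotVal (D.τ c) κ := by
  classical
  simp only [dotVal, fits_τArc]

lemma invol_dotAt (c : D.Crossing) (y : D.Chain) :
    D.invol (dotAt c y) = dotAt (D.τ c) (D.invol y) := by
  refine coord_ext fun w κ _ => ?_
  rw [coord_invol, coord_dotAt, coord_dotAt, coord_invol, dotVal_τArc]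

lemma invol_diff (y : D.Chain) : D.invol (D.diff y) = D.diff (D.invol y) :=
  LinearMap.congr_fun D.invol_comp_diff y

/-! ### Changing one crossing on the axis or two crossings off the axis -/

variable {eX : D.Crossing ≃ D'.Crossing} {eA : D.Arc ≃ D'.Arc} {o : D.Crossing → ZMod 4}
  {S : Finset D.Crossing}

lemma SameShadow.flipsAt (h : SameShadow D D' eX eA o) (hS : ∀ i, (o i = 1 ∨ o i = 3) ↔ i ∈ S) :
    FlipsAt D.toKnotDiagram D'.toKnotDiagram eX eA S := by
  intro c b κ
  have key : ∀ (b : Bool) (o k : ZMod 4),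
      partner b k + o = partner (if o = 1 ∨ o = 3 then !b else b) (k + o) := by decide
  have hb : (if c ∈ S then !b else b) = if o c = 1 ∨ o c = 3 then !b else b := by
    simp only [hS]
  rw [hb]
  constructor
  · intro hf k
    have := hf (k - o c)
    rwa [Function.comp_apply, Function.comp_apply, ← h.1, ← h.1, key, sub_add_cancel] at this
  · intro hf k
    rw [Function.comp_apply, Function.comp_apply, ← h.1, ← h.1, key]
    exact hf _

lemma changeMap_invol (h : FlipsAt D.toKnotDiagram D'.toKnotDiagram eX eA S)
    (hX : ∀ i, D'.τ (eX i) = eX (D.τ i)) (hA : ∀ e, D'.τArc (eA e) = eA (D.τArc e))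
    (hS : ∀ i, D.τ i ∈ S ↔ i ∈ S) (y : D.Chain) :
    changeMap eX eA S (D.invol y) = D'.invol (changeMap eX eA S y) := by
  refine coord_ext fun w κ _ => ?_
  have hw : pullState eX S (w ∘ D'.τ) = pullState eX S w ∘ D.τ := by
    funext c
    simp only [pullState, Function.comp_apply, hX, hS]
  have hκ : (κ ∘ D'.τArc) ∘ eA = (κ ∘ eA) ∘ D.τArc := by
    funext a
    simp only [Function.comp_apply, hA]
  rw [h.coord_changeMap, coord_invol, coord_invol, h.coord_changeMap, hw, hκ]
  congr 1
  symm
  refine Finset.prod_bij (fun c _ => D.τ c) (fun c hc => (hS c).2 hc)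
    (fun a _ b _ hab => by rw [← D.τ_τ a, hab, D.τ_τ])
    (fun c hc => ⟨D.τ c, (hS c).2 hc, D.τ_τ c⟩) fun c _ => ?_
  rw [dotVal_τArc]
  rfl

/-- The sum of the dots at `c` is coherently homotopic to `H` if `c` lies on the axis. -/
lemma exists_homotopy_dotAt {c : D.Crossing} (hc : D.τ c = c) :
    ∃ h k : D.Chain →ₗ[BNRing] D.Chain,
      (∀ y, dotAt c y + varH ^ 1 • y = D.diff (h y) + h (D.diff y)) ∧
      ∀ y, h (D.invol y) + D.invol (h y) = D.diff (k y) + k (D.diff y) := by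
  refine ⟨saddleAt c false, 0, fun y => ?_, fun y => ?_⟩
  · rw [diff_saddleAt_false, pow_one]
  · rw [invol_saddleAt, hc]
    simp [EquivariantComplex.add_self_eq_zero]

/-- The product of the dots at two crossings that are exchanged by the reflection is coherently homotopic
to `H²`.  Each factor is homotopic to `H` by a reverse saddle `hc`, and the two ways of combining these
homotopies differ by the boundary of `h_c h_{τ c}`. -/
lemma exists_homotopy_dotAt_dotAt (c : D.Crossing) :
    ∃ h k : D.Chain →ₗ[BNRing] D.Chain,
      (∀ y, dotAt c (dotAt (D.τ c) y) + varH ^ 2 • y = D.diff (h y) + h (D.diff y)) ∧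
      ∀ y, h (D.invol y) + D.invol (h y) = D.diff (k y) + k (D.diff y) := by
  have h0 : ∀ z : D.Chain, z + z = 0 := EquivariantComplex.add_self_eq_zero
  refine ⟨saddleAt c false ∘ₗ dotAt (D.τ c) + varH • saddleAt (D.τ c) false,
    saddleAt c false ∘ₗ saddleAt (D.τ c) false ∘ₗ D.invol, fun y => ?_, fun y => ?_⟩
  · have h1 := diff_saddleAt_false c (dotAt (D.τ c) y)
    have h2 := congrArg (fun z => varH • z) (diff_saddleAt_false (D.τ c) y)
    simp only [smul_add, smul_smul] at h2
    simp only [LinearMap.add_apply, LinearMap.comp_apply, LinearMap.smul_apply, map_add, map_smul,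
      dotAt_diff]
    calc dotAt c (dotAt (D.τ c) y) + varH ^ 2 • y
        = (dotAt c (dotAt (D.τ c) y) + varH • dotAt (D.τ c) y) +
            (varH • dotAt (D.τ c) y + (varH * varH) • y) := by
          rw [add_add_add_comm, add_assoc, ← add_assoc (varH • dotAt (D.τ c) y), h0, zero_add,
            pow_two]
      _ = _ := by
          rw [← h1, ← h2]
          abel
  · have h1 := diff_saddleAt_false c (saddleAt (D.τ c) false (D.invol y))
    have h2 := congrArg (saddleAt c false) (diff_saddleAt_false (D.τ c) (D.invol y))
    simp only [map_add, map_smul] at h2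
    simp only [LinearMap.add_apply, LinearMap.comp_apply, LinearMap.smul_apply, map_add, map_smul,
      invol_saddleAt, invol_dotAt, D.τ_τ, invol_diff]
    rw [← dotAt_saddleAt c (D.τ c)]
    calc _ = (dotAt c (saddleAt (D.τ c) false (D.invol y)) +
              varH • saddleAt (D.τ c) false (D.invol y)) +
            (saddleAt c false (dotAt (D.τ c) (D.invol y)) +
              varH • saddleAt c false (D.invol y)) := by abel
      _ = (D.diff (saddleAt c false (saddleAt (D.τ c) false (D.invol y))) +
            saddleAt c false (saddleAt (D.τ c) false (D.diff (D.invol y)))) +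
            (saddleAt c false (D.diff (saddleAt (D.τ c) false (D.invol y))) +
              saddleAt c false (D.diff (saddleAt (D.τ c) false (D.invol y)))) := by
          rw [← h1, ← h2]
          abel
      _ = _ := by rw [h0, add_zero]

lemma changeMap_coherentSection (t : ℕ) (h : FlipsAt D.toKnotDiagram D'.toKnotDiagram eX eA S)
    (hX : ∀ i, D'.τ (eX i) = eX (D.τ i)) (hA : ∀ e, D'.τArc (eA e) = eA (D.τArc e))
    (hS : ∀ i, D.τ i ∈ S ↔ i ∈ S) (P : D.Chain → D.Chain)
    (hP : ∀ y w κ, coord (P y) w κ = (∏ c ∈ S, dotVal c κ) * coord y w κ)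
    (hh : ∃ h k : D.Chain →ₗ[BNRing] D.Chain,
      (∀ y, P y + varH ^ t • y = D.diff (h y) + h (D.diff y)) ∧
      ∀ y, h (D.invol y) + D.invol (h y) = D.diff (k y) + k (D.diff y)) :
    CoherentSection t D D' (changeMap eX eA S)
      (changeMap eX.symm eA.symm (S.map eX.toEmbedding)) where
  map_diff := h.changeMap_diff
  map_invol := changeMap_invol h hX hA hS
  homotopy := by
    have : ∀ y, changeMap eX.symm eA.symm (S.map eX.toEmbedding) (changeMap eX eA S y) = P y :=
      fun y => coord_ext fun w κ _ => by rw [h.coord_changeMap_changeMap, hP]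
    simpa only [this] using hh

lemma exists_coherentSection_of_sameShadow (t : ℕ) (h : SameShadow D D' eX eA o)
    (hS : ∀ i, (o i = 1 ∨ o i = 3) ↔ i ∈ S) (hSτ : ∀ i, D.τ i ∈ S ↔ i ∈ S)
    (hh : ∀ (E : TransvergentDiagram) (e : D.Crossing ≃ E.Crossing),
      (∀ i, E.τ (e i) = e (D.τ i)) → ∃ P : E.Chain → E.Chain,
      (∀ y w κ, coord (P y) w κ = (∏ c ∈ S.map e.toEmbedding, dotVal c κ) * coord y w κ) ∧
      ∃ h k : E.Chain →ₗ[BNRing] E.Chain,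
        (∀ y, P y + varH ^ t • y = E.diff (h y) + h (E.diff y)) ∧
        ∀ y, h (E.invol y) + E.invol (h y) = E.diff (k y) + k (E.diff y)) :
    ∃ (F : D.Chain →ₗ[BNRing] D'.Chain) (G : D'.Chain →ₗ[BNRing] D.Chain),
      CoherentSection t D D' F G ∧ CoherentSection t D' D G F := by
  have hf := h.flipsAt hS
  obtain ⟨P, hP, hPh⟩ := hh D (Equiv.refl _) fun _ => rfl
  obtain ⟨P', hP', hPh'⟩ := hh D' eX h.2.1
  have e1 : S.map (Equiv.refl D.Crossing).toEmbedding = S := Finset.map_refl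
  rw [e1] at hP
  refine ⟨_, _, changeMap_coherentSection t hf h.2.1 h.2.2.1 hSτ P hP hPh, ?_⟩
  have hX : ∀ i, D.τ (eX.symm i) = eX.symm (D'.τ i) := fun i => by
    rw [Equiv.eq_symm_apply, ← h.2.1, Equiv.apply_symm_apply]
  have hA : ∀ e, D.τArc (eA.symm e) = eA.symm (D'.τArc e) := fun e => by
    rw [Equiv.eq_symm_apply, ← h.2.2.1, Equiv.apply_symm_apply]
  have := changeMap_coherentSection t hf.symm hX hA (fun i => by
    simp only [Finset.mem_map_equiv, ← hX, hSτ]) P' hP' hPh'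
  have e2 : (S.map eX.toEmbedding).map eX.symm.toEmbedding = S := by
    ext i
    simp
  rwa [e2, Equiv.symm_symm, Equiv.symm_symm] at this

lemma TypeA.exists_coherentSection (h : TypeA D D') :
    ∃ (F : D.Chain →ₗ[BNRing] D'.Chain) (G : D'.Chain →ₗ[BNRing] D.Chain),
      CoherentSection 2 D D' F G ∧ CoherentSection 2 D' D G F := by
  obtain ⟨eX, eA, o, hsh, c, hc, ho⟩ := h
  refine exists_coherentSection_of_sameShadow (S := {c, D.τ c}) 2 hsh (fun i => by simp [ho])
    (fun i => ?_) fun E e he => ?_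
  · have h1 : D.τ i = D.τ c ↔ i = c :=
      ⟨fun h => by rw [← D.τ_τ i, h, D.τ_τ], fun h => by rw [h]⟩
    have h2 : D.τ i = c ↔ i = D.τ c :=
      ⟨fun h => by rw [← h, D.τ_τ], fun h => by rw [h, D.τ_τ]⟩
    simp only [Finset.mem_insert, Finset.mem_singleton, h1, h2]
    exact or_comm
  · refine ⟨_, fun y w κ => ?_, exists_homotopy_dotAt_dotAt (e c)⟩
    rw [coord_dotAt, coord_dotAt, Finset.prod_map, Finset.prod_pair hc.symm, mul_assoc, he]
    rfl

lemma TypeB.exists_coherentSection (h : TypeB D D') :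
    ∃ (F : D.Chain →ₗ[BNRing] D'.Chain) (G : D'.Chain →ₗ[BNRing] D.Chain),
      CoherentSection 1 D D' F G ∧ CoherentSection 1 D' D G F := by
  obtain ⟨eX, eA, o, hsh, c, hc, ho⟩ := h
  refine exists_coherentSection_of_sameShadow (S := {c}) 1 hsh (fun i => by simp [ho])
    (fun i => ?_) fun E e he => ?_
  · rw [Finset.mem_singleton, Finset.mem_singleton]
    exact ⟨fun h => by rw [← D.τ_τ i, h, hc], fun h => by rw [h, hc]⟩
  · refine ⟨_, fun y w κ => ?_, exists_homotopy_dotAt (c := e c) (by rw [he, hc])⟩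
    rw [coord_dotAt, Finset.prod_map, Finset.prod_singleton]
    rfl

end TransvergentDiagram

/-! ### The algebra of a clasp -/

/-- The relations between the saddles at the two crossings of a clasp and the birth and the death of the
small circle of the clasp.  The projections `p`, `q`, `b`, `c` belong to the resolutions of the two
crossings by two strands, by one turned crossing (left, right), and by both turned crossings, which
creates the small circle.  The saddles `u₁`, `u₂` turn the left and the right crossing, `v₁`, `v₂` turn
them back, `ι` and `ε` are the birth and the death of the small circle at the right crossing, and `I` is
the involution.  The list is invariant under reversing all products and exchanging `u` with `v` and `ι`
with `ε`. -/
structure ClaspRelations {S R : Type} [CommRing S] [Ring R] [Algebra S R] (H : S)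
    (p q b c u₁ u₂ v₁ v₂ ι ε I : R) : Prop where
  sum_proj : p + q + b + c = 1
  proj_p : p * p = p
  proj_c : c * c = c
  proj_pc : p * c = 0
  proj_cp : c * p = 0
  u₁_p : q * u₁ = u₁ * p
  u₁_b : c * u₁ = u₁ * b
  p_u₁ : p * u₁ = 0
  b_u₁ : b * u₁ = 0
  u₁_q : u₁ * q = 0
  u₁_c : u₁ * c = 0
  u₂_p : b * u₂ = u₂ * p
  u₂_q : c * u₂ = u₂ * q
  p_u₂ : p * u₂ = 0
  q_u₂ : q * u₂ = 0
  u₂_c : u₂ * c = 0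
  p_v₁ : v₁ * q = p * v₁
  b_v₁ : v₁ * c = b * v₁
  v₁_p : v₁ * p = 0
  v₁_b : v₁ * b = 0
  q_v₁ : q * v₁ = 0
  c_v₁ : c * v₁ = 0
  p_v₂ : v₂ * b = p * v₂
  q_v₂ : v₂ * c = q * v₂
  v₂_p : v₂ * p = 0
  v₂_q : v₂ * q = 0
  c_v₂ : c * v₂ = 0
  ι_q : ι * q = ι
  c_ι : c * ι = ι
  ε_c : ε * c = ε
  q_ε : q * ε = ε
  u_comm : u₁ * u₂ = u₂ * u₁
  v_comm : v₂ * v₁ = v₁ * v₂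
  u₁_v₂ : u₁ * v₂ = v₂ * u₁
  u₂_v₁ : u₂ * v₁ = v₁ * u₂
  uvu : u₁ * v₁ * u₁ = H • u₁
  vuv : v₁ * u₁ * v₁ = H • v₁
  vu_b : v₁ * u₁ * b = H • b
  ε_u₂ : ε * u₂ * q = q
  v₂_ι : q * v₂ * ι = q
  ε_ι : ε * ι = 0
  neck : u₂ * ε + ι * v₂ + H • (ι * ε) = c
  slide : ε * u₁ * v₁ * ι = q
  v₂_eq : v₂ * b = v₁ * ε * u₁
  u₂_eq : b * u₂ = v₁ * ι * u₁
  I_I : I * I = 1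
  I_p : I * p = p * I
  I_c : I * c = c * I
  I_u₁ : I * u₁ = u₂ * I
  I_v₁ : I * v₁ = v₂ * I
  I_ε : I * ε = v₁ * ι * ε * I
  I_ι : ι * I = I * ι * ε * u₁

namespace ClaspRelations

variable {S R : Type} [CommRing S] [Ring R] [Algebra S R] {H : S}
  {p q b c u₁ u₂ v₁ v₂ ι ε I : R}

/-- Reversing products exchanges the roles of the `0`- and the `1`-resolution of the clasp. -/
lemma reverse (h : ClaspRelations H p q b c u₁ u₂ v₁ v₂ ι ε I) :
    ClaspRelations H (.op p : Rᵐᵒᵖ) (.op q) (.op b) (.op c) (.op v₁) (.op v₂) (.op u₁) (.op u₂)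
      (.op ε) (.op ι) (.op I) := by
  have conj {x y : R} (hxy : I * x = y * I) : x * I = I * y := by
    rw [← mul_one (I * y), ← h.I_I, ← mul_assoc, mul_assoc I y, ← hxy, ← mul_assoc, h.I_I, one_mul]
  constructor
  all_goals
    simp only [← MulOpposite.op_mul, ← MulOpposite.op_add, ← MulOpposite.op_smul,
      ← MulOpposite.op_one, ← MulOpposite.op_zero, MulOpposite.op_inj, ← mul_assoc]
  exacts [h.sum_proj, h.proj_p, h.proj_c, h.proj_cp, h.proj_pc, h.p_v₁, h.b_v₁, h.v₁_p, h.v₁_b,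
    h.q_v₁, h.c_v₁, h.p_v₂, h.q_v₂, h.v₂_p, h.v₂_q, h.c_v₂, h.u₁_p, h.u₁_b, h.p_u₁, h.b_u₁,
    h.u₁_q, h.u₁_c, h.u₂_p, h.u₂_q, h.p_u₂, h.q_u₂, h.u₂_c, h.q_ε, h.ε_c, h.c_ι, h.ι_q,
    h.v_comm, h.u_comm, h.u₂_v₁, h.u₁_v₂, h.vuv, h.uvu, by rw [← h.b_v₁, mul_assoc, h.u₁_b, ←
    mul_assoc, h.vu_b], h.v₂_ι, h.ε_u₂, h.ε_ι, by rw [add_comm (ι * v₂), h.neck], h.slide,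
    h.u₂_eq, h.v₂_eq, h.I_I, h.I_p.symm, h.I_c.symm, conj h.I_v₁, conj h.I_u₁, h.I_ι, h.I_ε]

/-- The algebra behind the clasp.  If the differential of the clasp is `u₁ + u₂`, the resolution by two
strands is a quotient complex of the clasp.  Then `F` and `G` are chain maps from it to the clasp and
back, with `G F = H`; `k` is a homotopy from `F G` to `H`, and `m` is a homotopy between `k` and its
reflection. -/
lemma exists_maps (h : ClaspRelations H p q b c u₁ u₂ v₁ v₂ ι ε I) (add_self : ∀ x : R, x + x = 0) :
    ∃ F G k m : R, F * p = F ∧ p * G = G ∧ (u₁ + u₂) * F = 0 ∧ G * (u₁ + u₂) = 0 ∧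
      G * F = H • p ∧ F * G + H • 1 = (u₁ + u₂) * k + k * (u₁ + u₂) ∧
      I * F = F * I ∧ I * G = G * I ∧ k * I + I * k = (u₁ + u₂) * m + m * (u₁ + u₂) ∧
      ∀ d : R, Commute d p → Commute d c → Commute d u₁ → Commute d v₁ → Commute d v₂ →
        Commute d ι → Commute d ε → Commute d I →
        Commute d F ∧ Commute d G ∧ Commute d k ∧ Commute d m := by
  -- Every identity below is a sum of multiples of the relations modulo `2`; `expand` turns products
  -- into sums of words, and `even` removes the words that occur an even number of times.
  have expand : (∀ x y z : R, x * (y + z) = x * y + x * z) ∧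
      (∀ x y z : R, (x + y) * z = x * z + y * z) ∧ (∀ x y z : R, x * y * z = x * (y * z)) ∧
      (∀ x y : R, H • (x + y) = H • x + H • y) ∧ (∀ x y : R, H • x * y = H • (x * y)) ∧
      (∀ x y : R, x * H • y = H • (x * y)) ∧ (∀ x : R, x * 0 = 0) ∧ (∀ x : R, 0 * x = 0) ∧
      (H • (0 : R) = 0) ∧ (∀ x : R, x * 1 = x) ∧ (∀ x : R, 1 * x = x) :=
    ⟨mul_add, add_mul, mul_assoc, smul_add H, smul_mul_assoc H, fun x y => mul_smul_comm H x y,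
      mul_zero, zero_mul, smul_zero H, mul_one, one_mul⟩
  have even : (∀ x : R, (2 : ℤ) • x = 0) ∧ (∀ x : R, (-2 : ℤ) • x = 0) ∧ (∀ x : R, (4 : ℤ) • x = 0) ∧
      (∀ x : R, 0 + x = x) ∧ (∀ x : R, x + 0 = x) := by
    have h1 : ∀ x : R, (2 : ℤ) • x = 0 := fun x => by rw [two_zsmul, add_self]
    refine ⟨h1, fun x => by rw [neg_zsmul, h1, neg_zero], fun x => ?_, zero_add, add_zero⟩
    rw [show (4 : ℤ) = 2 * 2 by norm_num, mul_zsmul, h1]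
  have e1 : u₁ * ι = 0 := by
    linear_combination (norm := (simp only [expand]; abel_nf; simp only [even]))
      u₁ * h.c_ι + h.u₁_c * ι
  have e2 : u₂ * ι = 0 := by
    linear_combination (norm := (simp only [expand]; abel_nf; simp only [even]))
      u₂ * h.c_ι + h.u₂_c * ι
  have e3 : ε * v₁ = 0 := by
    linear_combination (norm := (simp only [expand]; abel_nf; simp only [even]))
      h.ε_c * v₁ + ε * h.c_v₁
  have e4 : ε * p = 0 := by
    linear_combination (norm := (simp only [expand]; abel_nf; simp only [even]))
      h.ε_c * p + ε * h.proj_cp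
  have e5 : p * ι = 0 := by
    linear_combination (norm := (simp only [expand]; abel_nf; simp only [even]))
      p * h.c_ι + h.proj_pc * ι
  have e6 : ε * u₂ = q := by
    linear_combination (norm := (simp only [expand]; abel_nf; simp only [even]))
      h.ε_c * u₂ + ε * h.u₂_q + h.ε_u₂
  have e7 : v₂ * ι = q := by
    linear_combination (norm := (simp only [expand]; abel_nf; simp only [even]))
      v₂ * h.c_ι + h.q_v₂ * ι + h.v₂_ι
  -- `v₂` times the neck-cutting relation is `v₂ u₂ ε = H ε`, and `ε u₂ = q`
  have e8 : v₂ * u₂ * q = H • q := by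
    linear_combination (norm := (simp only [expand]; abel_nf; simp only [even]))
      v₂ * h.neck * u₂ * q + v₂ * u₂ * h.ε_u₂ + e7 * v₂ * u₂ * q + h.q_v₂ * u₂ * q +
        H • (e7 * ε * u₂ * q) + H • (h.q_ε * u₂ * q) + H • h.ε_u₂
  have e9 : p * v₁ * v₂ * c = v₁ * v₂ * c := by
    linear_combination (norm := (simp only [expand]; abel_nf; simp only [even]))
      h.p_v₁ * v₂ * c + v₁ * h.q_v₂ * c + v₁ * v₂ * h.proj_c
  have e10 : p * v₁ * ε = v₁ * ε := by
    linear_combination (norm := (simp only [expand]; abel_nf; simp only [even]))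
      h.p_v₁ * ε + v₁ * h.q_ε
  -- insert the neck-cutting relation to the right of `ε u₁ v₁`
  have e11 : ε * u₁ * v₁ * c = u₁ * v₁ * ε + v₂ * c + H • ε := by
    linear_combination (norm := (simp only [expand]; abel_nf; simp only [even]))
      ε * u₁ * v₁ * h.neck + h.slide * v₂ + h.q_v₂ + H • (h.slide * ε) + H • h.q_ε +
        ε * u₁ * h.u₂_v₁ * ε + ε * h.u_comm * v₁ * ε + e6 * u₁ * v₁ * ε + h.u₁_p * v₁ * ε +
        u₁ * h.p_v₁ * ε + u₁ * v₁ * h.q_ε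
  -- insert the neck-cutting relation to the left of `u₁ v₁`
  have e12 : u₁ * v₁ * c =
      u₂ * u₁ * v₁ * ε + u₂ * v₂ * c + ι * u₁ * v₁ * v₂ * c + H • (ι * u₁ * v₁ * ε) + H • c := by
    linear_combination (norm := (simp only [expand]; abel_nf; simp only [even]))
      h.neck * u₁ * v₁ * c + h.u₁_b * v₁ * c + u₁ * h.b_v₁ * c + u₁ * v₁ * h.proj_c + u₂ * e11 +
        ι * h.u₁_v₂ * v₁ * c + ι * u₁ * h.v_comm * c + H • (ι * e11) + H • (h.neck * c) +
        H • (u₂ * h.ε_c) + H • (H • (ι * h.ε_c)) + H • h.proj_c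
  have e13 : (H • p + v₁ * u₁ * p + ι * u₁ * p) * (p + v₁ * v₂ * c + H • (v₁ * ε)) =
      H • p + v₁ * u₁ * p + ι * u₁ * p + ι * u₁ * v₁ * v₂ * c + H • (ι * u₁ * v₁ * ε) := by
    linear_combination (norm := (simp only [expand]; abel_nf; simp only [even]))
      H • h.proj_p + v₁ * u₁ * h.proj_p + ι * u₁ * h.proj_p + H • e9 + v₁ * u₁ * e9 + ι * u₁ * e9 +
        h.vuv * v₂ * c + H • (H • e10) + H • (v₁ * u₁ * e10) + H • (ι * u₁ * e10) +
        H • (h.vuv * ε)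
  have e14 : v₂ * u₂ * p = v₁ * u₁ * p := by
    linear_combination (norm := (simp only [expand]; abel_nf; simp only [even]))
      v₂ * h.u₂_p + v₂ * h.u₂_eq + h.v_comm * ι * u₁ + v₁ * e7 * u₁ + v₁ * h.u₁_p
  have e15 : I * ι = ι * ε * u₁ * I := by
    linear_combination (norm := (simp only [expand]; abel_nf; simp only [even]))
      I * ι * h.I_I + I * h.I_ι * I + h.I_I * ι * ε * u₁ * I
  have e16 : I * v₂ = v₁ * I := by
    linear_combination (norm := (simp only [expand]; abel_nf; simp only [even]))
      I * h.I_v₁ * I + h.I_I * v₁ * I + I * v₂ * h.I_I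
  have e17 : I * u₂ = u₁ * I := by
    linear_combination (norm := (simp only [expand]; abel_nf; simp only [even]))
      I * h.I_u₁ * I + h.I_I * u₁ * I + I * u₂ * h.I_I
  -- `v₁ u₁ + H` is the sum of the dots on the two strands at the left crossing; the term `ι u₁` of `F`
  -- makes it a chain map, and in `G` the terms through the closed small circle do so.
  refine ⟨H • p + v₁ * u₁ * p + ι * u₁ * p, p + v₁ * v₂ * c + H • (v₁ * ε),
    v₁ + v₂ * c + u₁ * v₁ * ε + ι, (v₁ * ε + ι * ε) * I, ?_, ?_, ?_, ?_, ?_, ?_, ?_, ?_, ?_, ?_⟩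
  · linear_combination (norm := (simp only [expand]; abel))
      H • h.proj_p + v₁ * u₁ * h.proj_p + ι * u₁ * h.proj_p
  · linear_combination (norm := (simp only [expand]; abel))
      h.proj_p + e9 + H • e10
  · linear_combination (norm := (simp only [expand]; abel_nf; simp only [even]))
      h.uvu * p + e1 * u₁ * p + e2 * u₁ * p + h.u₂_v₁ * u₁ * p + v₁ * h.u_comm * p + H • h.u₂_p +
        H • h.u₂_eq + v₁ * u₁ * h.u₂_p + v₁ * u₁ * h.u₂_eq + h.vuv * ι * u₁
  · linear_combination (norm := (simp only [expand]; abel_nf; simp only [even]))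
      h.p_u₁ + h.p_u₂ + v₁ * v₂ * h.u₁_b + v₁ * h.u₁_v₂ * b + v₁ * u₁ * h.v₂_eq + h.vuv * ε * u₁ +
        v₁ * v₂ * h.u₂_q + v₁ * e8 + H • (v₁ * e6)
  · linear_combination (norm := (simp only [expand]; abel_nf; simp only [even]))
      H • h.proj_p + h.p_v₁ * u₁ * p + e5 * u₁ * p + H • (v₁ * v₂ * h.proj_cp) +
        v₁ * v₂ * h.c_v₁ * u₁ * p + v₁ * v₂ * h.c_ι * u₁ * p + v₁ * e7 * u₁ * p +
        H • (H • (v₁ * e4)) + H • (v₁ * e3 * u₁ * p) + H • (v₁ * h.ε_ι * u₁ * p)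
  · linear_combination (norm := (simp only [expand]; abel_nf; simp only [even]))
      e13 + u₁ * h.q_v₂ + h.u₁_q * v₂ + u₁ * u₁ * e10 + u₁ * h.u₁_p * v₁ * ε +
        h.u₁_q * u₁ * v₁ * ε + e1 + h.u₂_v₁ + e2 + v₂ * h.u₁_b + h.u₁_v₂ * b + u₁ * h.v₂_eq +
        v₂ * h.u₂_q + e8 + u₁ * v₁ * e6 + h.ι_q * u₂ + ι * h.q_u₂ + h.ι_q * u₁ + ι * h.u₁_p +
        v₁ * u₁ * h.sum_proj + v₁ * h.u₁_q + v₁ * h.u₁_c + h.vu_b + u₁ * h.v₁_p + u₁ * h.v₁_b +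
        u₁ * v₁ * h.sum_proj + e12 + H • h.sum_proj
  · linear_combination (norm := (simp only [expand]; abel))
      H • h.I_p + h.I_v₁ * u₁ * p + v₂ * h.I_u₁ * p + v₂ * u₂ * h.I_p + e14 * I + e15 * u₁ * p +
        ι * ε * u₁ * h.I_u₁ * p + ι * ε * u₁ * u₂ * h.I_p + ι * ε * h.u_comm * p * I +
        ι * e6 * u₁ * p * I + h.ι_q * u₁ * p * I
  · linear_combination (norm := (simp only [expand]; abel))
      h.I_p + h.I_v₁ * v₂ * c + v₂ * e16 * c + h.v_comm * I * c + v₁ * v₂ * h.I_c +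
        H • (h.I_v₁ * ε) + H • (v₂ * h.I_ε) + H • (h.v_comm * ι * ε * I) + H • (v₁ * e7 * ε * I) +
        H • (v₁ * h.q_ε * I)
  · linear_combination (norm := (simp only [expand]; abel_nf; simp only [even]))
      h.I_v₁ + e16 * c + v₁ * h.I_c + h.I_u₁ * v₁ * ε + u₂ * h.I_v₁ * ε + u₂ * v₂ * h.I_ε +
        u₂ * h.v_comm * ι * ε * I + u₂ * v₁ * e7 * ε * I + u₂ * v₁ * h.q_ε * I + e15 + e1 * ε * I +
        e2 * ε * I + (v₁ * ε + ι * ε) * h.I_u₁ + (v₁ * ε + ι * ε) * e17 + v₁ * e6 * I + ι * e6 * I +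
        h.ι_q * I + h.v₂_eq * I + v₁ * h.sum_proj * I + h.v₁_p * I + h.v₁_b * I +
        v₂ * h.sum_proj * I + h.v₂_p * I + h.v₂_q * I
  · intro d hp hc hu hv hv' hι hε hI
    exact ⟨((hp.smul_right H).add_right ((hv.mul_right hu).mul_right hp)).add_right
        ((hι.mul_right hu).mul_right hp),
      (hp.add_right ((hv.mul_right hv').mul_right hc)).add_right ((hv.mul_right hε).smul_right H),
      ((hv.add_right (hv'.mul_right hc)).add_right ((hu.mul_right hv).mul_right hε)).add_right hι,
      ((hv.mul_right hε).add_right (hι.mul_right hε)).mul_right hI⟩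

end ClaspRelations

/-! ### The counit at one circle -/

open Classical in
/-- Apply the counit `x ↦ 1`, `1 ↦ 0` to the tensor factor of the circle `c`; the factor of any other
circle `s` goes to `f s`. -/
noncomputable def counitAt {S T : Type} [Fintype S] (c : S) (f : S → T) :
    circleModule S →ₗ[BNRing] circleModule T :=
  PiTensorProduct.lift
    ((MultilinearMap.mkPiAlgebra BNRing S (circleModule T)).compLinearMap fun s =>
      if s = c then Algebra.linearMap BNRing (circleModule T) ∘ₗ BNAlg.coeffX else factor (f s))

open Classical in
/-- Over the field of fractions, the counit is the sum of the two evaluations divided by `H`. -/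
lemma evalAt_counitAt {S T : Type} [Fintype S] [Fintype T] (ε : T → Bool) (c : S) (f : S → T)
    (y : circleModule S) :
    varH * evalAt ε (counitAt c f y) =
      ∑ x : Bool, evalAt (fun s => if s = c then x else ε (f s)) y := by
  have h : varH • ((evalAt ε).toLinearMap ∘ₗ counitAt c f) =
      ∑ x : Bool, (evalAt (fun s => if s = c then x else ε (f s))).toLinearMap := by
    refine PiTensorProduct.ext (MultilinearMap.ext fun v => ?_)
    simp only [LinearMap.compMultilinearMap_apply, LinearMap.smul_apply, LinearMap.comp_apply,
      counitAt, PiTensorProduct.lift.tprod, MultilinearMap.compLinearMap_apply,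
      MultilinearMap.mkPiAlgebra_apply, AlgHom.toLinearMap_apply, map_prod, LinearMap.sum_apply,
      evalAt_tprod, smul_eq_mul]
    have h1 : ∀ x : Bool, ∏ s, BNAlg.eval (if s = c then x else ε (f s)) (v s) =
        BNAlg.eval x (v c) * ∏ s ∈ Finset.univ.erase c, BNAlg.eval (ε (f s)) (v s) := fun x => by
      rw [← Finset.mul_prod_erase _ _ (Finset.mem_univ c), if_pos rfl]
      congr 1
      exact Finset.prod_congr rfl fun s hs => by rw [if_neg (Finset.ne_of_mem_erase hs)]
    simp only [h1]
    rw [← Finset.sum_mul, ← Finset.mul_prod_erase _ _ (Finset.mem_univ c), if_pos rfl, ← mul_assoc]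
    congr 1
    · have h2 : BNAlg.coeffOne (v c) + BNAlg.coeffOne (v c) = 0 := by
        rw [← two_mul, BNAlg.two_eq_zero, zero_mul]
      have h3 : ∀ b : Bool, BNAlg.eval b (v c) =
        BNAlg.coeffOne (v c) + (if b then varH else 0) * BNAlg.coeffX (v c) := fun _ => rfl
      rw [Fintype.sum_bool, h3, h3, LinearMap.comp_apply, Algebra.linearMap_apply, AlgHom.commutes]
      simp only [if_true, Bool.false_eq_true, if_false, Algebra.algebraMap_self, RingHom.id_apply]
      linear_combination -h2
    · exact Finset.prod_congr rfl fun s hs => by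
        rw [if_neg (Finset.ne_of_mem_erase hs), evalAt_factor]
  simpa using LinearMap.congr_fun h y

namespace KnotDiagram

open BNField

/-! ### Resolutions and colourings of a clasp -/

/-- A clasp with crossings `l` (left) and `r` (right).  The arcs `lo` and `up` are the lower and the upper
arc between the two crossings; the other arcs that meet the clasp are named after the corners at which
they leave it.  The resolution `!turn` of both crossings consists of two strands, the lower one
through `bl`, `lo`, `br` and the upper one through `tl`, `up`, `tr`; the resolution `turn` of both
crossings closes `lo` and `up` to a small circle. -/
structure Clasp (D : KnotDiagram) where
  l : D.Crossing
  r : D.Crossing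
  lo : D.Arc
  up : D.Arc
  bl : D.Arc
  tl : D.Arc
  br : D.Arc
  tr : D.Arc
  turn : Bool
  l_ne_r : l ≠ r
  bl_ne : bl ≠ lo ∧ bl ≠ up
  tl_ne : tl ≠ lo ∧ tl ≠ up
  br_ne : br ≠ lo ∧ br ≠ up
  tr_ne : tr ≠ lo ∧ tr ≠ up
  fits_l_not : ∀ κ : D.Arc → Bool, Fits l (!turn) κ ↔ κ bl = κ lo ∧ κ tl = κ up
  fits_r_not : ∀ κ : D.Arc → Bool, Fits r (!turn) κ ↔ κ br = κ lo ∧ κ tr = κ up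
  fits_l : ∀ κ : D.Arc → Bool, Fits l turn κ ↔ κ lo = κ up ∧ κ bl = κ tl
  fits_r : ∀ κ : D.Arc → Bool, Fits r turn κ ↔ κ lo = κ up ∧ κ br = κ tr
  arc_ne : ∀ i k, i ≠ l → i ≠ r → D.arc i k ≠ lo ∧ D.arc i k ≠ up

namespace Clasp

variable {D : KnotDiagram} (C : Clasp D)

/-- The resolution that is `a` at the left and `b` at the right crossing of the clasp, and agrees with
`w` at the other crossings. -/
def put (w : D.State) (a b : Bool) : D.State := Function.update (Function.update w C.l a) C.r b

lemma put_l (w : D.State) (a b : Bool) : C.put w a b C.l = a := by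
  rw [put, Function.update_of_ne C.l_ne_r, Function.update_self]

lemma put_r (w : D.State) (a b : Bool) : C.put w a b C.r = b := Function.update_self ..

lemma put_of_ne (w : D.State) (a b : Bool) {i : D.Crossing} (hl : i ≠ C.l) (hr : i ≠ C.r) :
    C.put w a b i = w i := by
  rw [put, Function.update_of_ne hr, Function.update_of_ne hl]

lemma update_put_r (w : D.State) (a b b' : Bool) :
    Function.update (C.put w a b) C.r b' = C.put w a b' := Function.update_idem ..

lemma update_put_l (w : D.State) (a b a' : Bool) :
    Function.update (C.put w a b) C.l a' = C.put w a' b := by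
  rw [put, put, Function.update_comm C.l_ne_r.symm, Function.update_idem,
    Function.update_comm C.l_ne_r]

lemma put_self (w : D.State) : C.put w (w C.l) (w C.r) = w := by
  rw [put, Function.update_eq_self, Function.update_eq_self]

open Classical in
/-- Colour both arcs of the small circle by `x`. -/
noncomputable def recolour (κ : D.Arc → Bool) (x : Bool) (a : D.Arc) : Bool :=
  if a = C.lo ∨ a = C.up then x else κ a

variable (κ : D.Arc → Bool) (x : Bool)

lemma recolour_of_ne {a : D.Arc} (h : a ≠ C.lo ∧ a ≠ C.up) : C.recolour κ x a = κ a :=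
  if_neg (not_or.2 h)

lemma recolour_lo : C.recolour κ x C.lo = x := if_pos (Or.inl rfl)

lemma recolour_up : C.recolour κ x C.up = x := if_pos (Or.inr rfl)

lemma recolour_bl : C.recolour κ x C.bl = κ C.bl := C.recolour_of_ne κ x C.bl_ne

lemma recolour_tl : C.recolour κ x C.tl = κ C.tl := C.recolour_of_ne κ x C.tl_ne

lemma recolour_br : C.recolour κ x C.br = κ C.br := C.recolour_of_ne κ x C.br_ne

lemma recolour_tr : C.recolour κ x C.tr = κ C.tr := C.recolour_of_ne κ x C.tr_ne

lemma recolour_recolour (x' : Bool) : C.recolour (C.recolour κ x) x' = C.recolour κ x' := by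
  funext a
  unfold recolour
  split_ifs <;> rfl

variable {κ x}

lemma recolour_eq_self (hlo : κ C.lo = x) (hup : κ C.up = x) : C.recolour κ x = κ := by
  funext a
  unfold recolour
  split_ifs with h
  · rcases h with rfl | rfl
    exacts [hlo.symm, hup.symm]
  · rfl

lemma fits_recolour {i : D.Crossing} (hl : i ≠ C.l) (hr : i ≠ C.r) (b : Bool) :
    Fits i b (C.recolour κ x) ↔ Fits i b κ := by
  unfold Fits
  simp only [C.recolour_of_ne κ x (C.arc_ne i _ hl hr)]

lemma valid_put_iff {w : D.State} {a b : Bool} : Valid (C.put w a b) κ ↔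
    Fits C.l a κ ∧ Fits C.r b κ ∧ ∀ i, i ≠ C.l → i ≠ C.r → Fits i (w i) κ := by
  constructor
  · refine fun h => ⟨?_, ?_, fun i hl hr => ?_⟩
    · simpa only [C.put_l] using h C.l
    · simpa only [C.put_r] using h C.r
    · simpa only [C.put_of_ne w a b hl hr] using h i
  · rintro ⟨h1, h2, h3⟩ i
    by_cases hl : i = C.l
    · rw [hl, C.put_l]
      exact h1
    by_cases hr : i = C.r
    · rw [hr, C.put_r]
      exact h2
    rw [C.put_of_ne w a b hl hr]
    exact h3 i hl hr

/-- Colouring the small circle differently does not matter outside of the clasp. -/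
lemma valid_put_recolour_iff {w : D.State} {a b : Bool} : Valid (C.put w a b) (C.recolour κ x) ↔
    Fits C.l a (C.recolour κ x) ∧ Fits C.r b (C.recolour κ x) ∧
      ∀ i, i ≠ C.l → i ≠ C.r → Fits i (w i) κ := by
  rw [C.valid_put_iff]
  refine and_congr_right fun _ => and_congr_right fun _ => forall_congr' fun i => ?_
  exact forall_congr' fun hl => forall_congr' fun hr => C.fits_recolour hl hr _

lemma fits_l_recolour : Fits C.l C.turn (C.recolour κ x) ↔ κ C.bl = κ C.tl := by
  rw [C.fits_l, C.recolour_lo, C.recolour_up, C.recolour_bl, C.recolour_tl]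
  exact and_iff_right rfl

lemma fits_r_recolour : Fits C.r C.turn (C.recolour κ x) ↔ κ C.br = κ C.tr := by
  rw [C.fits_r, C.recolour_lo, C.recolour_up, C.recolour_br, C.recolour_tr]
  exact and_iff_right rfl

lemma fits_l_not_recolour : Fits C.l (!C.turn) (C.recolour κ x) ↔ κ C.bl = x ∧ κ C.tl = x := by
  rw [C.fits_l_not, C.recolour_lo, C.recolour_up, C.recolour_bl, C.recolour_tl]

lemma fits_r_not_recolour : Fits C.r (!C.turn) (C.recolour κ x) ↔ κ C.br = x ∧ κ C.tr = x := by
  rw [C.fits_r_not, C.recolour_lo, C.recolour_up, C.recolour_br, C.recolour_tr]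

/-- Closing the small circle creates a circle. -/
lemma card_circle_put (w : D.State) : Nat.card (D.Circle (C.put w C.turn C.turn)) =
    Nat.card (D.Circle (C.put w C.turn (!C.turn))) + 1 := by
  have h := card_circle_of_ne (v := C.put w C.turn (!C.turn)) (w := C.put w C.turn C.turn) (i := C.r)
    (by rw [C.put_r, C.put_r]) fun j hj => by
      rw [← C.update_put_r w C.turn C.turn, Function.update_of_ne hj]
  have hv : Valid (C.put w C.turn C.turn) (C.recolour (fun _ => false) true) :=
    C.valid_put_recolour_iff.2 ⟨C.fits_l_recolour.2 rfl, C.fits_r_recolour.2 rfl,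
      fun _ _ _ _ => rfl⟩
  have hs : numSplit (C.put w C.turn C.turn) C.r = 1 := by
    refine if_neg fun hc => ?_
    have h1 := (fits_not_iff (C.fits_r_recolour.2 rfl)).2 (hv.eq_of_circle_eq hc)
    exact Bool.false_ne_true (C.fits_r_not_recolour.1 h1).1
  omega

/-! ### Birth and death of the small circle -/

lemma coord_ext_put {y z : D.Chain}
    (h : ∀ w a b κ, Valid (C.put w a b) κ → coord y (C.put w a b) κ = coord z (C.put w a b) κ) :
    y = z := by
  refine coord_ext fun w κ hκ => ?_
  have := h w (w C.l) (w C.r) κ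
  rw [C.put_self] at this
  exact this hκ

open Classical in
/-- The projection to the resolutions that are `a` at the left and `b` at the right crossing. -/
noncomputable def corner (a b : Bool) : Module.End BNRing D.Chain :=
  LinearMap.pi fun w => if w C.l = a ∧ w C.r = b then LinearMap.proj w else 0

open Classical in
lemma coord_corner (a b : Bool) (y : D.Chain) (w : D.State) (a' b' : Bool) (κ : D.Arc → Bool) :
    coord (C.corner a b y) (C.put w a' b') κ =
      if a' = a ∧ b' = b then coord y (C.put w a' b') κ else 0 := by
  have h1 : C.corner a b y (C.put w a' b') =
      if a' = a ∧ b' = b then y (C.put w a' b') else 0 := by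
    rw [corner, LinearMap.pi_apply, C.put_l, C.put_r]
    split_ifs <;> rfl
  unfold coord
  rw [h1]
  split_ifs <;> simp

open Classical in
lemma coord_saddleAt_l (d : Bool) (y : D.Chain) (w : D.State) (a b : Bool) (κ : D.Arc → Bool) :
    coord (saddleAt C.l d y) (C.put w a b) κ =
      if a = d ∧ Fits C.l d κ then T * coord y (C.put w (!d) b) κ else 0 := by
  rw [coord_saddleAt, C.put_l, C.update_put_l]

open Classical in
lemma coord_saddleAt_r (d : Bool) (y : D.Chain) (w : D.State) (a b : Bool) (κ : D.Arc → Bool) :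
    coord (saddleAt C.r d y) (C.put w a b) κ =
      if b = d ∧ Fits C.r d κ then T * coord y (C.put w a (!d)) κ else 0 := by
  rw [coord_saddleAt, C.put_r, C.update_put_r]

open Classical in
/-- The birth of the small circle, with value `1`, where the left crossing is turned: at the right
crossing, the strand through `br` and `tr` is separated from the small circle. -/
noncomputable def birth : Module.End BNRing D.Chain :=
  C.corner C.turn C.turn ∘ₗ transport (fun w => Function.update w C.r (!C.turn))
    fun a => if a = C.lo ∨ a = C.up then C.br else a

open Classical in
lemma coord_birth_of_valid (y : D.Chain) {w : D.State} {a b : Bool} {κ : D.Arc → Bool}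
    (hκ : Valid (C.put w a b) κ) : coord (C.birth y) (C.put w a b) κ =
      if a = C.turn ∧ b = C.turn then
        T⁻¹ * coord y (C.put w C.turn (!C.turn)) (C.recolour κ (κ C.br)) else 0 := by
  rw [birth, LinearMap.comp_apply, coord_corner]
  split_ifs with h
  · obtain ⟨rfl, rfl⟩ := h
    have hc : κ ∘ (fun a => if a = C.lo ∨ a = C.up then C.br else a) = C.recolour κ (κ C.br) := by
      funext a
      simp only [Function.comp_apply, recolour]
      split_ifs <;> rfl
    have hκ' := C.valid_put_iff.1 hκ
    rw [C.fits_l, C.fits_r] at hκ'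
    rw [coord_transport _ _ y hκ _ 1]
    · rw [C.update_put_r, hc, pow_one]
    · rw [C.update_put_r, C.card_circle_put]
    · rw [C.update_put_r, hc]
      exact C.valid_put_recolour_iff.2 ⟨C.fits_l_recolour.2 hκ'.1.2,
        C.fits_r_not_recolour.2 ⟨rfl, hκ'.2.1.2.symm⟩, hκ'.2.2⟩
  · rfl

/-- The death of the small circle: its value is mapped by the counit. -/
noncomputable def death : Module.End BNRing D.Chain :=
  C.corner C.turn (!C.turn) ∘ₗ LinearMap.pi fun w =>
    counitAt (D.circle (Function.update w C.r C.turn) C.lo) (fun s => D.circle w (Quot.out s)) ∘ₗ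
      LinearMap.proj (Function.update w C.r C.turn)

open Classical in
lemma coord_death_of_valid (y : D.Chain) {w : D.State} {a b : Bool} {κ : D.Arc → Bool}
    (hκ : Valid (C.put w a b) κ) : coord (C.death y) (C.put w a b) κ =
      if a = C.turn ∧ b = !C.turn then
        T⁻¹ * ∑ x, coord y (C.put w C.turn C.turn) (C.recolour κ x) else 0 := by
  rw [death, LinearMap.comp_apply, coord_corner]
  split_ifs with h
  swap
  · rfl
  obtain ⟨rfl, rfl⟩ := h
  have hκ' := C.valid_put_iff.1 hκ
  rw [C.fits_l, C.fits_r_not] at hκ'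
  set v := C.put w C.turn C.turn with hv
  have hval : ∀ x, Valid v (C.recolour κ x) := fun x =>
    C.valid_put_recolour_iff.2 ⟨C.fits_l_recolour.2 hκ'.1.2,
      C.fits_r_recolour.2 (by rw [hκ'.2.1.1, hκ'.2.1.2, hκ'.1.1]), hκ'.2.2⟩
  have hsmall : Valid v (C.recolour (fun _ => false) true) :=
    C.valid_put_recolour_iff.2 ⟨C.fits_l_recolour.2 rfl, C.fits_r_recolour.2 rfl,
      fun _ _ _ _ => rfl⟩
  -- the small circle consists of `lo` and `up`
  have hout : ∀ s : D.Circle v, s = D.circle v C.lo ↔ Quot.out s = C.lo ∨ Quot.out s = C.up := by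
    intro s
    constructor
    · intro hs
      by_contra hne
      have h1 := eq_out (valid_iff.1 hsmall) C.lo
      rw [← hs, C.recolour_lo] at h1
      exact Bool.false_ne_true ((if_neg hne).symm.trans h1)
    · intro hs
      have hlu : D.circle v C.up = D.circle v C.lo := by
        by_contra hne
        have hval' : Valid v fun a => decide (D.circle v a = D.circle v C.lo) :=
          valid_iff.2 fun a b hab => by rw [circle_eq_of_joined hab]
        have h1 := (C.fits_l _).1 ((C.valid_put_iff.1 hval').1)
        exact hne (by simpa using h1.1.symm)
      have h2 : s = D.circle v (Quot.out s) := (circle_out s).symm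
      rcases hs with hs | hs <;> rw [hs] at h2
      exacts [h2, h2.trans hlu]
  have key : varH * evalState (C.put w C.turn (!C.turn)) κ
      (counitAt (D.circle v C.lo) (fun s => D.circle (C.put w C.turn (!C.turn)) (Quot.out s)) (y v)) =
      ∑ x, evalState v (C.recolour κ x) (y v) := by
    rw [evalState, evalAt_counitAt]
    refine Finset.sum_congr rfl fun x _ => ?_
    rw [evalState]
    congr 2
    funext s
    simp only [recolour, ← hout, eq_out (valid_iff.1 hκ)]
  have key' := congrArg incl key
  rw [map_mul, map_sum, incl_varH] at key'
  rw [coord_of_valid hκ, LinearMap.pi_apply, LinearMap.comp_apply, LinearMap.proj_apply,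
    C.update_put_r, ← hv]
  simp only [coord_of_valid (hval _)]
  rw [← Finset.mul_sum, ← key', hv, C.card_circle_put, ← mul_assoc, ← mul_assoc]
  congr 1
  rw [← zpow_neg_one, ← zpow_natCast, ← zpow_add₀ T_ne_zero, ← zpow_add₀ T_ne_zero]
  congr 1
  push_cast
  ring

open Classical in
lemma coord_birth (y : D.Chain) (w : D.State) (a b : Bool) (κ : D.Arc → Bool) :
    coord (C.birth y) (C.put w a b) κ =
      if (a = C.turn ∧ b = C.turn) ∧ κ C.lo = κ C.up ∧ κ C.bl = κ C.tl ∧ κ C.br = κ C.tr then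
        T⁻¹ * coord y (C.put w C.turn (!C.turn)) (C.recolour κ (κ C.br)) else 0 := by
  by_cases hv : Valid (C.put w a b) κ
  · rw [C.coord_birth_of_valid y hv]
    refine if_ctx_congr (and_iff_left_of_imp ?_).symm (fun _ => rfl) fun _ => rfl
    rintro ⟨rfl, rfl⟩
    have h := C.valid_put_iff.1 hv
    rw [C.fits_l, C.fits_r] at h
    exact ⟨h.1.1, h.1.2, h.2.1.2⟩
  · rw [coord_of_not_valid hv]
    split_ifs with h
    · obtain ⟨⟨rfl, rfl⟩, h1, h2, h3⟩ := h
      rw [coord_of_not_valid, mul_zero]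
      intro hv'
      exact hv (C.valid_put_iff.2 ⟨(C.fits_l _).2 ⟨h1, h2⟩, (C.fits_r _).2 ⟨h1, h3⟩,
        (C.valid_put_recolour_iff.1 hv').2.2⟩)
    · rfl

open Classical in
lemma coord_death (y : D.Chain) (w : D.State) (a b : Bool) (κ : D.Arc → Bool) :
    coord (C.death y) (C.put w a b) κ =
      if (a = C.turn ∧ b = !C.turn) ∧ κ C.lo = κ C.up ∧ κ C.bl = κ C.tl ∧ κ C.br = κ C.lo ∧
          κ C.tr = κ C.up then
        T⁻¹ * ∑ x, coord y (C.put w C.turn C.turn) (C.recolour κ x) else 0 := by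
  by_cases hv : Valid (C.put w a b) κ
  · rw [C.coord_death_of_valid y hv]
    refine if_ctx_congr (and_iff_left_of_imp ?_).symm (fun _ => rfl) fun _ => rfl
    rintro ⟨rfl, rfl⟩
    have h := C.valid_put_iff.1 hv
    rw [C.fits_l, C.fits_r_not] at h
    exact ⟨h.1.1, h.1.2, h.2.1⟩
  · rw [coord_of_not_valid hv]
    split_ifs with h
    · obtain ⟨⟨rfl, rfl⟩, h1, h2, h3⟩ := h
      rw [Finset.sum_eq_zero, mul_zero]
      refine fun x _ => coord_of_not_valid fun hv' => ?_
      exact hv (C.valid_put_iff.2 ⟨(C.fits_l _).2 ⟨h1, h2⟩, (C.fits_r_not _).2 h3,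
        (C.valid_put_recolour_iff.1 hv').2.2⟩)
    · rfl

end Clasp

end KnotDiagram

namespace KnotDiagram

open BNField

namespace Clasp

variable {D : KnotDiagram} (C : Clasp D)

/-! ### The relations of a clasp -/

open Classical in
lemma coord_turn_l (y : D.Chain) (w : D.State) (a b : Bool) (κ : D.Arc → Bool) :
    coord (saddleAt C.l C.turn y) (C.put w a b) κ =
      if a = C.turn ∧ κ C.lo = κ C.up ∧ κ C.bl = κ C.tl then
        T * coord y (C.put w (!C.turn) b) κ else 0 := by
  rw [coord_saddleAt_l]
  simp only [C.fits_l]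

open Classical in
lemma coord_turn_r (y : D.Chain) (w : D.State) (a b : Bool) (κ : D.Arc → Bool) :
    coord (saddleAt C.r C.turn y) (C.put w a b) κ =
      if b = C.turn ∧ κ C.lo = κ C.up ∧ κ C.br = κ C.tr then
        T * coord y (C.put w a (!C.turn)) κ else 0 := by
  rw [coord_saddleAt_r]
  simp only [C.fits_r]

open Classical in
lemma coord_turn_back_l (y : D.Chain) (w : D.State) (a b : Bool) (κ : D.Arc → Bool) :
    coord (saddleAt C.l (!C.turn) y) (C.put w a b) κ =
      if a = (!C.turn) ∧ κ C.bl = κ C.lo ∧ κ C.tl = κ C.up then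
        T * coord y (C.put w C.turn b) κ else 0 := by
  rw [coord_saddleAt_l, Bool.not_not]
  simp only [C.fits_l_not]

open Classical in
lemma coord_turn_back_r (y : D.Chain) (w : D.State) (a b : Bool) (κ : D.Arc → Bool) :
    coord (saddleAt C.r (!C.turn) y) (C.put w a b) κ =
      if b = (!C.turn) ∧ κ C.br = κ C.lo ∧ κ C.tr = κ C.up then
        T * coord y (C.put w a C.turn) κ else 0 := by
  rw [coord_saddleAt_r, Bool.not_not]
  simp only [C.fits_r_not]

/-- Chains vanish at colourings that are not constant on the arcs joined at the clasp. -/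
lemma coord_eq_zero_r (y : D.Chain) (w : D.State) (a : Bool) {κ : D.Arc → Bool}
    (h : ¬ (κ C.lo = κ C.up ∧ κ C.br = κ C.tr)) : coord y (C.put w a C.turn) κ = 0 :=
  coord_of_not_valid fun hv => h ((C.fits_r κ).1 (C.valid_put_iff.1 hv).2.1)

lemma coord_eq_zero_l_not (y : D.Chain) (w : D.State) (b : Bool) {κ : D.Arc → Bool}
    (h : ¬ (κ C.bl = κ C.lo ∧ κ C.tl = κ C.up)) : coord y (C.put w (!C.turn) b) κ = 0 :=
  coord_of_not_valid fun hv => h ((C.fits_l_not κ).1 (C.valid_put_iff.1 hv).1)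

lemma coord_eq_zero_r_not (y : D.Chain) (w : D.State) (a : Bool) {κ : D.Arc → Bool}
    (h : ¬ (κ C.br = κ C.lo ∧ κ C.tr = κ C.up)) : coord y (C.put w a (!C.turn)) κ = 0 :=
  coord_of_not_valid fun hv => h ((C.fits_r_not κ).1 (C.valid_put_iff.1 hv).2.1)

lemma corner_mul_saddleAt_l (a b : Bool) :
    C.corner a b * saddleAt C.l a = saddleAt C.l a * C.corner (!a) b := by
  classical
  refine LinearMap.ext fun y => C.coord_ext_put fun w a' b' κ _ => ?_
  simp only [Module.End.mul_apply, coord_corner, coord_saddleAt_l]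
  by_cases h1 : a' = a <;> by_cases h2 : b' = b <;> simp [h1, h2]

lemma corner_mul_saddleAt_r (a b : Bool) :
    C.corner a b * saddleAt C.r b = saddleAt C.r b * C.corner a (!b) := by
  classical
  refine LinearMap.ext fun y => C.coord_ext_put fun w a' b' κ _ => ?_
  simp only [Module.End.mul_apply, coord_corner, coord_saddleAt_r]
  by_cases h1 : a' = a <;> by_cases h2 : b' = b <;> simp [h1, h2]

lemma corner_not_mul_saddleAt_l (a b : Bool) : C.corner (!a) b * saddleAt C.l a = 0 := by
  classical
  refine LinearMap.ext fun y => C.coord_ext_put fun w a' b' κ _ => ?_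
  simp only [Module.End.mul_apply, coord_corner, coord_saddleAt_l]
  by_cases h1 : a' = a <;> simp [h1]

lemma corner_not_mul_saddleAt_r (a b : Bool) : C.corner a (!b) * saddleAt C.r b = 0 := by
  classical
  refine LinearMap.ext fun y => C.coord_ext_put fun w a' b' κ _ => ?_
  simp only [Module.End.mul_apply, coord_corner, coord_saddleAt_r]
  by_cases h1 : b' = b <;> simp [h1]

lemma saddleAt_l_mul_corner (a b : Bool) : saddleAt C.l a * C.corner a b = 0 := by
  classical
  refine LinearMap.ext fun y => C.coord_ext_put fun w a' b' κ _ => ?_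
  simp [Module.End.mul_apply, coord_corner, coord_saddleAt_l]

lemma saddleAt_r_mul_corner (a b : Bool) : saddleAt C.r b * C.corner a b = 0 := by
  classical
  refine LinearMap.ext fun y => C.coord_ext_put fun w a' b' κ _ => ?_
  simp [Module.End.mul_apply, coord_corner, coord_saddleAt_r]

lemma corner_mul_corner (a b a' b' : Bool) :
    C.corner a b * C.corner a' b' = if a = a' ∧ b = b' then C.corner a b else 0 := by
  classical
  refine LinearMap.ext fun y => C.coord_ext_put fun w a' b' κ _ => ?_
  split_ifs with h
  · obtain ⟨rfl, rfl⟩ := h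
    simp only [Module.End.mul_apply, coord_corner]
    split_ifs <;> rfl
  · simp only [Module.End.mul_apply, coord_corner, LinearMap.zero_apply, coord_zero]
    split_ifs with h1 h2
    · exact absurd ⟨h1.1.symm.trans h2.1, h1.2.symm.trans h2.2⟩ h
    all_goals rfl

lemma sum_corner (a b : Bool) :
    C.corner (!a) (!b) + C.corner a (!b) + C.corner (!a) b + C.corner a b = 1 := by
  classical
  refine LinearMap.ext fun y => C.coord_ext_put fun w a' b' κ _ => ?_
  simp only [LinearMap.add_apply, Module.End.one_apply, coord_add, coord_corner]
  cases a <;> cases b <;> cases a' <;> cases b' <;> simp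

lemma saddleAt_mul_comm {i j : D.Crossing} (hij : i ≠ j) (b b' : Bool) :
    (saddleAt i b : Module.End BNRing D.Chain) * saddleAt j b' = saddleAt j b' * saddleAt i b :=
  LinearMap.ext (saddleAt_comm hij b b')

lemma saddleAt_mul_saddleAt_mul_saddleAt (i : D.Crossing) (b : Bool) :
    (saddleAt i b : Module.End BNRing D.Chain) * saddleAt i (!b) * saddleAt i b =
      varH • saddleAt i b := by
  classical
  refine LinearMap.ext fun y => coord_ext fun w κ _ => ?_
  simp only [Module.End.mul_apply, LinearMap.smul_apply, coord_smul, coord_saddleAt,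
    Function.update_self, Function.update_idem, Bool.not_not, incl_varH]
  by_cases h1 : w i = b ∧ Fits i b κ
  swap
  · simp [h1]
  rw [if_pos h1, if_pos h1]
  by_cases h2 : Fits i (!b) κ
  · obtain ⟨rfl, h1⟩ := h1
    simp only [h1, h2, and_self, if_true]
    ring
  · rw [if_neg (fun h => h2 h.2), coord_of_not_valid fun h => h2 (valid_update.1 h).1]
    ring

/-- Where the small circle is a part of the strands at the left crossing, at most one of its two colours
is constant on circles. -/
lemma sum_recolour_l (y : D.Chain) (w : D.State) (b : Bool) (κ : D.Arc → Bool) :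
    ∑ x, coord y (C.put w (!C.turn) b) (C.recolour κ x) =
      if κ C.bl = κ C.tl then coord y (C.put w (!C.turn) b) (C.recolour κ (κ C.bl)) else 0 := by
  have h : ∀ x, ¬ (κ C.bl = x ∧ κ C.tl = x) →
      coord y (C.put w (!C.turn) b) (C.recolour κ x) = 0 := fun x hx =>
    coord_of_not_valid fun hv => hx (C.fits_l_not_recolour.1 (C.valid_put_iff.1 hv).1)
  split_ifs with hc
  · exact Finset.sum_eq_single _ (fun x _ hx => h x fun h' => hx h'.1.symm) fun h' =>
      absurd (Finset.mem_univ _) h'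
  · exact Finset.sum_eq_zero fun x _ => h x fun h' => hc (h'.1.trans h'.2.symm)

lemma sum_recolour_r (y : D.Chain) (w : D.State) (a : Bool) (κ : D.Arc → Bool) :
    ∑ x, coord y (C.put w a (!C.turn)) (C.recolour κ x) =
      if κ C.br = κ C.tr then coord y (C.put w a (!C.turn)) (C.recolour κ (κ C.br)) else 0 := by
  have h : ∀ x, ¬ (κ C.br = x ∧ κ C.tr = x) →
      coord y (C.put w a (!C.turn)) (C.recolour κ x) = 0 := fun x hx =>
    coord_of_not_valid fun hv => hx (C.fits_r_not_recolour.1 (C.valid_put_iff.1 hv).2.1)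
  split_ifs with hc
  · exact Finset.sum_eq_single _ (fun x _ hx => h x fun h' => hx h'.1.symm) fun h' =>
      absurd (Finset.mem_univ _) h'
  · exact Finset.sum_eq_zero fun x _ => h x fun h' => hc (h'.1.trans h'.2.symm)

/-- Where only the right crossing is turned, both strands at the left crossing lie on one circle, so
that the two dots there cancel. -/
lemma turn_back_mul_turn_mul_corner :
    saddleAt C.l (!C.turn) * saddleAt C.l C.turn * C.corner (!C.turn) C.turn =
      varH • C.corner (!C.turn) C.turn := by
  classical
  refine LinearMap.ext fun y => C.coord_ext_put fun w a b κ hκ => ?_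
  have hv := C.valid_put_iff.1 hκ
  simp only [Module.End.mul_apply, LinearMap.smul_apply, coord_smul, coord_turn_l,
    coord_turn_back_l, coord_corner, incl_varH]
  rcases Bool.eq_or_eq_not a C.turn with rfl | rfl <;>
    rcases Bool.eq_or_eq_not b C.turn with rfl | rfl <;>
    simp only [C.fits_l, C.fits_r, C.fits_l_not, C.fits_r_not] at hv <;>
    simp [hv.1, hv.2.1]
  ring

lemma death_mul_turn_mul_corner :
    C.death * saddleAt C.r C.turn * C.corner C.turn (!C.turn) = C.corner C.turn (!C.turn) := by
  classical
  refine LinearMap.ext fun y => C.coord_ext_put fun w a b κ hκ => ?_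
  have hv := C.valid_put_iff.1 hκ
  simp only [Module.End.mul_apply, coord_turn_r, coord_corner, coord_death]
  rcases Bool.eq_or_eq_not a C.turn with rfl | rfl <;>
    rcases Bool.eq_or_eq_not b C.turn with rfl | rfl <;>
    simp only [C.fits_l, C.fits_r, C.fits_l_not, C.fits_r_not] at hv <;>
    simp [recolour_lo, recolour_up, recolour_br, recolour_tr, hv.1, hv.2.1, T_ne_zero,
      ← Finset.mul_sum, sum_recolour_r, recolour_eq_self, -Fintype.univ_bool]

lemma corner_mul_turn_back_mul_birth :
    C.corner C.turn (!C.turn) * saddleAt C.r (!C.turn) * C.birth = C.corner C.turn (!C.turn) := by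
  classical
  refine LinearMap.ext fun y => C.coord_ext_put fun w a b κ hκ => ?_
  have hv := C.valid_put_iff.1 hκ
  simp only [Module.End.mul_apply, coord_turn_back_r, coord_corner, coord_birth]
  rcases Bool.eq_or_eq_not a C.turn with rfl | rfl <;>
    rcases Bool.eq_or_eq_not b C.turn with rfl | rfl <;>
    simp only [C.fits_l, C.fits_r, C.fits_l_not, C.fits_r_not] at hv <;>
    simp [hv.1, hv.2.1, T_ne_zero, recolour_eq_self]

lemma death_mul_birth :
    C.death * C.birth = 0 := by
  classical
  refine LinearMap.ext fun y => C.coord_ext_put fun w a b κ hκ => ?_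
  have hv := C.valid_put_iff.1 hκ
  simp only [Module.End.mul_apply, coord_birth, coord_death]
  rcases Bool.eq_or_eq_not a C.turn with rfl | rfl <;>
    rcases Bool.eq_or_eq_not b C.turn with rfl | rfl <;>
    simp only [C.fits_l, C.fits_r, C.fits_l_not, C.fits_r_not] at hv <;>
    simp [recolour_lo, recolour_up, recolour_bl, recolour_tl, recolour_br, recolour_tr,
      recolour_recolour, hv.1, hv.2.1, recolour_eq_self, BNField.two_eq_zero, -Fintype.univ_bool]

/-- Neck cutting between the small circle and the strand at the right crossing, where the left crossing is
turned. -/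
lemma neck_cutting :
    saddleAt C.r C.turn * C.death + C.birth * saddleAt C.r (!C.turn) + varH • (C.birth * C.death) =
      C.corner C.turn C.turn := by
  classical
  refine LinearMap.ext fun y => C.coord_ext_put fun w a b κ hκ => ?_
  have hv := C.valid_put_iff.1 hκ
  simp only [Module.End.mul_apply, LinearMap.smul_apply, LinearMap.add_apply, coord_smul, coord_add,
    coord_turn_r, coord_turn_back_r, coord_corner, coord_birth, coord_death, incl_varH]
  rcases Bool.eq_or_eq_not a C.turn with rfl | rfl <;>
    rcases Bool.eq_or_eq_not b C.turn with rfl | rfl <;>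
    simp only [C.fits_l, C.fits_r, C.fits_l_not, C.fits_r_not] at hv <;>
    simp [recolour_lo, recolour_up, recolour_bl, recolour_tl, recolour_br, recolour_tr,
      recolour_recolour, hv.1, hv.2.1, T_ne_zero, -Fintype.univ_bool]
  have h2 : ∀ z : BNField, z + z = 0 := CharTwo.add_self_eq_zero
  have h3 : ∀ z : BNField, T ^ 2 * (T⁻¹ * (T⁻¹ * z)) = z := fun z => by
    have := T_ne_zero
    field_simp
  rw [h3]
  split_ifs with h
  · rw [add_right_comm, h2, zero_add, C.recolour_eq_self (hv.1.1.trans h.symm) h.symm]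
  · have h4 : C.recolour κ (!κ C.tr) = κ := by
      rw [← Bool.eq_not.2 (Ne.symm h)]
      exact C.recolour_eq_self hv.1.1 rfl
    have h5 : ∀ (f : Bool → BNField) (x : Bool), ∑ x, f x = f x + f (!x) := by
      rintro f (_ | _)
      · rw [Fintype.sum_bool, add_comm]
        rfl
      · exact Fintype.sum_bool f
    rw [h5 _ (κ C.tr), h4, ← add_assoc, zero_add, h2, zero_add]

/-- Joining a new small circle to the strand at the left crossing and separating it again is `H` plus the
two dots; of these, only the dot on the small circle survives its death. -/
lemma death_mul_saddles_mul_birth :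
    C.death * saddleAt C.l C.turn * saddleAt C.l (!C.turn) * C.birth =
      C.corner C.turn (!C.turn) := by
  classical
  refine LinearMap.ext fun y => C.coord_ext_put fun w a b κ hκ => ?_
  have hv := C.valid_put_iff.1 hκ
  simp only [Module.End.mul_apply, coord_turn_l, coord_turn_back_l, coord_corner, coord_birth,
    coord_death]
  rcases Bool.eq_or_eq_not a C.turn with rfl | rfl <;>
    rcases Bool.eq_or_eq_not b C.turn with rfl | rfl <;>
    simp only [C.fits_l, C.fits_r, C.fits_l_not, C.fits_r_not] at hv <;>
    simp [recolour_lo, recolour_up, recolour_bl, recolour_tl, recolour_br, recolour_tr,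
      recolour_recolour, hv.1, hv.2.1, T_ne_zero, recolour_eq_self, -Fintype.univ_bool]

/-- Where only the right crossing is turned, turning it back is the same as closing the small circle at the
left crossing, letting it die at the right crossing, and turning the left crossing back. -/
lemma turn_back_mul_corner :
    saddleAt C.r (!C.turn) * C.corner (!C.turn) C.turn =
      saddleAt C.l (!C.turn) * C.death * saddleAt C.l C.turn := by
  classical
  refine LinearMap.ext fun y => C.coord_ext_put fun w a b κ hκ => ?_
  have hv := C.valid_put_iff.1 hκ
  simp only [Module.End.mul_apply, coord_turn_l, coord_turn_back_l, coord_turn_back_r, coord_corner,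
    coord_death]
  rcases Bool.eq_or_eq_not a C.turn with rfl | rfl <;>
    rcases Bool.eq_or_eq_not b C.turn with rfl | rfl <;>
    simp only [C.fits_l, C.fits_r, C.fits_l_not, C.fits_r_not] at hv <;>
    simp [recolour_lo, recolour_up, recolour_bl, recolour_tl, hv.1, hv.2.1, T_ne_zero,
      ← Finset.mul_sum, sum_recolour_l, -Fintype.univ_bool]
  split_ifs with h
  · rw [C.recolour_eq_self rfl h.symm]
  · rw [C.coord_eq_zero_r _ _ _ fun h' => h h'.1, mul_zero]

/-- The reverse of `turn_back_mul_corner`. -/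
lemma corner_mul_turn :
    C.corner (!C.turn) C.turn * saddleAt C.r C.turn =
      saddleAt C.l (!C.turn) * C.birth * saddleAt C.l C.turn := by
  classical
  refine LinearMap.ext fun y => C.coord_ext_put fun w a b κ hκ => ?_
  have hv := C.valid_put_iff.1 hκ
  simp only [Module.End.mul_apply, coord_turn_l, coord_turn_r, coord_turn_back_l, coord_corner,
    coord_birth]
  rcases Bool.eq_or_eq_not a C.turn with rfl | rfl <;>
    rcases Bool.eq_or_eq_not b C.turn with rfl | rfl <;>
    simp only [C.fits_l, C.fits_r, C.fits_l_not, C.fits_r_not] at hv <;>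
    simp [recolour_lo, recolour_up, recolour_bl, recolour_tl, hv.1, hv.2.1, T_ne_zero]
  by_cases h : κ C.tr = κ C.up
  · rw [C.recolour_eq_self (hv.2.1.1.trans h.symm) h.symm]
  · rw [C.coord_eq_zero_r_not _ _ _ fun h' => h h'.2, C.coord_eq_zero_l_not]
    rw [C.recolour_up, C.recolour_tl, hv.1.2]
    exact fun h' => h h'.2.symm

lemma birth_mul_corner :
    C.birth * C.corner C.turn (!C.turn) = C.birth := by
  classical
  refine LinearMap.ext fun y => C.coord_ext_put fun w a b κ hκ => ?_
  have hv := C.valid_put_iff.1 hκ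
  simp only [Module.End.mul_apply, coord_corner, coord_birth]
  rcases Bool.eq_or_eq_not a C.turn with rfl | rfl <;>
    rcases Bool.eq_or_eq_not b C.turn with rfl | rfl <;>
    simp only [C.fits_l, C.fits_r, C.fits_l_not, C.fits_r_not] at hv <;>
    simp [hv.1, hv.2.1]

lemma corner_mul_birth :
    C.corner C.turn C.turn * C.birth = C.birth := by
  classical
  refine LinearMap.ext fun y => C.coord_ext_put fun w a b κ hκ => ?_
  have hv := C.valid_put_iff.1 hκ
  simp only [Module.End.mul_apply, coord_corner, coord_birth]
  rcases Bool.eq_or_eq_not a C.turn with rfl | rfl <;>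
    rcases Bool.eq_or_eq_not b C.turn with rfl | rfl <;>
    simp only [C.fits_l, C.fits_r, C.fits_l_not, C.fits_r_not] at hv <;>
    simp [hv.1, hv.2.1]

lemma death_mul_corner :
    C.death * C.corner C.turn C.turn = C.death := by
  classical
  refine LinearMap.ext fun y => C.coord_ext_put fun w a b κ hκ => ?_
  have hv := C.valid_put_iff.1 hκ
  simp only [Module.End.mul_apply, coord_corner, coord_death]
  rcases Bool.eq_or_eq_not a C.turn with rfl | rfl <;>
    rcases Bool.eq_or_eq_not b C.turn with rfl | rfl <;>
    simp only [C.fits_l, C.fits_r, C.fits_l_not, C.fits_r_not] at hv <;>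
    simp [hv.1, hv.2.1, -Fintype.univ_bool]

lemma corner_mul_death :
    C.corner C.turn (!C.turn) * C.death = C.death := by
  classical
  refine LinearMap.ext fun y => C.coord_ext_put fun w a b κ hκ => ?_
  have hv := C.valid_put_iff.1 hκ
  simp only [Module.End.mul_apply, coord_corner, coord_death]
  rcases Bool.eq_or_eq_not a C.turn with rfl | rfl <;>
    rcases Bool.eq_or_eq_not b C.turn with rfl | rfl <;>
    simp only [C.fits_l, C.fits_r, C.fits_l_not, C.fits_r_not] at hv <;>
    simp [hv.1, hv.2.1, -Fintype.univ_bool]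

end Clasp

end KnotDiagram

namespace KnotDiagram.Clasp

open BNField TransvergentDiagram

/-! ### Symmetric clasps -/

/-- The reflection exchanges the crossings of the clasp and fixes the two arcs between them. -/
structure IsSymmetric {E : TransvergentDiagram} (C : Clasp E.toKnotDiagram) : Prop where
  τ_l : E.τ C.l = C.r
  τArc_lo : E.τArc C.lo = C.lo
  τArc_up : E.τArc C.up = C.up
  τArc_bl : E.τArc C.bl = C.br
  τArc_tl : E.τArc C.tl = C.tr

namespace IsSymmetric

variable {E : TransvergentDiagram} {C : Clasp E.toKnotDiagram}

lemma τ_r (hC : C.IsSymmetric) : E.τ C.r = C.l := by rw [← hC.τ_l, E.τ_τ]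

lemma τArc_br (hC : C.IsSymmetric) : E.τArc C.br = C.bl := by rw [← hC.τArc_bl, E.τArc_τArc]

lemma τArc_tr (hC : C.IsSymmetric) : E.τArc C.tr = C.tl := by rw [← hC.τArc_tl, E.τArc_τArc]

lemma put_comp_τ (hC : C.IsSymmetric) (w : E.State) (a b : Bool) : C.put w a b ∘ E.τ =
      C.put (w ∘ E.τ) b a := by
  rw [put, put, Function.update_comm C.l_ne_r b a (w ∘ E.τ), update_comp_τ, update_comp_τ, hC.τ_r,
    hC.τ_l]

lemma recolour_comp_τArc (hC : C.IsSymmetric) (κ : E.Arc → Bool) (x : Bool) :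
    C.recolour κ x ∘ E.τArc = C.recolour (κ ∘ E.τArc) x := by
  funext a
  have h1 : E.τArc a = C.lo ↔ a = C.lo :=
    ⟨fun h => by rw [← E.τArc_τArc a, h, hC.τArc_lo], fun h => by rw [h, hC.τArc_lo]⟩
  have h2 : E.τArc a = C.up ↔ a = C.up :=
    ⟨fun h => by rw [← E.τArc_τArc a, h, hC.τArc_up], fun h => by rw [h, hC.τArc_up]⟩
  by_cases h : a = C.lo ∨ a = C.up
  · exact (if_pos ((or_congr h1 h2).2 h)).trans (if_pos h).symm
  · exact (if_neg (mt (or_congr h1 h2).1 h)).trans (if_neg h).symm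

lemma coord_invol_put (hC : C.IsSymmetric) (y : E.Chain) (w : E.State) (a b : Bool)
    (κ : E.Arc → Bool) : coord (E.invol y) (C.put w a b) κ =
      coord y (C.put (w ∘ E.τ) b a) (κ ∘ E.τArc) := by
  rw [coord_invol, hC.put_comp_τ]

lemma invol_mul_corner (hC : C.IsSymmetric) (a : Bool) :
    (E.invol : Module.End BNRing E.Chain) * C.corner a a = C.corner a a * E.invol := by
  classical
  refine LinearMap.ext fun y => C.coord_ext_put fun w a' b' κ _ => ?_
  simp only [Module.End.mul_apply, hC.coord_invol_put, coord_corner, and_comm]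

/-- The reflection of the death at the right crossing is a death at the left crossing. -/
lemma invol_mul_death (hC : C.IsSymmetric) : (E.invol : Module.End BNRing E.Chain) * C.death =
    saddleAt C.l (!C.turn) * C.birth * C.death * E.invol := by
  classical
  refine LinearMap.ext fun y => C.coord_ext_put fun w a b κ hκ => ?_
  have hv := C.valid_put_iff.1 hκ
  simp only [Module.End.mul_apply, hC.coord_invol_put, coord_turn_back_l, coord_birth, coord_death]
  rcases Bool.eq_or_eq_not a C.turn with rfl | rfl <;>
    rcases Bool.eq_or_eq_not b C.turn with rfl | rfl <;>
    simp only [C.fits_l, C.fits_r, C.fits_l_not, C.fits_r_not] at hv <;>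
    simp [recolour_lo, recolour_up, recolour_bl, recolour_tl, recolour_br, recolour_tr,
      recolour_recolour, hv.1, hv.2.1, T_ne_zero, hC.recolour_comp_τArc, hC.τArc_lo, hC.τArc_up,
      hC.τArc_bl, hC.τArc_tl, hC.τArc_br, hC.τArc_tr, -Fintype.univ_bool]

/-- The reverse of `invol_mul_death`. -/
lemma birth_mul_invol (hC : C.IsSymmetric) : C.birth * (E.invol : Module.End BNRing E.Chain) =
    E.invol * C.birth * C.death * saddleAt C.l C.turn := by
  classical
  refine LinearMap.ext fun y => C.coord_ext_put fun w a b κ hκ => ?_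
  have hv := C.valid_put_iff.1 hκ
  simp only [Module.End.mul_apply, hC.coord_invol_put, coord_turn_l, coord_birth, coord_death]
  rcases Bool.eq_or_eq_not a C.turn with rfl | rfl <;>
    rcases Bool.eq_or_eq_not b C.turn with rfl | rfl <;>
    simp only [C.fits_l, C.fits_r, C.fits_l_not, C.fits_r_not] at hv <;>
    simp [recolour_lo, recolour_up, recolour_bl, recolour_tl, recolour_br, recolour_tr,
      recolour_recolour, hv.1, hv.2.1, T_ne_zero, hC.recolour_comp_τArc, hC.τArc_lo, hC.τArc_up,
      hC.τArc_bl, hC.τArc_tl, hC.τArc_br, hC.τArc_tr, ← Finset.mul_sum, sum_recolour_l,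
      -Fintype.univ_bool]

lemma claspRelations (hC : C.IsSymmetric) : ClaspRelations (R := Module.End BNRing E.Chain) varH
    (C.corner (!C.turn) (!C.turn)) (C.corner C.turn (!C.turn)) (C.corner (!C.turn) C.turn)
    (C.corner C.turn C.turn) (saddleAt C.l C.turn) (saddleAt C.r C.turn)
    (saddleAt C.l (!C.turn)) (saddleAt C.r (!C.turn)) C.birth C.death E.invol where
  sum_proj := C.sum_corner C.turn C.turn
  proj_p := by simp [corner_mul_corner]
  proj_c := by simp [corner_mul_corner]
  proj_pc := by simp [corner_mul_corner]
  proj_cp := by simp [corner_mul_corner]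
  u₁_p := C.corner_mul_saddleAt_l _ _
  u₁_b := C.corner_mul_saddleAt_l _ _
  p_u₁ := C.corner_not_mul_saddleAt_l _ _
  b_u₁ := C.corner_not_mul_saddleAt_l _ _
  u₁_q := C.saddleAt_l_mul_corner _ _
  u₁_c := C.saddleAt_l_mul_corner _ _
  u₂_p := C.corner_mul_saddleAt_r _ _
  u₂_q := C.corner_mul_saddleAt_r _ _
  p_u₂ := C.corner_not_mul_saddleAt_r _ _
  q_u₂ := C.corner_not_mul_saddleAt_r _ _
  u₂_c := C.saddleAt_r_mul_corner _ _
  p_v₁ := by rw [C.corner_mul_saddleAt_l, Bool.not_not]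
  b_v₁ := by rw [C.corner_mul_saddleAt_l, Bool.not_not]
  v₁_p := C.saddleAt_l_mul_corner _ _
  v₁_b := C.saddleAt_l_mul_corner _ _
  q_v₁ := by simpa using C.corner_not_mul_saddleAt_l (!C.turn) (!C.turn)
  c_v₁ := by simpa using C.corner_not_mul_saddleAt_l (!C.turn) C.turn
  p_v₂ := by rw [C.corner_mul_saddleAt_r, Bool.not_not]
  q_v₂ := by rw [C.corner_mul_saddleAt_r, Bool.not_not]
  v₂_p := C.saddleAt_r_mul_corner _ _
  v₂_q := C.saddleAt_r_mul_corner _ _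
  c_v₂ := by simpa using C.corner_not_mul_saddleAt_r C.turn (!C.turn)
  ι_q := C.birth_mul_corner
  c_ι := C.corner_mul_birth
  ε_c := C.death_mul_corner
  q_ε := C.corner_mul_death
  u_comm := saddleAt_mul_comm C.l_ne_r _ _
  v_comm := saddleAt_mul_comm C.l_ne_r.symm _ _
  u₁_v₂ := saddleAt_mul_comm C.l_ne_r _ _
  u₂_v₁ := saddleAt_mul_comm C.l_ne_r.symm _ _
  uvu := saddleAt_mul_saddleAt_mul_saddleAt _ _
  vuv := by simpa using saddleAt_mul_saddleAt_mul_saddleAt (D := E.toKnotDiagram) C.l (!C.turn)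
  vu_b := C.turn_back_mul_turn_mul_corner
  ε_u₂ := C.death_mul_turn_mul_corner
  v₂_ι := C.corner_mul_turn_back_mul_birth
  ε_ι := C.death_mul_birth
  neck := C.neck_cutting
  slide := C.death_mul_saddles_mul_birth
  v₂_eq := C.turn_back_mul_corner
  u₂_eq := C.corner_mul_turn
  I_I := E.invol_comp_invol
  I_p := hC.invol_mul_corner _
  I_c := hC.invol_mul_corner _
  I_u₁ := LinearMap.ext fun y => by
    rw [Module.End.mul_apply, invol_saddleAt, hC.τ_l]
    rfl
  I_v₁ := LinearMap.ext fun y => by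
    rw [Module.End.mul_apply, invol_saddleAt, hC.τ_l]
    rfl
  I_ε := hC.invol_mul_death
  I_ι := hC.birth_mul_invol

end IsSymmetric

end KnotDiagram.Clasp

namespace KnotDiagram.Clasp

open BNField TransvergentDiagram

/-! ### Removing a clasp -/

section

variable {D : KnotDiagram} (C : Clasp D)

lemma update_put_of_ne (w : D.State) (a b d : Bool) {i : D.Crossing} (hl : i ≠ C.l) (hr : i ≠ C.r) :
    Function.update (C.put w a b) i d = C.put (Function.update w i d) a b := by
  rw [put, put, Function.update_comm hr.symm, Function.update_comm hl.symm]

open Classical in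
lemma coord_saddleAt_of_ne {i : D.Crossing} (hl : i ≠ C.l) (hr : i ≠ C.r) (d : Bool) (y : D.Chain)
    (w : D.State) (a b : Bool) (κ : D.Arc → Bool) :
    coord (saddleAt i d y) (C.put w a b) κ =
      if w i = d ∧ Fits i d κ then T * coord y (C.put (Function.update w i !d) a b) κ else 0 := by
  rw [coord_saddleAt, C.put_of_ne w a b hl hr, C.update_put_of_ne w a b _ hl hr]

variable {i : D.Crossing}

lemma commute_saddleAt_corner (hl : i ≠ C.l) (hr : i ≠ C.r) (d a b : Bool) :
    Commute (saddleAt i d : Module.End BNRing D.Chain) (C.corner a b) := by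
  classical
  refine LinearMap.ext fun y => C.coord_ext_put fun w a' b' κ _ => ?_
  simp only [Module.End.mul_apply, coord_corner, C.coord_saddleAt_of_ne hl hr]
  split_ifs <;> simp

lemma commute_saddleAt_birth (hl : i ≠ C.l) (hr : i ≠ C.r) (d : Bool) :
    Commute (saddleAt i d : Module.End BNRing D.Chain) C.birth := by
  classical
  refine LinearMap.ext fun y => C.coord_ext_put fun w a b κ _ => ?_
  simp only [Module.End.mul_apply, coord_birth, C.coord_saddleAt_of_ne hl hr, C.fits_recolour hl hr]
  split_ifs
  · exact mul_left_comm _ _ _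
  all_goals simp

lemma commute_saddleAt_death (hl : i ≠ C.l) (hr : i ≠ C.r) (d : Bool) :
    Commute (saddleAt i d : Module.End BNRing D.Chain) C.death := by
  classical
  refine LinearMap.ext fun y => C.coord_ext_put fun w a b κ _ => ?_
  simp only [Module.End.mul_apply, coord_death, C.coord_saddleAt_of_ne hl hr, C.fits_recolour hl hr]
  split_ifs
  · rw [← Finset.mul_sum]
    exact mul_left_comm _ _ _
  all_goals simp

end

/-- The diagram `D` is obtained from `E` by replacing a clasp by the two strands of its unturned
resolution: `j` embeds the crossings of `D` in those of `E`, and `π` maps every arc of `E` to the arc of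
`D` that it becomes a part of. -/
structure Removal (D : KnotDiagram) {E : KnotDiagram} (C : Clasp E) where
  j : D.Crossing → E.Crossing
  π : E.Arc → D.Arc
  injective : Function.Injective j
  range : Set.range j = {C.l, C.r}ᶜ
  surjective : Function.Surjective π
  eq_of_π_eq : ∀ κ : E.Arc → Bool, Fits C.l (!C.turn) κ → Fits C.r (!C.turn) κ →
    ∀ e e', π e = π e' → κ e = κ e'
  fits_l : ∀ κ : D.Arc → Bool, Fits C.l (!C.turn) (κ ∘ π)
  fits_r : ∀ κ : D.Arc → Bool, Fits C.r (!C.turn) (κ ∘ π)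
  fits_j : ∀ i b (κ : D.Arc → Bool), Fits (j i) b (κ ∘ π) ↔ Fits i b κ

namespace Removal

variable {D E : KnotDiagram} {C : Clasp E} (M : Removal D C)

lemma j_ne (i : D.Crossing) : M.j i ≠ C.l ∧ M.j i ≠ C.r := by
  have h : M.j i ∈ ({C.l, C.r}ᶜ : Set E.Crossing) := M.range ▸ Set.mem_range_self i
  exact not_or.1 h

lemma exists_j_eq {i : E.Crossing} (hl : i ≠ C.l) (hr : i ≠ C.r) : ∃ i', M.j i' = i := by
  have h : i ∈ ({C.l, C.r}ᶜ : Set E.Crossing) := not_or.2 ⟨hl, hr⟩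
  rwa [← M.range] at h

/-- An arc of `E` that becomes a part of the given arc of `D`. -/
noncomputable def lift (e : D.Arc) : E.Arc := Function.surjInv M.surjective e

lemma π_lift (e : D.Arc) : M.π (M.lift e) = e := Function.surjInv_eq M.surjective e

lemma comp_π_comp_lift (κ : D.Arc → Bool) : (κ ∘ M.π) ∘ M.lift = κ := by
  funext e
  simp only [Function.comp_apply, M.π_lift]

lemma comp_lift_comp_π {κ : E.Arc → Bool} (hl : Fits C.l (!C.turn) κ) (hr : Fits C.r (!C.turn) κ) :
    (κ ∘ M.lift) ∘ M.π = κ :=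
  funext fun _ => M.eq_of_π_eq κ hl hr _ _ (M.π_lift _)

/-- The resolution of `E` that extends a resolution of `D` and is not turned at the clasp. -/
noncomputable def extend (v : D.State) : E.State := Function.extend M.j v fun _ => !C.turn

lemma extend_comp (v : D.State) : M.extend v ∘ M.j = v :=
  funext fun i => M.injective.extend_apply v (fun _ => !C.turn) i

lemma extend_eq_put (w : E.State) :
    M.extend (w ∘ M.j) = C.put w (!C.turn) (!C.turn) := by
  funext i
  by_cases hl : i = C.l
  · rw [hl, put_l]
    exact Function.extend_apply' _ _ _ fun ⟨i', h⟩ => (M.j_ne i').1 h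
  by_cases hr : i = C.r
  · rw [hr, put_r]
    exact Function.extend_apply' _ _ _ fun ⟨i', h⟩ => (M.j_ne i').2 h
  obtain ⟨i', rfl⟩ := M.exists_j_eq hl hr
  rw [C.put_of_ne w _ _ hl hr]
  exact M.injective.extend_apply _ _ _

lemma put_comp (w : E.State) (a b : Bool) : C.put w a b ∘ M.j = w ∘ M.j :=
  funext fun i => C.put_of_ne w a b (M.j_ne i).1 (M.j_ne i).2

lemma valid_comp_lift {w : E.State} {κ : E.Arc → Bool}
    (hl : Fits C.l (!C.turn) κ) (hr : Fits C.r (!C.turn) κ) :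
    Valid (w ∘ M.j) (κ ∘ M.lift) ↔ Valid (C.put w (!C.turn) (!C.turn)) κ := by
  have h : ∀ i b, Fits (M.j i) b κ ↔ Fits i b (κ ∘ M.lift) := fun i b => by
    rw [← M.fits_j, M.comp_lift_comp_π hl hr]
  rw [C.valid_put_iff]
  constructor
  · refine fun hv => ⟨hl, hr, fun i hil hir => ?_⟩
    obtain ⟨i, rfl⟩ := M.exists_j_eq hil hir
    exact (h i _).2 (hv i)
  · exact fun hv i => (h i _).1 (hv.2.2 _ (M.j_ne i).1 (M.j_ne i).2)

lemma card_circle (w : E.State) : Nat.card (D.Circle (w ∘ M.j)) =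
    Nat.card (E.Circle (C.put w (!C.turn) (!C.turn))) := by
  refine card_circle_eq M.lift M.π (fun κ hκ => ?_) fun κ hκ => ⟨?_, M.comp_π_comp_lift κ⟩
  · have h := C.valid_put_iff.1 hκ
    exact ⟨(M.valid_comp_lift h.1 h.2.1).2 hκ, M.comp_lift_comp_π h.1 h.2.1⟩
  · rw [← M.valid_comp_lift (M.fits_l κ) (M.fits_r κ), M.comp_π_comp_lift]
    exact hκ

/-- The inclusion of the complex of `D` as the unturned resolution of the clasp. -/
noncomputable def incl : D.Chain →ₗ[BNRing] E.Chain :=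
  C.corner (!C.turn) (!C.turn) ∘ₗ transport (fun w => w ∘ M.j) M.lift

open Classical in
lemma coord_incl (y : D.Chain) (w : E.State) (a b : Bool) (κ : E.Arc → Bool) :
    coord (M.incl y) (C.put w a b) κ =
      if (a = (!C.turn) ∧ b = !C.turn) ∧ Fits C.l (!C.turn) κ ∧ Fits C.r (!C.turn) κ then
        coord y (w ∘ M.j) (κ ∘ M.lift) else 0 := by
  rw [incl, LinearMap.comp_apply, coord_corner]
  by_cases h : a = (!C.turn) ∧ b = !C.turn
  swap
  · rw [if_neg h, if_neg fun h' => h h'.1]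
  obtain ⟨rfl, rfl⟩ := h
  rw [if_pos ⟨rfl, rfl⟩]
  by_cases hv : Valid (C.put w (!C.turn) (!C.turn)) κ
  · have h := C.valid_put_iff.1 hv
    rw [if_pos ⟨⟨rfl, rfl⟩, h.1, h.2.1⟩, coord_transport _ _ y hv _ 0, M.put_comp, pow_zero,
      inv_one, one_mul]
    · rw [M.put_comp, M.card_circle, add_zero]
    · rw [M.put_comp]
      exact (M.valid_comp_lift h.1 h.2.1).2 hv
  · rw [coord_of_not_valid hv]
    split_ifs with h
    · rw [coord_of_not_valid (mt (M.valid_comp_lift h.2.1 h.2.2).1 hv)]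
    · rfl

/-- The projection to the complex of `D`, the unturned resolution of the clasp. -/
noncomputable def proj : E.Chain →ₗ[BNRing] D.Chain := transport M.extend M.π

lemma extend_eq_put_extend (v : D.State) :
    M.extend v = C.put (M.extend v) (!C.turn) (!C.turn) := by
  rw [← M.extend_eq_put, M.extend_comp]

lemma coord_proj (y : E.Chain) {v : D.State} {κ : D.Arc → Bool} (hκ : Valid v κ) :
    coord (M.proj y) v κ = coord y (M.extend v) (κ ∘ M.π) := by
  rw [proj, coord_transport _ _ y hκ _ 0, pow_zero, inv_one, one_mul]
  · rw [add_zero, M.extend_eq_put_extend, ← M.card_circle, M.extend_comp]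
  · rw [M.extend_eq_put_extend, ← M.valid_comp_lift (M.fits_l κ) (M.fits_r κ), M.comp_π_comp_lift,
      M.extend_comp]
    exact hκ

lemma proj_incl (y : D.Chain) : M.proj (M.incl y) = y := by
  refine coord_ext fun v κ hκ => ?_
  rw [M.coord_proj _ hκ, M.extend_eq_put_extend, coord_incl, if_pos ⟨⟨rfl, rfl⟩, M.fits_l κ,
    M.fits_r κ⟩, M.extend_comp, M.comp_π_comp_lift]

lemma incl_proj (y : E.Chain) : M.incl (M.proj y) = C.corner (!C.turn) (!C.turn) y := by
  classical
  refine C.coord_ext_put fun w a b κ hκ => ?_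
  rw [coord_incl, coord_corner]
  by_cases h : a = (!C.turn) ∧ b = !C.turn
  · obtain ⟨rfl, rfl⟩ := h
    have h := C.valid_put_iff.1 hκ
    rw [if_pos ⟨⟨rfl, rfl⟩, h.1, h.2.1⟩, if_pos ⟨rfl, rfl⟩,
      M.coord_proj _ ((M.valid_comp_lift h.1 h.2.1).2 hκ), M.extend_eq_put,
      M.comp_lift_comp_π h.1 h.2.1]
  · rw [if_neg h, if_neg fun h' => h h'.1]

/-- The part of the differential that does not change the resolution of the clasp. -/
noncomputable def outerDiff : Module.End BNRing E.Chain := ∑ i, saddleAt (M.j i) true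

lemma diff_eq : (E.diff : Module.End BNRing E.Chain) =
    M.outerDiff + (saddleAt C.l true + saddleAt C.r true) := by
  classical
  refine LinearMap.ext fun y => ?_
  have h1 : (Finset.univ : Finset E.Crossing) =
      insert C.l (insert C.r (Finset.univ.map ⟨M.j, M.injective⟩)) := by
    ext i
    simp only [Finset.mem_univ, Finset.mem_insert, Finset.mem_map, Function.Embedding.coeFn_mk,
      true_and, true_iff]
    by_contra h
    rw [not_or, not_or] at h
    exact h.2.2 (M.exists_j_eq h.1 h.2.1)
  rw [diff_eq_sum_saddleAt, h1, Finset.sum_insert, Finset.sum_insert, Finset.sum_map, outerDiff,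
    LinearMap.add_apply, LinearMap.add_apply, LinearMap.sum_apply, ← add_assoc, add_comm]
  · rfl
  · simp only [Finset.mem_map, Function.Embedding.coeFn_mk, Finset.mem_univ, true_and]
    exact fun ⟨i, h⟩ => (M.j_ne i).2 h
  · simp only [Finset.mem_insert, Finset.mem_map, Function.Embedding.coeFn_mk, Finset.mem_univ,
      true_and, not_or]
    exact ⟨C.l_ne_r, fun ⟨i, h⟩ => (M.j_ne i).1 h⟩

lemma commute_outerDiff {f : Module.End BNRing E.Chain}
    (h : ∀ i, i ≠ C.l → i ≠ C.r → Commute (saddleAt i true) f) : Commute M.outerDiff f :=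
  Commute.sum_left _ _ _ fun i _ => h _ (M.j_ne i).1 (M.j_ne i).2

lemma incl_diff (y : D.Chain) : M.incl (D.diff y) = M.outerDiff (M.incl y) := by
  classical
  rw [diff_eq_sum_saddleAt, map_sum, outerDiff, LinearMap.sum_apply]
  refine Finset.sum_congr rfl fun i _ => C.coord_ext_put fun w a b κ _ => ?_
  have hne := M.j_ne i
  have hw : Function.update w (M.j i) (!true) ∘ M.j = Function.update (w ∘ M.j) i !true :=
    Function.update_comp_eq_of_injective w M.injective i _
  rw [coord_incl, C.coord_saddleAt_of_ne hne.1 hne.2, coord_incl, coord_saddleAt, hw]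
  by_cases h : (a = (!C.turn) ∧ b = !C.turn) ∧ Fits C.l (!C.turn) κ ∧ Fits C.r (!C.turn) κ
  · rw [if_pos h, if_pos h, ← M.fits_j, M.comp_lift_comp_π h.2.1 h.2.2]
    rfl
  · rw [if_neg h, if_neg h, mul_zero, ite_self]

end Removal

end KnotDiagram.Clasp

namespace TransvergentDiagram

open KnotDiagram BNField

variable {D E : TransvergentDiagram} {C : Clasp E.toKnotDiagram}

/-- Removing the clasp is compatible with the reflections. -/
structure IsEquivariant (M : Clasp.Removal D.toKnotDiagram C) : Prop where
  τ_j : ∀ i, E.τ (M.j i) = M.j (D.τ i)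
  π_τArc : ∀ e, M.π (E.τArc e) = D.τArc (M.π e)

lemma IsEquivariant.incl_invol {M : Clasp.Removal D.toKnotDiagram C} (hM : IsEquivariant M)
    (hC : C.IsSymmetric) (y : D.Chain) : M.incl (D.invol y) = E.invol (M.incl y) := by
  classical
  refine C.coord_ext_put fun w a b κ _ => ?_
  rw [M.coord_incl, hC.coord_invol_put, M.coord_incl, coord_invol, fits_τArc, fits_τArc, hC.τ_l,
    hC.τ_r]
  by_cases h : (a = (!C.turn) ∧ b = !C.turn) ∧ Fits C.l (!C.turn) κ ∧ Fits C.r (!C.turn) κ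
  · have hw : (w ∘ E.τ) ∘ M.j = (w ∘ M.j) ∘ D.τ := funext fun i => congrArg w (hM.τ_j i)
    have hκ : (κ ∘ E.τArc) ∘ M.lift = (κ ∘ M.lift) ∘ D.τArc := by
      funext e
      refine M.eq_of_π_eq κ h.2.1 h.2.2 _ _ ?_
      rw [hM.π_τArc, M.π_lift, M.π_lift]
    rw [if_pos h, if_pos ⟨h.1.symm, h.2.symm⟩, hw, hκ]
  · rw [if_neg h, if_neg fun h' => h ⟨h'.1.symm, h'.2.symm⟩]

/-- From the algebra of the clasp to the complexes: `F` and `G` act on the complex of `E`, of which the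
complex of `D` is the unturned part; they are composed with its inclusion and projection. -/
lemma exists_coherentSection_of_maps {M : Clasp.Removal D.toKnotDiagram C} (hM : IsEquivariant M)
    (hC : C.IsSymmetric) {u F G k m : Module.End BNRing E.Chain}
    (hd : (E.diff : Module.End BNRing E.Chain) = M.outerDiff + u)
    (hpG : C.corner (!C.turn) (!C.turn) * G = G)
    (huF : u * F = 0) (hGu : G * u = 0) (hGF : G * F = varH • C.corner (!C.turn) (!C.turn))
    (hFG : F * G + varH • 1 = u * k + k * u) (hIF : (E.invol : Module.End _ _) * F = F * E.invol)
    (hIG : (E.invol : Module.End _ _) * G = G * E.invol)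
    (hk : k * (E.invol : Module.End _ _) + (E.invol : Module.End _ _) * k = u * m + m * u)
    (hF : Commute M.outerDiff F) (hG : Commute M.outerDiff G) (hdk : Commute M.outerDiff k)
    (hdm : Commute M.outerDiff m) :
    ∃ (f : D.Chain →ₗ[BNRing] E.Chain) (g : E.Chain →ₗ[BNRing] D.Chain),
      CoherentSection 1 D E f g ∧ CoherentSection 1 E D g f := by
  have h0 : ∀ z : E.Chain, z + z = 0 := EquivariantComplex.add_self_eq_zero
  have hdiff : ∀ y, E.diff y = M.outerDiff y + u y := fun y => LinearMap.congr_fun hd y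
  have proj_corner : ∀ y, M.proj (C.corner (!C.turn) (!C.turn) y) = M.proj y := fun y => by
    rw [← M.incl_proj, M.proj_incl]
  have proj_outer : ∀ y, M.proj (M.outerDiff y) = D.diff (M.proj y) := fun y => by
    have h := LinearMap.congr_fun (M.commute_outerDiff fun i hl hr =>
      C.commute_saddleAt_corner hl hr true (!C.turn) (!C.turn)).eq y
    rw [← proj_corner, ← M.proj_incl (D.diff _), M.incl_diff, M.incl_proj]
    exact congrArg M.proj h.symm
  have proj_invol : ∀ y, M.proj (E.invol y) = D.invol (M.proj y) := fun y => by
    have h := LinearMap.congr_fun (hC.invol_mul_corner (!C.turn)) y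
    rw [← proj_corner, ← M.proj_incl (D.invol _), hM.incl_invol hC, M.incl_proj]
    exact congrArg M.proj h.symm
  have commute_add : ∀ z : Module.End BNRing E.Chain, Commute M.outerDiff z → ∀ y,
      E.diff (z y) + z (E.diff y) = (u * z + z * u) y := fun z hz y => by
    have h : M.outerDiff (z y) = z (M.outerDiff y) := LinearMap.congr_fun hz.eq y
    rw [hdiff, hdiff, map_add, h, add_add_add_comm, h0, zero_add]
    rfl
  refine ⟨F ∘ₗ M.incl, M.proj ∘ₗ G, ⟨fun y => ?_, fun y => ?_, 0, 0, fun y => ?_, fun y => ?_⟩,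
    ⟨fun y => ?_, fun y => ?_, k, m, fun y => ?_, fun y => ?_⟩⟩
  · have h1 : u (F (M.incl y)) = 0 := LinearMap.congr_fun huF _
    have h2 := LinearMap.congr_fun hF.eq (M.incl y)
    rw [LinearMap.comp_apply, LinearMap.comp_apply, hdiff, h1, add_zero, M.incl_diff]
    exact h2.symm
  · rw [LinearMap.comp_apply, LinearMap.comp_apply, hM.incl_invol hC]
    exact (LinearMap.congr_fun hIF (M.incl y)).symm
  · have h1 : G (F (M.incl y)) = varH • C.corner (!C.turn) (!C.turn) (M.incl y) :=
      LinearMap.congr_fun hGF _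
    rw [LinearMap.comp_apply, LinearMap.comp_apply, h1, map_smul, proj_corner, M.proj_incl, pow_one]
    simpa using EquivariantComplex.add_self_eq_zero (varH • y)
  · simp
  · have h1 : G (u y) = 0 := LinearMap.congr_fun hGu _
    have h2 : M.outerDiff (G y) = G (M.outerDiff y) := LinearMap.congr_fun hG.eq y
    rw [LinearMap.comp_apply, LinearMap.comp_apply, hdiff, map_add, h1, add_zero, ← h2, proj_outer]
  · rw [LinearMap.comp_apply, LinearMap.comp_apply, ← proj_invol]
    exact congrArg M.proj (LinearMap.congr_fun hIG y).symm
  · have h1 : C.corner (!C.turn) (!C.turn) (G y) = G y := LinearMap.congr_fun hpG y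
    rw [commute_add k hdk, ← hFG, LinearMap.comp_apply, LinearMap.comp_apply, M.incl_proj, h1,
      pow_one]
    rfl
  · rw [commute_add m hdm, ← hk]
    rfl

/-- The two types of clasp differ in the direction of the saddles in the differential, and the algebra
of the clasp is symmetric under reversing it. -/
lemma exists_coherentSection_of_removal {M : Clasp.Removal D.toKnotDiagram C} (hM : IsEquivariant M)
    (hC : C.IsSymmetric) :
    ∃ (f : D.Chain →ₗ[BNRing] E.Chain) (g : E.Chain →ₗ[BNRing] D.Chain),
      CoherentSection 1 D E f g ∧ CoherentSection 1 E D g f := by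
  have hp : ∀ a b, Commute M.outerDiff (C.corner a b) := fun a b =>
    M.commute_outerDiff fun i hl hr => C.commute_saddleAt_corner hl hr true a b
  have hs : ∀ b, Commute M.outerDiff (saddleAt C.l b) ∧ Commute M.outerDiff (saddleAt C.r b) :=
    fun b => ⟨M.commute_outerDiff fun i hl _ => Clasp.saddleAt_mul_comm hl true b,
      M.commute_outerDiff fun i _ hr => Clasp.saddleAt_mul_comm hr true b⟩
  have hι : Commute M.outerDiff C.birth :=
    M.commute_outerDiff fun i hl hr => C.commute_saddleAt_birth hl hr true
  have hε : Commute M.outerDiff C.death :=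
    M.commute_outerDiff fun i hl hr => C.commute_saddleAt_death hl hr true
  have hI : Commute M.outerDiff (E.invol : Module.End BNRing E.Chain) := by
    refine LinearMap.ext fun y => ?_
    simp only [Module.End.mul_apply, Clasp.Removal.outerDiff, LinearMap.sum_apply, map_sum,
      invol_saddleAt, hM.τ_j]
    exact (Equiv.sum_comp (⟨D.τ, D.τ, D.τ_τ, D.τ_τ⟩ : D.Crossing ≃ D.Crossing)
      fun i => saddleAt (M.j i) true (E.invol y)).symm
  have h0 : ∀ x : Module.End BNRing E.Chain, x + x = 0 := fun x =>
    LinearMap.ext fun y => EquivariantComplex.add_self_eq_zero (x y)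
  cases hN : C.turn
  · obtain ⟨F, G, k, m, h1, h2, h3, h4, h5, h6, h7, h8, h9, h10⟩ :=
      hC.claspRelations.reverse.exists_maps fun x => congrArg MulOpposite.op (h0 x.unop)
    obtain ⟨c1, c2, c3, c4⟩ := h10 (.op M.outerDiff) (hp _ _).op (hp _ _).op (hs _).1.op (hs _).1.op
      (hs _).2.op hε.op hι.op hI.op
    have unop {x y : (Module.End BNRing E.Chain)ᵐᵒᵖ} (h : x = y) : x.unop = y.unop := by rw [h]
    refine exists_coherentSection_of_maps hM hC
      (u := saddleAt C.l (!C.turn) + saddleAt C.r (!C.turn)) ?_ (unop h1) (unop h4)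
      (unop h3) (unop h5) ((unop h6).trans (add_comm _ _)) (unop h8).symm (unop h7).symm
      ((add_comm _ _).trans ((unop h9).trans (add_comm _ _))) c2.unop c1.unop c3.unop c4.unop
    rw [hN]
    exact M.diff_eq
  · obtain ⟨F, G, k, m, h1, h2, h3, h4, h5, h6, h7, h8, h9, h10⟩ :=
      hC.claspRelations.exists_maps h0
    obtain ⟨c1, c2, c3, c4⟩ := h10 M.outerDiff (hp _ _) (hp _ _) (hs _).1 (hs _).1 (hs _).2 hι hε hI
    refine exists_coherentSection_of_maps hM hC ?_ h2 h3 h4 h5 h6 h7 h8 h9 c1 c2 c3 c4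
    rw [hN]
    exact M.diff_eq

end TransvergentDiagram

namespace KnotDiagram

variable {D : KnotDiagram}

/-! ### Creating a clasp -/

lemma fits_iff_of_partner_eq_add_one {i : D.Crossing} {b : Bool} {s : ZMod 4}
    (hs : partner b s = s + 1) {κ : D.Arc → Bool} : Fits i b κ ↔
      κ (D.arc i s) = κ (D.arc i (s + 1)) ∧ κ (D.arc i (s + 3)) = κ (D.arc i (s + 2)) := by
  have key : ∀ (b : Bool) (s : ZMod 4), partner b s = s + 1 → partner b (s + 1) = s ∧
      partner b (s + 2) = s + 3 ∧ partner b (s + 3) = s + 2 ∧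
      ∀ k, k = s ∨ k = s + 1 ∨ k = s + 2 ∨ k = s + 3 := by decide
  obtain ⟨h1, h2, h3, hk⟩ := key b s hs
  constructor
  · intro h
    have h4 := h (s + 1)
    have h5 := h (s + 2)
    rw [h1] at h4
    rw [h2] at h5
    exact ⟨h4, h5⟩
  · rintro ⟨h4, h5⟩ k
    rcases hk k with rfl | rfl | rfl | rfl
    · rw [hs, h4]
    · rw [h1, h4]
    · rw [h2, h5]
    · rw [h3, h5]

lemma fits_iff_of_partner_eq_add_three {i : D.Crossing} {b : Bool} {s : ZMod 4}
    (hs : partner b s = s + 3) {κ : D.Arc → Bool} : Fits i b κ ↔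
      κ (D.arc i (s + 1)) = κ (D.arc i (s + 2)) ∧ κ (D.arc i s) = κ (D.arc i (s + 3)) := by
  have key : ∀ (b : Bool) (s : ZMod 4), partner b s = s + 3 → partner b (s + 1) = s + 1 + 1 ∧
      s + 1 + 1 = s + 2 ∧ s + 1 + 2 = s + 3 ∧ s + 1 + 3 = s := by decide
  obtain ⟨h1, h2, h3, h4⟩ := key b s hs
  rw [fits_iff_of_partner_eq_add_one h1, h2, h3, h4]

/-- Only two half-edges belong to an arc. -/
lemma eq_or_eq_of_arc_eq {i i' i'' : D.Crossing} {k k' k'' : ZMod 4} (hne : i ≠ i')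
    (h : D.arc i k = D.arc i' k') (h' : D.arc i'' k'' = D.arc i k) :
    (i'' = i ∧ k'' = k) ∨ (i'' = i' ∧ k'' = k') := by
  by_cases hc : (i'', k'') = (i, k)
  · exact Or.inl (Prod.ext_iff.1 hc)
  · have h1 : (i'', k'') = (i', k') := (D.arc_ends (i, k)).unique ⟨hc, h'⟩
      ⟨fun h => hne (Prod.ext_iff.1 h).1.symm, h.symm⟩
    exact Or.inr (Prod.ext_iff.1 h1)

end KnotDiagram

namespace TransvergentDiagram

open KnotDiagram

variable {D E : TransvergentDiagram}

lemma AddsClasp.exists_removal (h : AddsClasp D E) :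
    ∃ (C : Clasp E.toKnotDiagram) (M : Clasp.Removal D.toKnotDiagram C),
      IsEquivariant M ∧ C.IsSymmetric := by
  obtain ⟨l, r, p, q, j, π, o, hlr, hτ, hshift, hlo, hup, hj, hrange, hsurj, hπ, ho, harc, hτj, hπτ,
    -⟩ := h
  have parity : ∀ p q : ZMod 4, (p + q + 1 = 1 ∨ p + q + 1 = 3) →
      partner (!decide (p = 0 ∨ p = 2)) p = p + 1 ∧ partner (!decide (p = 0 ∨ p = 2)) q = q + 1 ∧
      partner (decide (p = 0 ∨ p = 2)) p = p + 3 ∧ partner (decide (p = 0 ∨ p = 2)) q = q + 3 := by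
    decide
  obtain ⟨hp1, hq1, hp3, hq3⟩ := parity p q (hshift ▸ E.shift_odd l)
  have k_ne : ∀ k : ZMod 4, k ≠ k + 1 ∧ k ≠ k + 2 ∧ k + 3 ≠ k + 1 ∧ k + 3 ≠ k + 2 ∧ k + 1 ≠ k ∧
      k + 1 ≠ k + 3 ∧ k + 2 ≠ k ∧ k + 2 ≠ k + 3 := by decide
  obtain ⟨k1, k2, k3, k4, -, -, -, -⟩ := k_ne p
  obtain ⟨-, -, -, -, k5, k6, k7, k8⟩ := k_ne q
  have on_lo : ∀ {i k}, E.arc i k = E.arc l (p + 1) → (i = l ∧ k = p + 1) ∨ (i = r ∧ k = q) :=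
    fun h => eq_or_eq_of_arc_eq hlr hlo h
  have on_up : ∀ {i k}, E.arc i k = E.arc l (p + 2) → (i = l ∧ k = p + 2) ∨ (i = r ∧ k = q + 3) :=
    fun h => eq_or_eq_of_arc_eq hlr hup h
  have ne_l : ∀ {k}, k ≠ p + 1 → k ≠ p + 2 →
      E.arc l k ≠ E.arc l (p + 1) ∧ E.arc l k ≠ E.arc l (p + 2) := fun h1 h2 =>
    ⟨fun h => (on_lo h).elim (fun h => h1 h.2) fun h => hlr h.1,
      fun h => (on_up h).elim (fun h => h2 h.2) fun h => hlr h.1⟩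
  have ne_r : ∀ {k}, k ≠ q → k ≠ q + 3 →
      E.arc r k ≠ E.arc l (p + 1) ∧ E.arc r k ≠ E.arc l (p + 2) := fun h1 h2 =>
    ⟨fun h => (on_lo h).elim (fun h => hlr h.1.symm) fun h => h1 h.2,
      fun h => (on_up h).elim (fun h => hlr h.1.symm) fun h => h2 h.2⟩
  let C : Clasp E.toKnotDiagram :=
    { l := l, r := r, lo := E.arc l (p + 1), up := E.arc l (p + 2)
      bl := E.arc l p, tl := E.arc l (p + 3), br := E.arc r (q + 1), tr := E.arc r (q + 2)
      turn := decide (p = 0 ∨ p = 2)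
      l_ne_r := hlr
      bl_ne := ne_l k1 k2
      tl_ne := ne_l k3 k4
      br_ne := ne_r k5 k6
      tr_ne := ne_r k7 k8
      fits_l_not := fun κ => fits_iff_of_partner_eq_add_one hp1
      fits_r_not := fun κ => by
        rw [fits_iff_of_partner_eq_add_one hq1, hlo, hup, eq_comm (a := κ (E.arc r q)),
          eq_comm (a := κ (E.arc r (q + 3)))]
      fits_l := fun κ => fits_iff_of_partner_eq_add_three hp3
      fits_r := fun κ => by
        rw [fits_iff_of_partner_eq_add_three hq3, hlo, hup, and_comm]
      arc_ne := fun i k hl hr => ⟨fun h => (on_lo h).elim (fun h => hl h.1) fun h => hr h.1,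
        fun h => (on_up h).elim (fun h => hl h.1) fun h => hr h.1⟩ }
  have partner_add : ∀ (b : Bool) (o k : ZMod 4), (o = 0 ∨ o = 2) →
      partner b (k + o) = partner b k + o := by decide
  let M : Clasp.Removal D.toKnotDiagram C :=
    { j := j, π := π
      injective := hj
      range := hrange
      surjective := hsurj
      eq_of_π_eq := fun κ hl hr e e' hee => by
        have hl' := (C.fits_l_not κ).1 hl
        have hr' := (C.fits_r_not κ).1 hr
        induction (hπ e e').1 hee with
        | rel a b hab =>
          rcases hab with ⟨rfl, rfl⟩ | ⟨rfl, rfl⟩ | ⟨rfl, rfl⟩ | ⟨rfl, rfl⟩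
          · exact hl'.1
          · exact hl'.2.symm
          · rw [← hlo]
            exact hr'.1.symm
          · rw [← hup]
            exact hr'.2
        | refl a => rfl
        | symm a b hab ih => exact (ih ((hπ _ _).2 hab)).symm
        | trans a b c hab hbc ih ih' => exact (ih ((hπ _ _).2 hab)).trans (ih' ((hπ _ _).2 hbc))
      fits_l := fun κ => (C.fits_l_not _).2
        ⟨congrArg κ ((hπ _ _).2 (.rel _ _ (Or.inl ⟨rfl, rfl⟩))),
          congrArg κ ((hπ _ _).2 (.rel _ _ (Or.inr (Or.inl ⟨rfl, rfl⟩)))).symm⟩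
      fits_r := fun κ => (C.fits_r_not _).2
        ⟨congrArg κ ((hπ _ _).2 (.rel _ _ (Or.inr (Or.inr (Or.inl ⟨hlo, rfl⟩))))).symm,
          congrArg κ ((hπ _ _).2 (.rel _ _ (Or.inr (Or.inr (Or.inr ⟨rfl, hup⟩)))))⟩
      fits_j := fun i b κ => by
        constructor
        · intro h k
          have := h (k + o i)
          rwa [partner_add _ _ _ (ho i), Function.comp_apply, Function.comp_apply, harc, harc] at this
        · intro h k
          have := h (k - o i)
          rwa [← harc, ← harc, ← partner_add _ _ _ (ho i), sub_add_cancel] at this }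
  have reflect : ∀ p q : ZMod 4, p + q + 1 - (p + 1) = q ∧ p + q + 1 - (p + 2) = q + 3 ∧
      p + q + 1 - p = q + 1 ∧ p + q + 1 - (p + 3) = q + 2 := by decide
  obtain ⟨r1, r2, r3, r4⟩ := reflect p q
  refine ⟨C, M, ⟨hτj, hπτ⟩, ⟨hτ, ?_, ?_, ?_, ?_⟩⟩
  all_goals
    refine (E.τArc_arc _ _).trans ?_
    rw [hτ, hshift]
  · rw [r1]
    exact hlo.symm
  · rw [r2]
    exact hup.symm
  · rw [r3]
  · rw [r4]

lemma TypeC.exists_coherentSection (h : TypeC D E) :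
    ∃ (F : D.Chain →ₗ[BNRing] E.Chain) (G : E.Chain →ₗ[BNRing] D.Chain),
      CoherentSection 1 D E F G ∧ CoherentSection 1 E D G F := by
  rcases h with h | h
  · obtain ⟨C, M, hM, hC⟩ := h.exists_removal
    exact exists_coherentSection_of_removal hM hC
  · obtain ⟨C, M, hM, hC⟩ := h.exists_removal
    obtain ⟨F, G, hFG, hGF⟩ := exists_coherentSection_of_removal hM hC
    exact ⟨G, F, hGF, hFG⟩

end TransvergentDiagram

theorem proposition3p1 (T : CrossingChangeType) (D D' : TransvergentDiagram)
    (hDD' : TransvergentDiagram.CrossingChange T D D') :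
    (∃ (f : EquivariantComplex.Hom D.CBN D'.CBN) (g : EquivariantComplex.Hom D'.CBN D.CBN),
      EquivariantComplex.CoherentlyHomotopic (A := D.CBN) (B := D.CBN)
        (f.map ≫ g.map) (varH ^ T.exponent • 𝟙 D.CBN.complex) ∧
      EquivariantComplex.CoherentlyHomotopic (A := D'.CBN) (B := D'.CBN)
        (g.map ≫ f.map) (varH ^ T.exponent • 𝟙 D'.CBN.complex) ∧
      Nonempty (Homotopy (f.cone ≫ g.cone) (varH ^ T.exponent • 𝟙 D.eqCBN)) ∧
      Nonempty (Homotopy (g.cone ≫ f.cone) (varH ^ T.exponent • 𝟙 D'.eqCBN))) ∧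
    ∀ C C' : BNComplex, Nonempty (HomotopyEquiv C D.eqCBN) → Nonempty (HomotopyEquiv C' D'.eqCBN) →
      ∃ (f : C ⟶ C') (g : C' ⟶ C),
        Nonempty (Homotopy (f ≫ g) (varH ^ T.exponent • 𝟙 C)) ∧
        Nonempty (Homotopy (g ≫ f) (varH ^ T.exponent • 𝟙 C')) := by
  cases T
  · obtain ⟨F, G, hFG, hGF⟩ := TransvergentDiagram.TypeA.exists_coherentSection hDD'
    exact exists_maps_of_coherentSection hFG hGF
  · obtain ⟨F, G, hFG, hGF⟩ := TransvergentDiagram.TypeB.exists_coherentSection hDD'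
    exact exists_maps_of_coherentSection hFG hGF
  · obtain ⟨F, G, hFG, hGF⟩ := TransvergentDiagram.TypeC.exists_coherentSection hDD'
    exact exists_maps_of_coherentSection hFG hGF
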